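/- Let $N\ge 2$, $s\in(0,1)$, $q>1$, $T>0$, $L\ge1$, let $\Omega\subset\mathbb R^N$ be open and bounded, and put $\Omega_T=\Omega\times(0,T]$. Let $K:\mathbb R^N\times\mathbb R^N\times(0,T]\to[0,\infty)$ be measurable with $$\frac{L^{-1}}{|x-y|^{N+2s}}\le K(x,y,t)\le\frac{L}{|x-y|^{N+2s}}\quad(x\neq y),\qquad K(x,y,t)=K(y,x,t),$$ for all $x,y\in\mathbb R^N$ and $t\in(0,T]$. A measurable function $u:\mathbb R^N\times(0,T]\to\mathbb R$ is called a local weak sub-solution of $$\partial_t u^q-\mathcal L^s_Ku=0\ \text{ in }\Omega_T,\qquad -\mathcal L_K^su(x,t)=2\,\mathrm{P.V.}\!\int_{\mathbb R^N}(u(x,t)-u(y,t))K(x,y,t)\,dy,$$ if $u\in C_{\rm loc}((0,T];L^{q+1}_{\rm loc}(\Omega))\cap L^2_{\rm loc}((0,T];W^{s,2}_{\rm loc}(\Omega))$ and, for all $[t_1,t_2]\subset(0,T]$, $$\int_{t_1}^{t_2}\!\int_{\mathbb R^N}\frac{|u(x,t)|}{1+|x|^{N+2s}}\,dx\,dt<\infty,$$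 and, for all $[t_1,t_2]\subset(0,T]$, all open $\tilde\Omega\Subset\Omega$ and all nonnegative $\phi\in L^2_{\rm loc}((0,T];W^{s,2}_0(\tilde\Omega))\cap W^{1,q+1}_{\rm loc}((0,T];L^{q+1}(\tilde\Omega))$, $$\int_{\tilde\Omega}|u|^{q-1}u\,\phi\,dx\Big|_{t_1}^{t_2}-\int_{t_1}^{t_2}\!\int_{\tilde\Omega}|u|^{q-1}u\,\partial_t\phi\,dx\,dt+\int_{t_1}^{t_2}\!\iint_{\mathbb R^N\times\mathbb R^N}(u(x,t)-u(y,t))(\phi(x,t)-\phi(y,t))K(x,y,t)\,dx\,dy\,dt\le0 .$$ Here $W^{s,2}_0(\tilde\Omega)$ is the space of functions in $W^{s,2}(\mathbb R^N)$ that vanish outside $\tilde\Omega$. **Theorem.** Let $u$ be a nonnegative local weak sub-solution in $\Omega_T$. If $$q\le\frac{N+2s}{N-2s},$$ then $u$ is locally bounded in $\Omega_T$: for every compact set $C\subset\Omega\times(0,T]$, $\operatorname*{ess\,sup}_{C}u<\infty$. -/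

import Mathlib

open MeasureTheory Set Filter Topology
open scoped ENNReal ContDiff

namespace FracPME

/-- `ℝ^N` with the Euclidean norm. -/
abbrev RN (N : ℕ) : Type := EuclideanSpace ℝ (Fin N)

/-- `U ⋐ Ω`: the closure of `U` is compact and contained in `Ω`. -/
def CompactlyInside {N : ℕ} (U Ω : Set (RN N)) : Prop :=
  IsCompact (closure U) ∧ closure U ⊆ Ω

/-- The squared Gagliardo seminorm
`∬_{U × U} |v(x) - v(y)|² / |x - y|^(N + 2s) dx dy`, with values in `[0, ∞]`. -/
noncomputable def gagliardoSq {N : ℕ} (s : ℝ) (U : Set (RN N)) (v : RN N → ℝ) : ℝ≥0∞ :=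
  ∫⁻ x in U, ∫⁻ y in U, ENNReal.ofReal (|v x - v y| ^ 2 / ‖x - y‖ ^ ((N : ℝ) + 2 * s))

/-- The fractional Sobolev space `W^{s,2}(U)`. -/
def MemFracSobolev {N : ℕ} (s : ℝ) (U : Set (RN N)) (v : RN N → ℝ) : Prop :=
  MemLp v 2 (volume.restrict U) ∧ gagliardoSq s U v < ⊤

/-- `W₀^{s,2}(U)`: functions in `W^{s,2}(ℝ^N)` that vanish outside `U`. -/
def MemFracSobolevZero {N : ℕ} (s : ℝ) (U : Set (RN N)) (v : RN N → ℝ) : Prop :=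
  MemFracSobolev s univ v ∧ ∀ x, x ∉ U → v x = 0

/-- The space `L²(a, b; W^{s,2}(U))`, for functions `v x t` of space and time. -/
def MemL2FracSobolev {N : ℕ} (s : ℝ) (U : Set (RN N)) (a b : ℝ) (v : RN N → ℝ → ℝ) : Prop :=
  AEMeasurable (fun z : RN N × ℝ => v z.1 z.2) (volume.restrict (U ×ˢ Ioc a b)) ∧
  (∀ᵐ t ∂(volume.restrict (Ioc a b)), MemFracSobolev s U (fun x => v x t)) ∧
  (∫⁻ t in Ioc a b,
    (eLpNorm (fun x => v x t) 2 (volume.restrict U) ^ 2 + gagliardoSq s U (fun x => v x t))) < ⊤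

/-- `v ∈ C(I; L^p(U))`, where `v(·, t)` is the value at every time `t ∈ I`. -/
def ContinuousInLp {N : ℕ} (p : ℝ) (U : Set (RN N)) (I : Set ℝ) (v : RN N → ℝ → ℝ) : Prop :=
  (∀ t ∈ I, MemLp (fun x => v x t) (ENNReal.ofReal p) (volume.restrict U)) ∧
  ∀ t₀ ∈ I, Tendsto
    (fun t => eLpNorm (fun x => v x t - v x t₀) (ENNReal.ofReal p) (volume.restrict U))
    (𝓝[I] t₀) (𝓝 0)

/-- `φ ∈ W^{1,p}_loc((0, T]; L^p(U))` with weak time derivative `φt`, where `φ` is the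
continuous representative `(0, T] → L^p(U)`, so that `φ(·, t)` makes sense for every `t`.
The weak derivative is taken in the Bochner sense: for each scalar `χ ∈ C_c^∞(0, T)` the identity
`∫ φ χ' dt = - ∫ φt χ dt` holds in `L^p(U)`, that is, almost everywhere in `U`. -/
structure MemTimeSobolev {N : ℕ} (p T : ℝ) (U : Set (RN N)) (φ φt : RN N → ℝ → ℝ) : Prop where
  memLp : ∀ a b : ℝ, 0 < a → a < b → b ≤ T →
    MemLp (fun z : RN N × ℝ => φ z.1 z.2) (ENNReal.ofReal p) (volume.restrict (U ×ˢ Ioc a b))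
  memLp_deriv : ∀ a b : ℝ, 0 < a → a < b → b ≤ T →
    MemLp (fun z : RN N × ℝ => φt z.1 z.2) (ENNReal.ofReal p) (volume.restrict (U ×ˢ Ioc a b))
  weak_deriv : ∀ χ : ℝ → ℝ, ContDiff ℝ ∞ χ → HasCompactSupport χ → tsupport χ ⊆ Ioo 0 T →
    ∀ᵐ x ∂(volume.restrict U),
      ∫ t in (0 : ℝ)..T, φ x t * deriv χ t = - ∫ t in (0 : ℝ)..T, φt x t * χ t
  continuous : ContinuousInLp p U (Ioc 0 T) φ

/-- Nonnegative test functions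
`φ ∈ L²_loc((0, T]; W₀^{s,2}(U)) ∩ W^{1,q+1}_loc((0, T]; L^{q+1}(U))`, with `φt = ∂_t φ`. -/
structure IsTestFunction {N : ℕ} (s q T : ℝ) (U : Set (RN N)) (φ φt : RN N → ℝ → ℝ) : Prop where
  nonneg : ∀ x, ∀ t ∈ Ioc 0 T, 0 ≤ φ x t
  memL2 : ∀ a b : ℝ, 0 < a → a < b → b ≤ T → MemL2FracSobolev s univ a b φ
  zero_trace : ∀ᵐ t ∂(volume.restrict (Ioc 0 T)), MemFracSobolevZero s U (fun x => φ x t)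
  eq_zero : ∀ x, x ∉ U → ∀ t ∈ Ioc 0 T, φ x t = 0
  memW : MemTimeSobolev (q + 1) T U φ φt

/-- A measurable symmetric kernel `K : ℝ^N × ℝ^N × (0, T] → [0, ∞)` with
`L⁻¹ / |x - y|^(N + 2s) ≤ K(x, y, t) ≤ L / |x - y|^(N + 2s)` off the diagonal. -/
structure IsKernel {N : ℕ} (s T L : ℝ) (K : RN N → RN N → ℝ → ℝ) : Prop where
  measurable : AEMeasurable (fun z : (RN N × RN N) × ℝ => K z.1.1 z.1.2 z.2)
    (volume.restrict (univ ×ˢ Ioc 0 T))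
  nonneg : ∀ x y, ∀ t ∈ Ioc 0 T, 0 ≤ K x y t
  symm : ∀ x y, ∀ t ∈ Ioc 0 T, K x y t = K y x t
  lower : ∀ x y, x ≠ y → ∀ t ∈ Ioc 0 T, L⁻¹ / ‖x - y‖ ^ ((N : ℝ) + 2 * s) ≤ K x y t
  upper : ∀ x y, x ≠ y → ∀ t ∈ Ioc 0 T, K x y t ≤ L / ‖x - y‖ ^ ((N : ℝ) + 2 * s)

/-- Local weak sub-solutions of `∂_t u^q - 𝓛_K^s u = 0` in `Ω_T = Ω × (0, T]`.
All integrals in the inequality converge absolutely under the preceding conditions. -/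
structure IsLocalWeakSubsolution {N : ℕ} (s q T : ℝ) (Ω : Set (RN N))
    (K : RN N → RN N → ℝ → ℝ) (u : RN N → ℝ → ℝ) : Prop where
  measurable : AEMeasurable (fun z : RN N × ℝ => u z.1 z.2) (volume.restrict (univ ×ˢ Ioc 0 T))
  /-- `u ∈ C_loc((0, T]; L^{q+1}_loc(Ω))`. -/
  continuous : ∀ U : Set (RN N), IsOpen U → CompactlyInside U Ω →
    ContinuousInLp (q + 1) U (Ioc 0 T) u
  /-- `u ∈ L²_loc((0, T]; W^{s,2}_loc(Ω))`. -/
  memL2 : ∀ U : Set (RN N), IsOpen U → CompactlyInside U Ω →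
    ∀ a b : ℝ, 0 < a → a < b → b ≤ T → MemL2FracSobolev s U a b u
  tail : ∀ t₁ t₂ : ℝ, 0 < t₁ → t₁ < t₂ → t₂ ≤ T →
    (∫⁻ t in Ioc t₁ t₂, ∫⁻ x, ENNReal.ofReal (|u x t| / (1 + ‖x‖ ^ ((N : ℝ) + 2 * s)))) < ⊤
  /-- The weak inequality. -/
  ineq : ∀ t₁ t₂ : ℝ, 0 < t₁ → t₁ < t₂ → t₂ ≤ T →
    ∀ U : Set (RN N), IsOpen U → CompactlyInside U Ω →
    ∀ φ φt : RN N → ℝ → ℝ, IsTestFunction s q T U φ φt →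
      ((∫ x in U, |u x t₂| ^ (q - 1) * u x t₂ * φ x t₂)
          - ∫ x in U, |u x t₁| ^ (q - 1) * u x t₁ * φ x t₁)
        - (∫ t in t₁..t₂, ∫ x in U, |u x t| ^ (q - 1) * u x t * φt x t)
        + (∫ t in t₁..t₂, ∫ z : RN N × RN N,
            (u z.1 t - u z.2 t) * (φ z.1 t - φ z.2 t) * K z.1 z.2 t) ≤ 0

/-- `u ∈ L^∞_loc(Ω_T)`: `u` is essentially bounded on each compact subset of `Ω × (0, T]`. -/
def LocallyBounded {N : ℕ} (T : ℝ) (Ω : Set (RN N)) (u : RN N → ℝ → ℝ) : Prop :=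
  ∀ C : Set (RN N × ℝ), IsCompact C → C ⊆ Ω ×ˢ Ioc 0 T →
    ∃ M : ℝ, ∀ᵐ z ∂(volume.restrict C), |u z.1 z.2| ≤ M

end FracPME

/-! The proof is a De Giorgi iteration on the truncations `(v - ℓ(t))_+`, where the level `ℓ(t) = k
+ F(t)` rises in time. It has four ingredients.

Energy inequality. The sub-solution inequality is only ever tested on `(t - h, t]` with functions
`ψ` of space, so no time derivative of a test function occurs. The choice is `ψ = (v(t) - ℓ(t))_+
η²`, the truncation frozen at the end time. The time term is bounded below by convexity
(`truncEnergy_sub_le`). In the form, `v(τ)` meets a truncation taken at time `t`. The mismatch is a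
double integral over `t` and the lag, and it is `o(h)` by continuity of translations in `L²`
(`CylinderSub.lag_small`). Hence slice energy plus accumulated dissipation has backward increments
whose positive parts have integral `o(h)`, and Lebesgue differentiation makes it almost everywhere
decreasing (`ae_antitone_of_shift`). The Young parameter `ε` is sent to zero afterwards
(`CylinderSub.energy_estimate`).

Tail. Interaction with points far away costs at most `(∫ψ)` times the increment of `F`, the time
integral of a multiple of the nonlocal tail (`CylinderSub.far_split`). Raising a level by `Δ` gains
at least `Δ (v - ℓ)_+` in the energy as soon as the level is at least one (`truncEnergy_level`). A
level rising exactly like `F` therefore absorbs the tail. Since the tail is integrable in time, `F`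
is bounded, and no supremum of the tail is needed.

Gain of integrability. A measure-theoretic pointwise bound (`rpow_le_energy_density`) gives `∫|f|^p
≤ C a^(2s/N) [f]²` with `p = 2 + 2s(q+1)/N`, whenever `∫|f|^(q+1) ≤ a`. The hypothesis on `q` is
equivalent to `q + 1 ≤ p`, which is what lets the `L^(q+1)` excess at a higher level be controlled
by the `L^p` norm at a lower one.

Iteration. One step (`CylinderSub.excess_step`) bounds the next excess by `A l^(-m) y^(1 + 2s/N)`,
with `A` and `m` independent of the base level `k₀`. The initial excess tends to zero as `k₀ → ∞` by
dominated convergence (`CylinderSub.tendsto_excess`). This qualitative smallness starts the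
iteration even in the equality case `q + 1 = p`. The excess then vanishes in the limit, so `v ≤ 3
k₀` on the smaller cylinder, and compactness finishes. -/

namespace FracPME

/-! ### The primitive attached to a truncation level -/

/-- `∫_ℓ^{max v ℓ} q τ^(q-1) (τ - ℓ) dτ` in closed form. -/
noncomputable def truncEnergy (q ℓ v : ℝ) : ℝ :=
  q / (q + 1) * ((max v ℓ) ^ (q + 1) - ℓ ^ (q + 1)) - ℓ * ((max v ℓ) ^ q - ℓ ^ q)

lemma mul_rpow_le_young {q a b : ℝ} (hq : 0 < q) (ha : 0 ≤ a) (hb : 0 ≤ b) :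
    a * b ^ q ≤ a ^ (q + 1) / (q + 1) + q / (q + 1) * b ^ (q + 1) := by
  have hc : (q + 1).HolderConjugate ((q + 1) / q) := by
    rw [Real.holderConjugate_iff]
    refine ⟨by linarith, ?_⟩
    field_simp
    ring
  have h := Real.young_inequality_of_nonneg ha (Real.rpow_nonneg hb q) hc
  rw [← Real.rpow_mul hb, mul_div_cancel₀ _ hq.ne'] at h
  refine h.trans (le_of_eq ?_)
  field_simp

lemma rpow_add_one_eq {q x : ℝ} (hq : 0 < q) (hx : 0 ≤ x) : x ^ (q + 1) = x * x ^ q := by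
  rw [Real.rpow_add_one' hx (by linarith), mul_comm]

lemma truncEnergy_of_le {q ℓ v : ℝ} (h : v ≤ ℓ) : truncEnergy q ℓ v = 0 := by
  simp [truncEnergy, max_eq_right h]

lemma truncEnergy_of_ge {q ℓ v : ℝ} (hq : 0 < q) (hℓ : 0 ≤ ℓ) (h : ℓ ≤ v) :
    truncEnergy q ℓ v = q / (q + 1) * v ^ (q + 1) + ℓ ^ (q + 1) / (q + 1) - ℓ * v ^ q := by
  rw [truncEnergy, max_eq_left h, rpow_add_one_eq hq hℓ]
  field_simp
  ring

lemma truncEnergy_nonneg {q ℓ v : ℝ} (hq : 0 < q) (hℓ : 0 ≤ ℓ) : 0 ≤ truncEnergy q ℓ v := by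
  rcases le_total v ℓ with h | h
  · rw [truncEnergy_of_le h]
  · rw [truncEnergy_of_ge hq hℓ h]
    linarith [mul_rpow_le_young hq hℓ (hℓ.trans h)]

lemma truncEnergy_le {q ℓ v : ℝ} (hq : 0 < q) (hℓ : 0 ≤ ℓ) (hv : 0 ≤ v) :
    truncEnergy q ℓ v ≤ v ^ (q + 1) := by
  rcases le_total v ℓ with h | h
  · rw [truncEnergy_of_le h]; positivity
  · rw [truncEnergy_of_ge hq hℓ h]
    have h1 : ℓ ^ (q + 1) ≤ ℓ * v ^ q := by
      rw [rpow_add_one_eq hq hℓ]; gcongr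
    have h2 : ℓ ^ (q + 1) / (q + 1) ≤ ℓ ^ (q + 1) :=
      div_le_self (by positivity) (by linarith)
    have h3 : q / (q + 1) * v ^ (q + 1) ≤ 1 * v ^ (q + 1) := by
      gcongr
      rw [div_le_one (by linarith)]; linarith
    linarith

/-- As a function of `v^q` the energy is convex with derivative `(v - ℓ)_+`, and this is its tangent
inequality. It replaces the chain rule for the time derivative by one valid for finite differences.
-/
lemma truncEnergy_sub_le {q ℓ v v' : ℝ} (hq : 0 < q) (hv : 0 ≤ v) (hv' : 0 ≤ v') :
    truncEnergy q ℓ v - truncEnergy q ℓ v' ≤ (v ^ q - v' ^ q) * max (v - ℓ) 0 := by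
  set m := max v ℓ with hm
  set m' := max v' ℓ with hm'
  have hm0 : 0 ≤ m := hv.trans (le_max_left _ _)
  have hm0' : 0 ≤ m' := hv'.trans (le_max_left _ _)
  have h1 : (m ^ q - m' ^ q) * (m - ℓ) ≤ (v ^ q - v' ^ q) * max (v - ℓ) 0 := by
    rcases le_total v ℓ with h | h
    · rw [hm, max_eq_right h, max_eq_right (by linarith)]; simp
    · rw [hm, max_eq_left h, max_eq_left (by linarith)]
      have : v' ^ q ≤ m' ^ q := by gcongr; exact le_max_left _ _
      nlinarith
  have e : truncEnergy q ℓ v - truncEnergy q ℓ v'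
      = q / (q + 1) * (m ^ (q + 1) - m' ^ (q + 1)) - ℓ * (m ^ q - m' ^ q) := by
    simp only [truncEnergy, ← hm, ← hm']; ring
  refine le_trans (e.trans_le ?_) h1
  · have h2 := mul_rpow_le_young hq hm0 hm0'
    have h3 := rpow_add_one_eq hq hm0
    have h4 : q / (q + 1) * m ^ (q + 1) = m * m ^ q - m ^ (q + 1) / (q + 1) := by
      rw [← h3]; field_simp; ring
    nlinarith

/-- The derivative of the energy in `ℓ` is `-(v^q - ℓ^q)`, and `v^q - ℓ^q ≥ v - ℓ` once `ℓ ≥ 1`. The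
linear gain from raising the level is what later pays for the nonlocal tail. -/
lemma truncEnergy_level {q ℓ ℓ' v : ℝ} (hq : 1 ≤ q) (hℓ : 1 ≤ ℓ) (h : ℓ ≤ ℓ') :
    truncEnergy q ℓ' v + (ℓ' - ℓ) * max (v - ℓ') 0 ≤ truncEnergy q ℓ v := by
  have hq0 : 0 < q := by linarith
  have hℓ0 : 0 ≤ ℓ := by linarith
  rcases le_total v ℓ' with hv | hv
  · rw [truncEnergy_of_le hv, max_eq_right (by linarith)]
    simpa using truncEnergy_nonneg hq0 hℓ0
  · rw [truncEnergy_of_ge hq0 (by linarith) hv, truncEnergy_of_ge hq0 hℓ0 (h.trans hv),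
      max_eq_left (by linarith)]
    have hℓ'0 : 0 ≤ ℓ' := by linarith
    have hv0 : 0 ≤ v := by linarith
    have h1 := mul_rpow_le_young hq0 hℓ0 hℓ'0
    have h2 := rpow_add_one_eq hq0 hℓ'0
    have h3 : q / (q + 1) * ℓ' ^ (q + 1) = ℓ' * ℓ' ^ q - ℓ' ^ (q + 1) / (q + 1) := by
      rw [← h2]; field_simp; ring
    have e1 : v ^ q = v * v ^ (q - 1) := by
      have := rpow_add_one_eq (q := q - 1 + 0) (x := v)
      rcases eq_or_lt_of_le hq with h5 | h5
      · rw [← h5]; simp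
      · have := rpow_add_one_eq (q := q - 1) (by linarith) hv0
        simpa using this
    have e2 : ℓ' ^ q = ℓ' * ℓ' ^ (q - 1) := by
      rcases eq_or_lt_of_le hq with h5 | h5
      · rw [← h5]; simp
      · have := rpow_add_one_eq (q := q - 1) (by linarith) hℓ'0
        simpa using this
    have h4 : ℓ' ^ (q - 1) ≤ v ^ (q - 1) :=
      Real.rpow_le_rpow hℓ'0 hv (by linarith)
    have h5 : 1 ≤ ℓ' ^ (q - 1) := Real.one_le_rpow (by linarith) (by linarith)
    have h6 : v - ℓ' ≤ v ^ q - ℓ' ^ q := by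
      rw [e1, e2]; nlinarith
    nlinarith

/-- Compare `v` with the midpoint of `ℓ` and `v` by the tangent inequality, then use superadditivity
of `r ↦ r^q`. The bound does not degenerate as the level grows. -/
lemma truncEnergy_lower {q ℓ v : ℝ} (hq : 1 ≤ q) (hℓ : 0 ≤ ℓ) (hv : 0 ≤ v) :
    (max (v - ℓ) 0 / 2) ^ (q + 1) ≤ truncEnergy q ℓ v := by
  have hq0 : 0 < q := by linarith
  rcases le_total v ℓ with h | h
  · rw [truncEnergy_of_le h, max_eq_right (by linarith)]
    simp [Real.zero_rpow (show q + 1 ≠ 0 by linarith)]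
  · rw [max_eq_left (by linarith)]
    have h1 := truncEnergy_sub_le (ℓ := ℓ) (v := (v + ℓ) / 2) (v' := v) hq0 (by linarith) hv
    have h2 := truncEnergy_nonneg (q := q) (v := (v + ℓ) / 2) hq0 hℓ
    rw [max_eq_left (by linarith)] at h1
    have h3 := Real.add_rpow_le_rpow_add (p := q) (a := (v - ℓ) / 2) (b := (v + ℓ) / 2)
      (by linarith) (by linarith) hq
    have h4 : (v - ℓ) / 2 + (v + ℓ) / 2 = v := by ring
    have h5 : (v + ℓ) / 2 - ℓ = (v - ℓ) / 2 := by ring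
    rw [h4] at h3
    rw [h5] at h1
    rw [rpow_add_one_eq hq0 (by linarith)]
    nlinarith

/-- The algebraic inequality behind the Caccioppoli estimate. -/
lemma caccioppoli_pointwise (a b ℓ η ζ : ℝ) :
    (max (a - ℓ) 0 * η - max (b - ℓ) 0 * ζ) ^ 2
        - max (a - ℓ) 0 * max (b - ℓ) 0 * (η - ζ) ^ 2
      ≤ (a - b) * (max (a - ℓ) 0 * η ^ 2 - max (b - ℓ) 0 * ζ ^ 2) := by
  -- When both values lie above the level this is an identity. When only one does, `a - b` is larger
  -- in modulus than the difference of the truncations and has the same sign.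
  rcases le_total a ℓ with h | h <;> rcases le_total b ℓ with h' | h'
  · rw [max_eq_right (by linarith), max_eq_right (by linarith)]; simp
  · rw [max_eq_right (by linarith), max_eq_left (by linarith)]
    nlinarith [mul_nonneg (mul_nonneg (sub_nonneg.2 h) (sub_nonneg.2 h')) (sq_nonneg ζ)]
  · rw [max_eq_left (by linarith), max_eq_right (by linarith)]
    nlinarith [mul_nonneg (mul_nonneg (sub_nonneg.2 h) (sub_nonneg.2 h')) (sq_nonneg η)]
  · rw [max_eq_left (by linarith), max_eq_left (by linarith)]
    nlinarith

/-! ### Measure-theoretic tools -/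

lemma exists_cutoff {N : ℕ} (x₀ : RN N) {r ρ : ℝ} (h : r < ρ) :
    ∃ η : RN N → ℝ, Continuous η ∧ (∀ x, 0 ≤ η x) ∧ (∀ x, η x ≤ 1) ∧
      (∀ x ∈ Metric.ball x₀ r, η x = 1) ∧ (∀ x, x ∉ Metric.ball x₀ ρ → η x = 0) ∧
      ∀ x y, |η x - η y| ≤ ‖x - y‖ / (ρ - r) := by
  have hd : 0 < ρ - r := by linarith
  refine ⟨fun x => max 0 (min 1 ((ρ - dist x x₀) / (ρ - r))), by fun_prop, fun x => le_max_left _ _,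
    fun x => max_le zero_le_one (min_le_left _ _), fun x hx => ?_, fun x hx => ?_, fun x y => ?_⟩
  · have : 1 ≤ (ρ - dist x x₀) / (ρ - r) := by
      rw [le_div_iff₀ hd]; linarith [Metric.mem_ball.1 hx]
    simp [this]
  · have : (ρ - dist x x₀) / (ρ - r) ≤ 0 :=
      div_nonpos_of_nonpos_of_nonneg (by simp at hx; linarith) hd.le
    exact max_eq_left ((min_le_right _ _).trans this)
  · show |max 0 (min 1 ((ρ - dist x x₀) / (ρ - r))) - max 0 (min 1 ((ρ - dist y x₀) / (ρ - r)))| ≤ _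
    rw [max_comm 0, max_comm 0]
    refine (abs_max_sub_max_le_abs _ _ _).trans ?_
    have e : (ρ - dist x x₀) / (ρ - r) - (ρ - dist y x₀) / (ρ - r)
        = (dist y x₀ - dist x x₀) / (ρ - r) := by ring
    have h1 := abs_min_sub_min_le_max 1 ((ρ - dist x x₀) / (ρ - r)) 1 ((ρ - dist y x₀) / (ρ - r))
    refine h1.trans ?_
    rw [sub_self, abs_zero, max_eq_right (abs_nonneg _), e, abs_div, abs_of_pos hd]
    gcongr
    rw [← dist_eq_norm, dist_comm x y]
    exact abs_dist_sub_le _ _ _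

/-- At two points where the primitive of `Φ` has derivative `Φ`, the difference `Φ t - Φ s` is the
limit of `h⁻¹ ∫_s^t (Φ x - Φ (x - h)) dx`. An `o(h)` bound on the positive part of the increments
makes this limit nonpositive. -/
lemma ae_antitone_of_shift {Φ : ℝ → ℝ} {a b : ℝ} (hab : a < b)
    (hΦ : IntervalIntegrable Φ volume a b)
    (H : ∀ ε > 0, ∃ δ > 0, ∀ h, 0 < h → h < δ →
      ∫⁻ t in Ioc (a + h) b, ENNReal.ofReal (Φ t - Φ (t - h)) ≤ ENNReal.ofReal (ε * h)) :
    ∃ G : Set ℝ, G ⊆ Ioo a b ∧ (∀ᵐ t ∂(volume.restrict (Ioc a b)), t ∈ G) ∧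
      ∀ s ∈ G, ∀ t ∈ G, s < t → Φ t ≤ Φ s := by
  have hd := hΦ.ae_hasDerivAt_integral
  rw [uIcc_of_le hab.le] at hd
  refine ⟨{t | t ∈ Ioo a b ∧ HasDerivAt (fun x => ∫ τ in a..x, Φ τ) (Φ t) t}, fun t ht => ht.1,
    ?_, ?_⟩
  · rw [restrict_Ioo_eq_restrict_Ioc.symm, ae_restrict_iff' measurableSet_Ioo]
    filter_upwards [hd] with t ht h
    exact ⟨h, ht ⟨h.1.le, h.2.le⟩ a ⟨le_rfl, hab.le⟩⟩
  · rintro s ⟨hs, hsd⟩ t ⟨ht, htd⟩ hst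
    set P : ℝ → ℝ := fun x => ∫ τ in a..x, Φ τ with hP
    have hint : ∀ x ∈ Icc a b, ∀ y ∈ Icc a b, IntervalIntegrable Φ volume x y := fun x hx y hy =>
      hΦ.mono_set (by
        rw [uIcc_of_le hab.le]; exact uIcc_subset_Icc hx hy)
    have key : ∀ x, HasDerivAt P (Φ x) x →
        Tendsto (fun h => h⁻¹ * (P x - P (x - h))) (𝓝[>] 0) (𝓝 (Φ x)) := by
      intro x hx
      have h1 := hx.tendsto_slope_zero
      have h2 : Tendsto (fun h : ℝ => -h) (𝓝[>] 0) (𝓝[≠] 0) := by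
        refine tendsto_nhdsWithin_of_tendsto_nhds_of_eventually_within _ ?_ ?_
        · have : Tendsto (fun h : ℝ => -h) (𝓝 0) (𝓝 (-0)) := tendsto_id.neg
          rw [neg_zero] at this
          exact this.mono_left nhdsWithin_le_nhds
        · filter_upwards [self_mem_nhdsWithin] with h hh
          simpa using (ne_of_gt hh)
      refine (h1.comp h2).congr' ?_
      filter_upwards with h
      simp only [Function.comp, smul_eq_mul, inv_neg, ← sub_eq_add_neg]
      ring
    refine le_of_forall_pos_le_add fun ε hε => ?_
    obtain ⟨δ, hδ, Hδ⟩ := H ε hε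
    have lim := (key t htd).sub (key s hsd)
    suffices Φ t - Φ s ≤ ε by linarith
    refine le_of_tendsto lim ?_
    have hev : ∀ᶠ h : ℝ in 𝓝[>] 0, h < min δ (s - a) :=
      (nhdsWithin_le_nhds (gt_mem_nhds (lt_min hδ (by linarith [hs.1]))))
    filter_upwards [self_mem_nhdsWithin, hev] with h h0 h1
    have h0 : 0 < h := h0
    have h2 : h < δ := h1.trans_le (min_le_left _ _)
    have h3 : a < s - h := by linarith [h1.trans_le (min_le_right _ _)]
    have i1 : IntervalIntegrable Φ volume s t :=
      hint s ⟨hs.1.le, hs.2.le⟩ t ⟨ht.1.le, ht.2.le⟩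
    have i2 : IntervalIntegrable (fun x => Φ (x - h)) volume s t := by
      have := hint (s - h) ⟨h3.le, by linarith [hs.2]⟩ (t - h) ⟨by linarith, by linarith [ht.2]⟩
      simpa using this.comp_sub_right h
    -- The two backward differences of the primitive telescope into a single integral of increments
    -- over `(s, t]`, to which the hypothesis applies.
    have e : (P t - P (t - h)) - (P s - P (s - h)) = ∫ x in s..t, (Φ x - Φ (x - h)) := by
      rw [intervalIntegral.integral_sub i1 i2, intervalIntegral.integral_comp_sub_right]
      simp only [hP]
      have ia : ∀ x ∈ Icc a b, IntervalIntegrable Φ volume a x :=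
        fun x hx => hint a ⟨le_rfl, hab.le⟩ x hx
      rw [← intervalIntegral.integral_interval_sub_left (ia t ⟨ht.1.le, ht.2.le⟩)
        (ia s ⟨hs.1.le, hs.2.le⟩), ← intervalIntegral.integral_interval_sub_left
        (ia (t - h) ⟨by linarith, by linarith [ht.2]⟩) (ia (s - h) ⟨h3.le, by linarith [hs.2]⟩)]
      ring
    have hle : ∫ x in s..t, (Φ x - Φ (x - h)) ≤ ε * h := by
      rw [intervalIntegral.integral_of_le hst.le]
      have j1 : IntegrableOn (fun x => Φ x - Φ (x - h)) (Ioc s t) := (i1.sub i2).1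
      have j2 : IntegrableOn (fun x => max (Φ x - Φ (x - h)) 0) (Ioc s t) := j1.pos_part
      refine le_trans (integral_mono j1 j2 fun x => le_max_left _ _) ?_
      rw [integral_eq_lintegral_of_nonneg_ae (f := fun x => max (Φ x - Φ (x - h)) 0) (ae_of_all _ fun x => le_max_right _ _)
        j2.aestronglyMeasurable]
      refine ENNReal.toReal_le_of_le_ofReal (by positivity) (le_trans ?_ (Hδ h h0 h2))
      have : ∀ x, ENNReal.ofReal (max (Φ x - Φ (x - h)) 0) = ENNReal.ofReal (Φ x - Φ (x - h)) := by
        intro x; simp [ENNReal.ofReal_max]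
      simp only [this]
      exact lintegral_mono_set (Ioc_subset_Ioc (by linarith) ht.2.le)
    rw [← mul_sub, e]
    calc h⁻¹ * _ ≤ h⁻¹ * (ε * h) := by gcongr
      _ = ε := by field_simp

/-- Fast geometric convergence. The recursion is stated through real majorants `y`, so that powers
are only taken of positive reals. -/
lemma tendsto_zero_of_superlinear {C b β : ℝ} (hC : 0 < C) (hb : 1 < b) (hβ : 0 < β) :
    ∃ δ > 0, ∀ Y : ℕ → ℝ≥0∞, Y 0 ≤ ENNReal.ofReal δ →
      (∀ n, ∀ y : ℝ, 0 < y → Y n ≤ ENNReal.ofReal y →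
        Y (n + 1) ≤ ENNReal.ofReal (C * b ^ n * y ^ (1 + β))) →
      Tendsto Y atTop (𝓝 0) := by
  have hb0 : 0 < b := by linarith
  -- The ratio satisfies `b θ^β = 1` and the starting size satisfies `C δ^β = θ`. These are exactly
  -- what is needed to propagate `Y n ≤ δ θ^n`.
  set θ := b ^ (-(1 / β)) with hθ
  have hθ0 : 0 < θ := Real.rpow_pos_of_pos hb0 _
  have hθ1 : θ < 1 := Real.rpow_lt_one_of_one_lt_of_neg hb (by rw [neg_lt_zero]; positivity)
  have hθβ : θ ^ β = b⁻¹ := by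
    rw [hθ, ← Real.rpow_mul hb0.le, ← Real.rpow_neg_one]; congr 1; field_simp
  refine ⟨(θ / C) ^ (1 / β), by positivity, fun Y h0 hY => ?_⟩
  set δ := (θ / C) ^ (1 / β) with hδ
  have hδ0 : 0 < δ := by positivity
  have hδβ : δ ^ β = θ / C := by
    rw [hδ, ← Real.rpow_mul (by positivity), one_div_mul_cancel hβ.ne', Real.rpow_one]
  have main : ∀ n, Y n ≤ ENNReal.ofReal (δ * θ ^ n) := by
    intro n
    induction n with
    | zero => simpa using h0
    | succ n ih =>
      refine (hY n _ (by positivity) ih).trans (le_of_eq ?_)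
      congr 1
      rw [Real.rpow_add (by positivity), Real.rpow_one,
        Real.mul_rpow hδ0.le (by positivity), hδβ, ← Real.rpow_natCast θ n, ← Real.rpow_mul hθ0.le,
        mul_comm (n : ℝ) β, Real.rpow_mul hθ0.le, hθβ, Real.rpow_natCast, pow_succ,
        Real.rpow_natCast, inv_pow]
      field_simp
  have lim : Tendsto (fun n : ℕ => ENNReal.ofReal (δ * θ ^ n)) atTop (𝓝 0) := by
    have : Tendsto (fun n : ℕ => δ * θ ^ n) atTop (𝓝 (δ * 0)) :=
      (tendsto_pow_atTop_nhds_zero_of_lt_one hθ0.le hθ1).const_mul _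
    rw [mul_zero] at this
    simpa using ENNReal.tendsto_ofReal this
  exact tendsto_of_tendsto_of_tendsto_of_le_of_le tendsto_const_nhds lim (fun _ => zero_le) main

/-- Continuity of translations in `L²`, for shifts of the time variable only, read off from
continuity of composition with measure-preserving maps. -/
lemma time_translation_L2 {N : ℕ} {H : (RN N × RN N) × ℝ → ℝ} (hH : MemLp H 2 volume) :
    ∀ ε > 0, ∃ δ > 0, ∀ σ : ℝ, |σ| < δ →
      ∫⁻ z : (RN N × RN N) × ℝ, ENNReal.ofReal ((H z - H (z.1, z.2 - σ)) ^ 2)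
        ≤ ENNReal.ofReal ε := by
  intro ε hε
  have : Fact ((1 : ℝ≥0∞) ≤ 2) := ⟨by norm_num⟩
  let g : C(ℝ, C((RN N × RN N) × ℝ, (RN N × RN N) × ℝ)) :=
    ContinuousMap.curry ⟨fun p : ℝ × ((RN N × RN N) × ℝ) => (p.2.1, p.2.2 - p.1), by fun_prop⟩
  have hg : ∀ σ z, g σ z = (z.1, z.2 - σ) := fun σ z => rfl
  have hm : ∀ σ, MeasurePreserving (g σ) volume volume := fun σ =>
    (MeasurePreserving.id (volume : Measure (RN N × RN N))).prod
      (measurePreserving_sub_right (volume : Measure ℝ) σ)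
  have hT := Filter.Tendsto.compMeasurePreservingLp (p := 2) (l := 𝓝 (0 : ℝ))
    (tendsto_const_nhds (x := hH.toLp H)) (g.continuous.tendsto 0) hm (hm 0) (by norm_num)
  have hD := (tendsto_iff_dist_tendsto_zero.1 hT).eventually (gt_mem_nhds (Real.sqrt_pos.2 hε))
  obtain ⟨δ, hδ, hB⟩ := Metric.eventually_nhds_iff.1 hD
  refine ⟨δ, hδ, fun σ hσ => ?_⟩
  have h1 := hB (y := σ) (by simpa using hσ)
  rw [Lp.toLp_compMeasurePreserving hH (hm σ), Lp.toLp_compMeasurePreserving hH (hm 0),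
    Lp.dist_def] at h1
  have hσm : MemLp (H ∘ g σ) 2 volume := hH.comp_measurePreserving (hm σ)
  have h0m : MemLp (H ∘ g 0) 2 volume := hH.comp_measurePreserving (hm 0)
  have h2 : eLpNorm (fun z => H (z.1, z.2 - σ) - H z) 2 volume ≤ ENNReal.ofReal (√ε) := by
    have hfin : eLpNorm (fun z => H (z.1, z.2 - σ) - H z) 2 volume ≠ ⊤ := (hσm.sub hH).2.ne
    rw [ENNReal.le_ofReal_iff_toReal_le hfin (by positivity)]
    refine le_trans (le_of_eq ?_) h1.le
    congr 1
    refine eLpNorm_congr_ae ?_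
    filter_upwards [hσm.coeFn_toLp, h0m.coeFn_toLp] with z e1 e2
    simp only [Pi.sub_apply, e1, e2, Function.comp, hg, sub_zero]
  rw [eLpNorm_eq_lintegral_rpow_enorm_toReal (by norm_num) (by norm_num)] at h2
  have h3 := ENNReal.rpow_le_rpow h2 (show (0 : ℝ) ≤ 2 by norm_num)
  rw [← ENNReal.rpow_mul, ENNReal.ofReal_rpow_of_nonneg (by positivity) (by norm_num)] at h3
  simp only [ENNReal.toReal_ofNat, one_div, isUnit_iff_ne_zero, ne_eq, OfNat.ofNat_ne_zero,
    not_false_eq_true, IsUnit.inv_mul_cancel, ENNReal.rpow_one, Real.rpow_ofNat,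
    Real.sq_sqrt hε.le] at h3
  refine le_trans (lintegral_mono fun z => ?_) h3
  rw [← sq_abs, abs_sub_comm, ← Real.norm_eq_abs, ENNReal.ofReal_pow (norm_nonneg _),
    ofReal_norm]
  exact le_of_eq (by norm_cast)

/-! ### The singular weight -/

/-- The weight `|x - y|^{-(N + 2s)}`. -/
noncomputable def wt {N : ℕ} (s : ℝ) (x y : RN N) : ℝ := (‖x - y‖ ^ ((N : ℝ) + 2 * s))⁻¹

lemma wt_nonneg {N : ℕ} (s : ℝ) (x y : RN N) : 0 ≤ wt s x y := by unfold wt; positivity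

lemma wt_symm {N : ℕ} (s : ℝ) (x y : RN N) : wt s x y = wt s y x := by
  unfold wt; rw [norm_sub_rev]

lemma measurable_wt {N : ℕ} (s : ℝ) : Measurable fun z : RN N × RN N => wt s z.1 z.2 := by
  unfold wt; fun_prop

lemma gagliardoSq_eq {N : ℕ} (s : ℝ) (U : Set (RN N)) (v : RN N → ℝ) :
    gagliardoSq s U v = ∫⁻ x in U, ∫⁻ y in U, ENNReal.ofReal ((v x - v y) ^ 2 * wt s x y) := by
  simp only [gagliardoSq, wt, div_eq_mul_inv, sq_abs]

lemma gagliardoSq_eq_prod {N : ℕ} (s : ℝ) (U : Set (RN N)) {v : RN N → ℝ} (hv : Measurable v) :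
    gagliardoSq s U v = ∫⁻ z, ENNReal.ofReal ((v z.1 - v z.2) ^ 2 * wt s z.1 z.2)
      ∂((volume.restrict U).prod (volume.restrict U)) := by
  have := measurable_wt (N := N) s
  rw [gagliardoSq_eq, lintegral_prod _ (by fun_prop)]

/-- In polar coordinates the integrand is `r^(1 - 2s)` on `(0, 1]`, integrable since `s < 1`, and
`r^(-1 - 2s)` beyond, integrable since `s > 0`. -/
lemma exists_kernel_moment {N : ℕ} (hN : 1 ≤ N) {s : ℝ} (hs0 : 0 < s) (hs1 : s < 1) :
    ∃ C : ℝ, 0 < C ∧ ∀ x : RN N,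
      ∫⁻ y, ENNReal.ofReal (min 1 (‖x - y‖ ^ 2) * wt s x y) ≤ ENNReal.ofReal C := by
  have : Nonempty (Fin N) := ⟨⟨0, hN⟩⟩
  have hint : Integrable (fun z : RN N => min 1 (‖z‖ ^ 2) * (‖z‖ ^ ((N : ℝ) + 2 * s))⁻¹) := by
    rw [integrable_fun_norm_addHaar (volume : Measure (RN N))
      (f := fun r => min 1 (r ^ 2) * (r ^ ((N : ℝ) + 2 * s))⁻¹)]
    rw [← Ioc_union_Ioi_eq_Ioi zero_le_one]
    refine IntegrableOn.union ?_ ?_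
    · have h1 : IntegrableOn (fun r : ℝ => r ^ (1 - 2 * s)) (Ioc 0 1) := by
        rw [← intervalIntegrable_iff_integrableOn_Ioc_of_le zero_le_one]
        exact intervalIntegral.intervalIntegrable_rpow' (by linarith)
      refine h1.congr_fun (fun r hr => ?_) measurableSet_Ioc
      have hr0 : 0 < r := hr.1
      have h2 : min 1 (r ^ 2) = r ^ 2 := min_eq_right (pow_le_one₀ hr0.le hr.2)
      simp only [h2, finrank_euclideanSpace, Fintype.card_fin, smul_eq_mul]
      rw [← Real.rpow_natCast r (N - 1), ← Real.rpow_natCast r 2, ← Real.rpow_neg hr0.le,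
        ← Real.rpow_add hr0, ← Real.rpow_add hr0, Nat.cast_sub hN]
      congr 1
      push_cast; ring
    · have h1 : IntegrableOn (fun r : ℝ => r ^ (-1 - 2 * s)) (Ioi 1) :=
        integrableOn_Ioi_rpow_of_lt (by linarith) zero_lt_one
      refine h1.congr_fun (fun r hr => ?_) measurableSet_Ioi
      have hr1 : 1 < r := hr
      have hr0 : 0 < r := by linarith
      have h2 : min 1 (r ^ 2) = 1 := min_eq_left (one_le_pow₀ hr1.le)
      simp only [h2, finrank_euclideanSpace, Fintype.card_fin, smul_eq_mul]
      rw [one_mul, ← Real.rpow_natCast r (N - 1), ← Real.rpow_neg hr0.le,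
        ← Real.rpow_add hr0, Nat.cast_sub hN]
      congr 1
      push_cast; ring
  have hfin : ∫⁻ z : RN N, ENNReal.ofReal (min 1 (‖z‖ ^ 2) * (‖z‖ ^ ((N : ℝ) + 2 * s))⁻¹) < ⊤ :=
    hint.lintegral_lt_top
  refine ⟨(∫⁻ z : RN N, ENNReal.ofReal (min 1 (‖z‖ ^ 2) * (‖z‖ ^ ((N : ℝ) + 2 * s))⁻¹)).toReal + 1,
    by positivity, fun x => ?_⟩
  have e := lintegral_sub_left_eq_self (μ := (volume : Measure (RN N)))
    (fun z : RN N => ENNReal.ofReal (min 1 (‖z‖ ^ 2) * (‖z‖ ^ ((N : ℝ) + 2 * s))⁻¹)) x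
  unfold wt
  rw [e]
  refine (ENNReal.le_ofReal_iff_toReal_le hfin.ne (by positivity)).2 (by linarith)

/-- A `Λ`-Lipschitz function with values in `[0, 1]` and `Λ ≥ 1` satisfies `(η x - η y)² ≤ Λ² min(1,
|x - y|²)`. -/
lemma cutoff_moment_le {N : ℕ} {s C Λ : ℝ} (hC : ∀ x : RN N,
      ∫⁻ y, ENNReal.ofReal (min 1 (‖x - y‖ ^ 2) * wt s x y) ≤ ENNReal.ofReal C) (hΛ : 1 ≤ Λ)
    {η : RN N → ℝ} (h0 : ∀ x, 0 ≤ η x) (h1 : ∀ x, η x ≤ 1)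
    (hη : ∀ x y, |η x - η y| ≤ Λ * ‖x - y‖) (x : RN N) :
    ∫⁻ y, ENNReal.ofReal ((η x - η y) ^ 2 * wt s x y) ≤ ENNReal.ofReal (Λ ^ 2 * C) := by
  rw [ENNReal.ofReal_mul (by positivity)]
  refine le_trans ?_ (mul_le_mul_right (hC x) _)
  rw [← lintegral_const_mul' _ _ ENNReal.ofReal_ne_top]
  refine lintegral_mono fun y => ?_
  rw [← ENNReal.ofReal_mul (by positivity), ← mul_assoc]
  refine ENNReal.ofReal_le_ofReal (mul_le_mul_of_nonneg_right ?_ (wt_nonneg _ _ _))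
  rw [mul_min_of_nonneg _ _ (by positivity), mul_one]
  refine le_min ?_ ?_
  · have : |η x - η y| ≤ 1 := abs_le.2 ⟨by linarith [h0 x, h1 y], by linarith [h0 y, h1 x]⟩
    rw [← sq_abs]
    nlinarith [abs_nonneg (η x - η y)]
  · rw [← sq_abs, ← mul_pow]
    exact pow_le_pow_left₀ (abs_nonneg _) (hη x y) 2

lemma far_moment_le {N : ℕ} {s C d : ℝ} (hC : ∀ x : RN N,
      ∫⁻ y, ENNReal.ofReal (min 1 (‖x - y‖ ^ 2) * wt s x y) ≤ ENNReal.ofReal C)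
    (hd : 0 < d) (hd1 : d ≤ 1) (x : RN N) (S : Set (RN N)) (hS : MeasurableSet S)
    (h : ∀ y ∈ S, d ≤ ‖x - y‖) :
    ∫⁻ y in S, ENNReal.ofReal (wt s x y) ≤ ENNReal.ofReal ((d ^ 2)⁻¹ * C) := by
  rw [ENNReal.ofReal_mul (by positivity)]
  refine le_trans ?_ (mul_le_mul_right (hC x) _)
  rw [← lintegral_const_mul' _ _ ENNReal.ofReal_ne_top]
  refine le_trans (setLIntegral_mono' hS fun y hy => ?_) (setLIntegral_le_lintegral S _)
  rw [← ENNReal.ofReal_mul (by positivity), ← mul_assoc]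
  refine ENNReal.ofReal_le_ofReal (le_mul_of_one_le_left (wt_nonneg _ _ _) ?_)
  rw [inv_mul_eq_div, one_le_div (by positivity)]
  exact le_min (by nlinarith) (pow_le_pow_left₀ hd.le (h y hy) 2)

/-- For `x` in a fixed ball and `|x - y| ≥ d`, both `1` and `|y|` are at most a constant times `|x -
y|`. This converts the kernel into the weight of the nonlocal tail. -/
lemma wt_le_of_far {N : ℕ} {s d R : ℝ} (hs0 : 0 < s) (hd : 0 < d) (x₀ : RN N) :
    ∃ c : ℝ, 0 < c ∧ ∀ x ∈ Metric.ball x₀ R, ∀ y ∉ Metric.ball x₀ (R + d),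
      wt s x y ≤ c / (1 + ‖y‖ ^ ((N : ℝ) + 2 * s)) := by
  set p : ℝ := (N : ℝ) + 2 * s with hp
  have hp0 : 0 < p := by positivity
  set X := ‖x₀‖ + |R| with hX
  refine ⟨(1 / d) ^ p + (1 + X / d) ^ p, by positivity, fun x hx y hy => ?_⟩
  have hxy : d ≤ ‖x - y‖ := by
    have h1 := dist_triangle y x x₀
    rw [Metric.mem_ball] at hx
    rw [Metric.mem_ball, not_lt] at hy
    rw [← dist_eq_norm, dist_comm]; linarith
  have hn : 0 < ‖x - y‖ := hd.trans_le hxy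
  have hxX : ‖x‖ ≤ X := by
    have h1 := norm_le_norm_add_norm_sub' x x₀
    rw [Metric.mem_ball, dist_eq_norm] at hx
    linarith [le_abs_self R]
  have hyn : ‖y‖ ≤ (1 + X / d) * ‖x - y‖ := by
    have h1 := norm_le_norm_add_norm_sub' y x
    rw [norm_sub_rev] at h1
    have h2 : X ≤ X / d * ‖x - y‖ := by
      rw [div_mul_eq_mul_div, le_div_iff₀ hd]; gcongr
    linarith
  have h1 : ‖y‖ ^ p ≤ (1 + X / d) ^ p * ‖x - y‖ ^ p := by
    rw [← Real.mul_rpow (by positivity) (by positivity)]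
    exact Real.rpow_le_rpow (norm_nonneg _) hyn hp0.le
  have h2 : 1 ≤ (1 / d) ^ p * ‖x - y‖ ^ p := by
    rw [← Real.mul_rpow (by positivity) (by positivity)]
    refine Real.one_le_rpow ?_ hp0.le
    rw [one_div, inv_mul_eq_div, one_le_div hd]; exact hxy
  rw [wt, ← hp, le_div_iff₀ (by positivity), inv_mul_le_iff₀ (by positivity)]
  linarith

/-- A pair not contained in the larger ball contributes only if one of its points lies in the
smaller one. The points are then at distance at least `d`, where the kernel has bounded mass. The
factor two counts the two orders. -/
lemma gagliardoSq_univ_le {N : ℕ} {s C d R : ℝ} (hC : ∀ x : RN N,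
      ∫⁻ y, ENNReal.ofReal (min 1 (‖x - y‖ ^ 2) * wt s x y) ≤ ENNReal.ofReal C)
    (hd : 0 < d) (hd1 : d ≤ 1) (x₀ : RN N) {f : RN N → ℝ} (hf : Measurable f)
    (h0 : ∀ x, x ∉ Metric.ball x₀ R → f x = 0) :
    gagliardoSq s univ f ≤ gagliardoSq s (Metric.ball x₀ (R + d)) f
      + ENNReal.ofReal (2 * ((d ^ 2)⁻¹ * C)) * ∫⁻ x, ENNReal.ofReal (f x ^ 2) := by
  set B := Metric.ball x₀ (R + d) with hB
  have hBm : MeasurableSet B := Metric.isOpen_ball.measurableSet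
  have hwt := measurable_wt (N := N) s
  have hoff : ∀ y ∉ B, f y = 0 := fun y hy =>
    h0 y fun h => hy (Metric.ball_subset_ball (by linarith) h)
  have hfar : ∀ x, ∫⁻ y in Bᶜ, ENNReal.ofReal ((f x - f y) ^ 2 * wt s x y)
      ≤ ENNReal.ofReal ((d ^ 2)⁻¹ * C) * ENNReal.ofReal (f x ^ 2) := by
    intro x
    have e : ∫⁻ y in Bᶜ, ENNReal.ofReal ((f x - f y) ^ 2 * wt s x y)
        = ENNReal.ofReal (f x ^ 2) * ∫⁻ y in Bᶜ, ENNReal.ofReal (wt s x y) := by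
      rw [← lintegral_const_mul' _ _ ENNReal.ofReal_ne_top]
      refine setLIntegral_congr_fun hBm.compl fun y hy => ?_
      simp only [hoff y hy, sub_zero]
      rw [ENNReal.ofReal_mul (by positivity)]
    rw [e, mul_comm]
    by_cases hx : x ∈ Metric.ball x₀ R
    · refine mul_le_mul_left (far_moment_le hC hd hd1 x _ hBm.compl fun y hy => ?_) _
      have h1 := dist_triangle y x x₀
      rw [Metric.mem_ball] at hx
      rw [hB, mem_compl_iff, Metric.mem_ball, not_lt] at hy
      rw [← dist_eq_norm, dist_comm]; linarith
    · simp [h0 x hx]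
  rw [gagliardoSq_eq, gagliardoSq_eq]
  simp only [Measure.restrict_univ]
  have hin : ∀ x, ∫⁻ y, ENNReal.ofReal ((f x - f y) ^ 2 * wt s x y)
      = (∫⁻ y in B, ENNReal.ofReal ((f x - f y) ^ 2 * wt s x y))
        + ∫⁻ y in Bᶜ, ENNReal.ofReal ((f x - f y) ^ 2 * wt s x y) := fun x =>
    (lintegral_add_compl _ hBm).symm
  have hmB : Measurable fun x => ∫⁻ y in B, ENNReal.ofReal ((f x - f y) ^ 2 * wt s x y) :=
    Measurable.lintegral_prod_right' (f := fun z : RN N × RN N =>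
      ENNReal.ofReal ((f z.1 - f z.2) ^ 2 * wt s z.1 z.2)) (by fun_prop)
  simp only [hin]
  rw [lintegral_add_left hmB, ← lintegral_add_compl
    (fun x => ∫⁻ y in B, ENNReal.ofReal ((f x - f y) ^ 2 * wt s x y)) hBm]
  have hswap : ∫⁻ x in Bᶜ, ∫⁻ y in B, ENNReal.ofReal ((f x - f y) ^ 2 * wt s x y)
      ≤ ENNReal.ofReal ((d ^ 2)⁻¹ * C) * ∫⁻ x, ENNReal.ofReal (f x ^ 2) := by
    rw [lintegral_lintegral_swap (f := fun x y => ENNReal.ofReal ((f x - f y) ^ 2 * wt s x y))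
      (by fun_prop), ← lintegral_const_mul' _ _ ENNReal.ofReal_ne_top]
    refine le_trans (setLIntegral_le_lintegral B _) (lintegral_mono fun y => ?_)
    refine le_trans (le_of_eq (lintegral_congr fun x => ?_)) (hfar y)
    rw [wt_symm s x y]
    congr 2
    ring
  have hsec : ∫⁻ x, ∫⁻ y in Bᶜ, ENNReal.ofReal ((f x - f y) ^ 2 * wt s x y)
      ≤ ENNReal.ofReal ((d ^ 2)⁻¹ * C) * ∫⁻ x, ENNReal.ofReal (f x ^ 2) := by
    rw [← lintegral_const_mul' _ _ ENNReal.ofReal_ne_top]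
    exact lintegral_mono hfar
  rw [ENNReal.ofReal_mul (by norm_num), ENNReal.ofReal_ofNat, mul_assoc, two_mul, ← add_assoc]
  gcongr

/-- Pointwise interpolation between the Gagliardo energy density and an `L^m` bound. -/
lemma rpow_le_energy_density {N : ℕ} (hN : 1 ≤ N) {s m : ℝ} (hs0 : 0 < s) (hm : 0 < m) :
    ∃ C : ℝ, 0 < C ∧ ∀ (f : RN N → ℝ) (a : ℝ), Measurable f → 0 < a →
      ∫⁻ x, ENNReal.ofReal (|f x| ^ m) ≤ ENNReal.ofReal a → ∀ x,
      ENNReal.ofReal (|f x| ^ (2 + 2 * s * m / N)) ≤ ENNReal.ofReal (C * a ^ (2 * s / N)) *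
        ∫⁻ y, ENNReal.ofReal ((f x - f y) ^ 2 * wt s x y) := by
  have hN0 : (0 : ℝ) < N := by exact_mod_cast hN
  have : Nonempty (Fin N) := ⟨⟨0, hN⟩⟩
  set ϖ : ℝ := (volume (Metric.ball (0 : RN N) 1)).toReal with hϖ
  have hϖt : volume (Metric.ball (0 : RN N) 1) ≠ ⊤ := measure_ball_lt_top.ne
  have hϖ0 : 0 < ϖ :=
    ENNReal.toReal_pos (Metric.measure_ball_pos _ _ one_pos).ne' hϖt
  refine ⟨8 / ϖ * (2 ^ (m + 1) / ϖ) ^ (2 * s / N), by positivity, fun f a hf ha hA x => ?_⟩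
  rcases eq_or_ne (f x) 0 with h0 | h0
  · rw [h0, abs_zero, Real.zero_rpow (by positivity)]; simp
  set F := |f x| with hF
  have hF0 : 0 < F := abs_pos.2 h0
  -- By Chebyshev, `b` bounds the measure of the set where `|f| ≥ F/2`. The radius `r` below gives
  -- the ball around `x` volume `2b`, so on a part of it of measure at least `b` the difference `|f
  -- x - f y|` exceeds `F/2`.
  set b : ℝ := a * 2 ^ m / F ^ m with hb
  have hb0 : 0 < b := by positivity
  set r : ℝ := (2 * b / ϖ) ^ ((N : ℝ)⁻¹) with hr
  have hr0 : 0 < r := by positivity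
  have hrN : r ^ N = 2 * b / ϖ := by
    rw [hr, ← Real.rpow_natCast, ← Real.rpow_mul (by positivity), inv_mul_cancel₀ hN0.ne',
      Real.rpow_one]
  set T := {y | F / 2 ≤ |f y|} with hT
  have hTm : MeasurableSet T := measurableSet_le measurable_const (by fun_prop)
  have hTb : volume T ≤ ENNReal.ofReal b := by
    have h1 := mul_meas_ge_le_lintegral (μ := (volume : Measure (RN N)))
      (f := fun y => ENNReal.ofReal (|f y| ^ m)) (by fun_prop) (ENNReal.ofReal ((F / 2) ^ m))
    have h2 : volume T ≤ volume {y | ENNReal.ofReal ((F / 2) ^ m) ≤ ENNReal.ofReal (|f y| ^ m)} :=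
      measure_mono fun y hy => ENNReal.ofReal_le_ofReal
        (Real.rpow_le_rpow (by positivity) hy hm.le)
    have hpos : 0 < (F / 2) ^ m := by positivity
    have h3 : ENNReal.ofReal ((F / 2) ^ m) * volume T ≤ ENNReal.ofReal a :=
      (mul_le_mul_right h2 _).trans (h1.trans hA)
    rw [mul_comm, ← ENNReal.le_div_iff_mul_le (Or.inl (by simpa using hpos))
      (Or.inl ENNReal.ofReal_ne_top), ← ENNReal.ofReal_div_of_pos hpos] at h3
    refine h3.trans (le_of_eq ?_)
    rw [hb, Real.div_rpow hF0.le (by norm_num)]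
    congr 1
    field_simp
  have hball : volume (Metric.ball x r) = ENNReal.ofReal (2 * b) := by
    rw [Measure.addHaar_ball _ _ hr0.le, finrank_euclideanSpace, Fintype.card_fin, hrN,
      ← ENNReal.ofReal_toReal hϖt, ← hϖ, ← ENNReal.ofReal_mul (by positivity)]
    congr 1
    field_simp
  have hdiff : ENNReal.ofReal b ≤ volume (Metric.ball x r \ T) := by
    refine le_trans ?_ (le_measure_sdiff)
    rw [hball]
    refine le_trans ?_ (tsub_le_tsub_left hTb _)
    rw [← ENNReal.ofReal_sub _ hb0.le]
    exact ENNReal.ofReal_le_ofReal (by linarith)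
  have hlow : ENNReal.ofReal (F ^ 2 / 4 * (r ^ ((N : ℝ) + 2 * s))⁻¹) * ENNReal.ofReal b
      ≤ ∫⁻ y, ENNReal.ofReal ((f x - f y) ^ 2 * wt s x y) := by
    refine le_trans (mul_le_mul_right hdiff _) ?_
    rw [← setLIntegral_const]
    refine le_trans (setLIntegral_mono' (Metric.isOpen_ball.measurableSet.diff hTm)
      fun y hy => ?_) (setLIntegral_le_lintegral _ _)
    have hyT : |f y| < F / 2 := not_le.1 hy.2
    have hxy : 0 < ‖x - y‖ := by
      rw [norm_pos_iff, sub_ne_zero]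
      rintro rfl
      exact absurd hyT (by linarith)
    have hyr : ‖x - y‖ < r := by
      rw [← dist_eq_norm, dist_comm]; exact hy.1
    refine ENNReal.ofReal_le_ofReal (mul_le_mul ?_ ?_ (by positivity) (sq_nonneg _))
    · have h1 : F / 2 ≤ |f x - f y| := by
        have := abs_sub_abs_le_abs_sub (f x) (f y)
        linarith
      rw [← sq_abs (f x - f y)]
      nlinarith
    · unfold wt
      gcongr
  have hr2 : r ^ (2 * s) = (2 ^ (m + 1) / ϖ) ^ (2 * s / N) * a ^ (2 * s / N)
      / F ^ (2 * s * m / N) := by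
    have e1 : 2 * b / ϖ = 2 ^ (m + 1) / ϖ * a / F ^ m := by
      rw [hb, Real.rpow_add_one (by norm_num)]; ring
    rw [hr, ← Real.rpow_mul (by positivity), e1, Real.div_rpow (by positivity) (by positivity),
      Real.mul_rpow (by positivity) ha.le, ← Real.rpow_mul hF0.le]
    congr 2
    · ring_nf
    · ring_nf
    · ring_nf
  refine le_trans (le_of_eq ?_) (mul_le_mul_right hlow _)
  rw [← ENNReal.ofReal_mul (by positivity), ← ENNReal.ofReal_mul (by positivity)]
  congr 1
  -- The factor `b` cancels against `r^N`, leaving `F² r^(-2s)`. Since `r` scales like `(a /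
  -- F^m)^(1/N)`, this is the claimed power of `F`.
  have e2 : r ^ ((N : ℝ) + 2 * s) = 2 * b / ϖ * r ^ (2 * s) := by
    rw [Real.rpow_add hr0, Real.rpow_natCast, hrN]
  rw [e2, hr2, Real.rpow_add hF0, Real.rpow_two]
  field_simp
  ring

/-- The Gagliardo–Nirenberg type inequality obtained by integrating the pointwise bound. -/
lemma lintegral_rpow_le_gagliardoSq {N : ℕ} (hN : 1 ≤ N) {s m : ℝ} (hs0 : 0 < s) (hm : 0 < m) :
    ∃ C : ℝ, 0 < C ∧ ∀ (f : RN N → ℝ) (a : ℝ), Measurable f → 0 < a →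
      ∫⁻ x, ENNReal.ofReal (|f x| ^ m) ≤ ENNReal.ofReal a →
      ∫⁻ x, ENNReal.ofReal (|f x| ^ (2 + 2 * s * m / N)) ≤
        ENNReal.ofReal (C * a ^ (2 * s / N)) * gagliardoSq s univ f := by
  obtain ⟨C, hC, h⟩ := rpow_le_energy_density hN hs0 hm
  refine ⟨C, hC, fun f a hf ha hA => ?_⟩
  rw [gagliardoSq_eq, ← lintegral_const_mul' _ _ ENNReal.ofReal_ne_top]
  simp only [Measure.restrict_univ]
  exact lintegral_mono (h f a hf ha hA)

/-! ### Cut-offs and the Gagliardo seminorm -/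

/-- `η` takes values in `[0, 1]` and is `Λ`-Lipschitz. -/
structure IsCutoff {N : ℕ} (Λ : ℝ) (η : RN N → ℝ) : Prop where
  one_le : 1 ≤ Λ
  cont : Continuous η
  nonneg : ∀ x, 0 ≤ η x
  le_one : ∀ x, η x ≤ 1
  lip : ∀ x y, |η x - η y| ≤ Λ * ‖x - y‖

lemma IsCutoff.sq {N : ℕ} {Λ : ℝ} {η : RN N → ℝ} (h : IsCutoff Λ η) :
    IsCutoff (2 * Λ) (fun x => η x ^ 2) where
  one_le := by linarith [h.one_le]
  cont := h.cont.pow 2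
  nonneg x := sq_nonneg _
  le_one x := pow_le_one₀ (h.nonneg x) (h.le_one x)
  lip x y := by
    have e : η x ^ 2 - η y ^ 2 = (η x + η y) * (η x - η y) := by ring
    have h1 : |η x + η y| ≤ 2 := by
      rw [abs_of_nonneg (add_nonneg (h.nonneg x) (h.nonneg y))]
      linarith [h.le_one x, h.le_one y]
    rw [e, abs_mul, mul_assoc]
    exact mul_le_mul h1 (h.lip x y) (abs_nonneg _) (by norm_num)

/-- `C` bounds the integrals `∫ min(1, |x-y|²) |x-y|^{-N-2s} dy`. -/
def KernelMoment (N : ℕ) (s C : ℝ) : Prop :=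
  ∀ x : RN N, ∫⁻ y, ENNReal.ofReal (min 1 (‖x - y‖ ^ 2) * wt s x y) ≤ ENNReal.ofReal C

/-- Discrete product rule `gη - g'η' = (g - g')η' + g(η - η')`: the first part is controlled by `0 ≤
η ≤ 1`, the second by the kernel moment. -/
lemma gagliardoSq_mul_cutoff_le {N : ℕ} {s C Λ : ℝ} (hC : KernelMoment N s C)
    {η : RN N → ℝ} (hη : IsCutoff Λ η) (U : Set (RN N)) {g : RN N → ℝ} (hg : Measurable g) :
    gagliardoSq s U (fun x => g x * η x) ≤ 2 * gagliardoSq s U g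
      + ENNReal.ofReal (2 * (Λ ^ 2 * C)) * ∫⁻ x in U, ENNReal.ofReal (g x ^ 2) := by
  have hwt := measurable_wt (N := N) s
  have hηm := hη.cont.measurable
  rw [gagliardoSq_eq, gagliardoSq_eq, ← lintegral_const_mul' _ _ ENNReal.ofReal_ne_top,
    ← lintegral_const_mul' _ _ (by norm_num : (2 : ℝ≥0∞) ≠ ⊤)]
  have hm2 : Measurable fun x => ∫⁻ y in U, ENNReal.ofReal ((g x - g y) ^ 2 * wt s x y) :=
    Measurable.lintegral_prod_right' (f := fun z : RN N × RN N =>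
      ENNReal.ofReal ((g z.1 - g z.2) ^ 2 * wt s z.1 z.2)) (by fun_prop)
  rw [← lintegral_add_left (hm2.const_mul 2)]
  refine lintegral_mono fun x => ?_
  have h1 := (setLIntegral_le_lintegral U _).trans
    (cutoff_moment_le hC hη.one_le hη.nonneg hη.le_one hη.lip x)
  rw [ENNReal.ofReal_mul (by norm_num), ENNReal.ofReal_ofNat, mul_assoc]
  have h2 := mul_le_mul_right (mul_le_mul_left h1 (ENNReal.ofReal (g x ^ 2))) 2
  refine le_trans ?_ (add_le_add_right h2 _)
  rw [← lintegral_const_mul' _ _ (by norm_num : (2 : ℝ≥0∞) ≠ ⊤),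
    ← lintegral_mul_const' _ _ ENNReal.ofReal_ne_top,
    ← lintegral_const_mul' _ _ (by norm_num : (2 : ℝ≥0∞) ≠ ⊤), ← lintegral_add_left (by fun_prop)]
  refine lintegral_mono fun y => ?_
  rw [← ENNReal.ofReal_mul' (sq_nonneg _), ← ENNReal.ofReal_ofNat 2,
    ← ENNReal.ofReal_mul (by norm_num), ← ENNReal.ofReal_mul (by norm_num),
    ← ENNReal.ofReal_add (by have := wt_nonneg s x y; positivity)
      (by have := wt_nonneg s x y; positivity)]
  refine ENNReal.ofReal_le_ofReal ?_
  have hw := wt_nonneg s x y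
  have e : (g x * η x - g y * η y) ^ 2 ≤ 2 * (g x - g y) ^ 2 + 2 * ((η x - η y) ^ 2 * g x ^ 2) := by
    have e1 : g x * η x - g y * η y = (g x - g y) * η y + g x * (η x - η y) := by ring
    have e2 : ((g x - g y) * η y) ^ 2 ≤ (g x - g y) ^ 2 := by
      rw [mul_pow]
      exact mul_le_of_le_one_right (sq_nonneg _) (pow_le_one₀ (hη.nonneg y) (hη.le_one y))
    rw [e1]
    nlinarith [sq_nonneg ((g x - g y) * η y - g x * (η x - η y))]
  nlinarith

lemma gagliardoSq_posPart_le {N : ℕ} (s ℓ : ℝ) (U : Set (RN N)) (g : RN N → ℝ) :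
    gagliardoSq s U (fun x => max (g x - ℓ) 0) ≤ gagliardoSq s U g := by
  rw [gagliardoSq_eq, gagliardoSq_eq]
  refine lintegral_mono fun x => lintegral_mono fun y => ENNReal.ofReal_le_ofReal ?_
  refine mul_le_mul_of_nonneg_right ?_ (wt_nonneg _ _ _)
  rw [← sq_abs, ← sq_abs (g x - g y)]
  refine pow_le_pow_left₀ (abs_nonneg _) ?_ 2
  have := abs_max_sub_max_le_abs (g x - ℓ) (g y - ℓ) 0
  simpa using this

lemma gagliardoSq_sub_le {N : ℕ} (s : ℝ) (U : Set (RN N)) {g g' : RN N → ℝ} (hg : Measurable g) :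
    gagliardoSq s U (fun x => g x - g' x) ≤ 2 * gagliardoSq s U g + 2 * gagliardoSq s U g' := by
  have hwt := measurable_wt (N := N) s
  simp only [gagliardoSq_eq]
  simp only [← lintegral_const_mul' _ _ (by norm_num : (2 : ℝ≥0∞) ≠ ⊤)]
  rw [← lintegral_add_left (Measurable.lintegral_prod_right' (f := fun z : RN N × RN N =>
      2 * ENNReal.ofReal ((g z.1 - g z.2) ^ 2 * wt s z.1 z.2)) (by fun_prop))]
  refine lintegral_mono fun x => ?_
  rw [← lintegral_add_left (by fun_prop)]
  refine lintegral_mono fun y => ?_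
  have hw := wt_nonneg s x y
  rw [← ENNReal.ofReal_ofNat 2, ← ENNReal.ofReal_mul (by norm_num),
    ← ENNReal.ofReal_mul (by norm_num), ← ENNReal.ofReal_add (by positivity) (by positivity)]
  refine ENNReal.ofReal_le_ofReal ?_
  have : (g x - g' x - (g y - g' y)) ^ 2 ≤ 2 * (g x - g y) ^ 2 + 2 * (g' x - g' y) ^ 2 := by
    nlinarith [sq_nonneg (g x - g y + (g' x - g' y))]
  nlinarith

/-- The cross term `∬_{U × U} g(x) g(y) (η(x) - η(y))² |x-y|^{-N-2s}`. -/
noncomputable def crossTerm {N : ℕ} (s : ℝ) (U : Set (RN N)) (η g : RN N → ℝ) : ℝ≥0∞ :=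
  ∫⁻ x in U, ∫⁻ y in U, ENNReal.ofReal (g x * g y * (η x - η y) ^ 2 * wt s x y)

/-- Use `g(x) g(y) ≤ g(x)² + g(y)²` and integrate out the other variable. The two halves agree by
symmetry of the weight. -/
lemma crossTerm_le {N : ℕ} {s C Λ : ℝ} (hC : KernelMoment N s C)
    {η : RN N → ℝ} (hη : IsCutoff Λ η) (U : Set (RN N)) {g : RN N → ℝ} (hg : Measurable g) :
    crossTerm s U η g ≤ ENNReal.ofReal (2 * (Λ ^ 2 * C)) * ∫⁻ x in U, ENNReal.ofReal (g x ^ 2) := by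
  have hwt := measurable_wt (N := N) s
  have hηm := hη.cont.measurable
  have h0 : ∫⁻ x in U, ∫⁻ y in U, ENNReal.ofReal ((η x - η y) ^ 2 * wt s x y * g x ^ 2)
      ≤ ENNReal.ofReal (Λ ^ 2 * C) * ∫⁻ x in U, ENNReal.ofReal (g x ^ 2) := by
    rw [← lintegral_const_mul' _ _ ENNReal.ofReal_ne_top]
    refine lintegral_mono fun x => ?_
    have h1 := (setLIntegral_le_lintegral U _).trans
      (cutoff_moment_le hC hη.one_le hη.nonneg hη.le_one hη.lip x)
    refine le_trans (le_of_eq ?_) (mul_le_mul_left h1 (ENNReal.ofReal (g x ^ 2)))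
    rw [← lintegral_mul_const' _ _ ENNReal.ofReal_ne_top]
    refine lintegral_congr fun y => ?_
    rw [← ENNReal.ofReal_mul' (sq_nonneg _)]
  have h0' : ∫⁻ x in U, ∫⁻ y in U, ENNReal.ofReal ((η x - η y) ^ 2 * wt s x y * g y ^ 2)
      ≤ ENNReal.ofReal (Λ ^ 2 * C) * ∫⁻ x in U, ENNReal.ofReal (g x ^ 2) := by
    rw [lintegral_lintegral_swap (f := fun x y =>
      ENNReal.ofReal ((η x - η y) ^ 2 * wt s x y * g y ^ 2)) (by fun_prop)]
    refine le_trans (le_of_eq ?_) h0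
    refine lintegral_congr fun x => lintegral_congr fun y => ?_
    rw [wt_symm s y x]
    congr 2
    ring
  rw [ENNReal.ofReal_mul (by norm_num), ENNReal.ofReal_ofNat, mul_assoc, two_mul]
  refine le_trans ?_ (add_le_add h0 h0')
  rw [crossTerm, ← lintegral_add_left (Measurable.lintegral_prod_right' (f := fun z : RN N × RN N =>
      ENNReal.ofReal ((η z.1 - η z.2) ^ 2 * wt s z.1 z.2 * g z.1 ^ 2)) (by fun_prop))]
  refine lintegral_mono fun x => ?_
  rw [← lintegral_add_left (by fun_prop)]
  refine lintegral_mono fun y => ?_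
  have hw := wt_nonneg s x y
  rw [← ENNReal.ofReal_add (by positivity) (by positivity)]
  refine ENNReal.ofReal_le_ofReal ?_
  have h2 : g x * g y ≤ g x ^ 2 + g y ^ 2 := by nlinarith [sq_nonneg (g x - g y), sq_nonneg (g x), sq_nonneg (g y)]
  have h3 : 0 ≤ (η x - η y) ^ 2 * wt s x y := by positivity
  nlinarith

/-- Finiteness is checked slice by slice in `[0, ∞]`, while signed terms need Bochner integrals on
the product. This is the passage between the two. -/
lemma integrable_prod_of_lintegral {α : Type*} [MeasurableSpace α] {ν : Measure α} [SFinite ν]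
    {I : Set ℝ} {Q : α × ℝ → ℝ} (hm : Measurable Q) (h0 : ∀ z, 0 ≤ Q z)
    (hfin : ∫⁻ τ in I, ∫⁻ z, ENNReal.ofReal (Q (z, τ)) ∂ν < ⊤) :
    Integrable Q (ν.prod (volume.restrict I)) ∧
      ∫ z, Q z ∂(ν.prod (volume.restrict I))
        = ∫ τ in I, (∫⁻ z, ENNReal.ofReal (Q (z, τ)) ∂ν).toReal := by
  have e : ∫⁻ z, ENNReal.ofReal (Q z) ∂(ν.prod (volume.restrict I))
      = ∫⁻ τ in I, ∫⁻ z, ENNReal.ofReal (Q (z, τ)) ∂ν :=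
    lintegral_prod_symm _ (by fun_prop)
  have hmI : Measurable fun τ => ∫⁻ z, ENNReal.ofReal (Q (z, τ)) ∂ν :=
    Measurable.lintegral_prod_left' (f := fun z : α × ℝ => ENNReal.ofReal (Q z)) (by fun_prop)
  refine ⟨⟨hm.aestronglyMeasurable, ?_⟩, ?_⟩
  · rw [hasFiniteIntegral_iff_ofReal (ae_of_all _ h0), e]; exact hfin
  · rw [integral_eq_lintegral_of_nonneg_ae (ae_of_all _ h0) hm.aestronglyMeasurable, e,
      integral_toReal hmI.aemeasurable (ae_lt_top hmI hfin.ne)]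

lemma lintegral_tailWeight_lt_top {N : ℕ} {s : ℝ} (hs0 : 0 < s) :
    ∫⁻ y : RN N, ENNReal.ofReal (1 / (1 + ‖y‖ ^ ((N : ℝ) + 2 * s))) < ⊤ := by
  set p : ℝ := (N : ℝ) + 2 * s with hp
  have hp0 : 0 < p := by positivity
  have h1 : Integrable (fun y : RN N => (2 : ℝ) ^ p * (1 + ‖y‖) ^ (-p)) :=
    (integrable_one_add_norm (by simp [hp, hs0])).const_mul _
  refine lt_of_le_of_lt (lintegral_mono fun y => ENNReal.ofReal_le_ofReal ?_) h1.lintegral_lt_top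
  rw [Real.rpow_neg (by positivity), ← div_eq_mul_inv,
    div_le_div_iff₀ (by positivity) (by positivity), one_mul]
  rcases le_total ‖y‖ 1 with h | h
  · calc (1 + ‖y‖) ^ p ≤ 2 ^ p := by gcongr; linarith
      _ ≤ _ := le_mul_of_one_le_right (by positivity) (by linarith [Real.rpow_nonneg (norm_nonneg y) p])
  · calc (1 + ‖y‖) ^ p ≤ (2 * ‖y‖) ^ p := by gcongr; linarith
      _ = 2 ^ p * ‖y‖ ^ p := Real.mul_rpow (by norm_num) (norm_nonneg y)
      _ ≤ _ := by gcongr; linarith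

/-! ### Sub-solutions on a cylinder, tested with functions of space only -/

/-- The weight `1 / (1 + |y|^{N+2s})` of the nonlocal tail. -/
noncomputable def tailWeight {N : ℕ} (s : ℝ) (y : RN N) : ℝ := 1 / (1 + ‖y‖ ^ ((N : ℝ) + 2 * s))

lemma tailWeight_nonneg {N : ℕ} (s : ℝ) (y : RN N) : 0 ≤ tailWeight s y := by
  unfold tailWeight; positivity

lemma measurable_tailWeight {N : ℕ} (s : ℝ) : Measurable (tailWeight s : RN N → ℝ) := by
  unfold tailWeight; fun_prop

/-- The nonlocal tail of `v(·, τ)`. -/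
noncomputable def tailAt {N : ℕ} (s : ℝ) (v : RN N → ℝ → ℝ) (τ : ℝ) : ℝ≥0∞ :=
  ∫⁻ x, ENNReal.ofReal (v x τ * tailWeight s x)

/-- A nonnegative, jointly measurable `v` on the cylinder `B × (a, b]`, `B = B_{ρ+d}(x₀)`, that
satisfies the sub-solution inequality for test functions which do not depend on time. -/
structure CylinderSub {N : ℕ} (s q L : ℝ) (x₀ : RN N) (ρ d a b : ℝ) (v : RN N → ℝ → ℝ)
    (κ : RN N → RN N → ℝ → ℝ) : Prop where
  meas : Measurable fun z : RN N × ℝ => v z.1 z.2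
  nonneg : ∀ x t, 0 ≤ v x t
  meas_k : Measurable fun z : (RN N × RN N) × ℝ => κ z.1.1 z.1.2 z.2
  lower : ∀ x y t, L⁻¹ * wt s x y ≤ κ x y t
  upper : ∀ x y t, κ x y t ≤ L * wt s x y
  energy : ∫⁻ t in Ioc a b, gagliardoSq s (Metric.ball x₀ (ρ + d)) (fun x => v x t) < ⊤
  bdd : ∃ M : ℝ, ∀ᵐ t ∂(volume.restrict (Ioc a b)),
    ∫⁻ x in Metric.ball x₀ (ρ + d), ENNReal.ofReal (v x t ^ (q + 1)) ≤ ENNReal.ofReal M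
  unif : ∀ ε > 0, ∃ δ > 0, ∀ h, 0 < h → h < δ → ∀ᵐ t ∂(volume.restrict (Ioc (a + h) b)),
    ∫⁻ x in Metric.ball x₀ (ρ + d), ENNReal.ofReal |v x t - v x (t - h)| ≤ ENNReal.ofReal ε
  tail : ∫⁻ t in Ioc a b, tailAt s v t < ⊤
  ineq : ∀ h > 0, ∀ᵐ t ∂(volume.restrict (Ioc (a + h) b)), ∀ ψ : RN N → ℝ, Measurable ψ →
    (∀ x, 0 ≤ ψ x) → (∀ x, x ∉ Metric.ball x₀ (ρ + d) → ψ x = 0) →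
    MemLp ψ (ENNReal.ofReal (q + 1)) → MemLp ψ 2 → gagliardoSq s univ ψ < ⊤ →
    (∫ x in Metric.ball x₀ (ρ + d), (v x t ^ q - v x (t - h) ^ q) * ψ x)
      + ∫ τ in Ioc (t - h) t, ∫ z : RN N × RN N,
          (v z.1 τ - v z.2 τ) * (ψ z.1 - ψ z.2) * κ z.1 z.2 τ ≤ 0

/-- The difference `δ₁ - δ₂` comes from a test function that only approximates the ideal one `(v -
ℓ)_+ η²`. The ideal part obeys the Caccioppoli inequality, and Young with parameter `ε` splits the
rest into a small energy term and a large multiple of the squared error. -/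
lemma near_pointwise {L ε W k : ℝ} (hL : 0 < L) (hε : 0 < ε) (hW : 0 ≤ W) (h1 : L⁻¹ * W ≤ k)
    (h2 : k ≤ L * W) {a b ℓ η ζ δ₁ δ₂ : ℝ} :
    L⁻¹ * ((max (a - ℓ) 0 * η - max (b - ℓ) 0 * ζ) ^ 2 * W)
      - L * (max (a - ℓ) 0 * max (b - ℓ) 0 * (η - ζ) ^ 2 * W)
      - L * ε * ((a - b) ^ 2 * W)
      - L / (4 * ε) * ((δ₁ - max (a - ℓ) 0 * η ^ 2 - (δ₂ - max (b - ℓ) 0 * ζ ^ 2)) ^ 2 * W)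
      ≤ (a - b) * (δ₁ - δ₂) * k := by
  have hk : 0 ≤ k := le_trans (by positivity) h1
  set wa := max (a - ℓ) 0
  set wb := max (b - ℓ) 0
  have hwa : 0 ≤ wa := le_max_right _ _
  have hwb : 0 ≤ wb := le_max_right _ _
  have hc := caccioppoli_pointwise a b ℓ η ζ
  set D := δ₁ - wa * η ^ 2 - (δ₂ - wb * ζ ^ 2) with hD
  have e : (a - b) * (δ₁ - δ₂) * k = (a - b) * (wa * η ^ 2 - wb * ζ ^ 2) * k + (a - b) * D * k := by
    rw [hD]; ring
  have i1 : ((wa * η - wb * ζ) ^ 2 - wa * wb * (η - ζ) ^ 2) * k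
      ≤ (a - b) * (wa * η ^ 2 - wb * ζ ^ 2) * k := mul_le_mul_of_nonneg_right hc hk
  have i2 : L⁻¹ * ((wa * η - wb * ζ) ^ 2 * W) ≤ (wa * η - wb * ζ) ^ 2 * k := by
    nlinarith [mul_le_mul_of_nonneg_left h1 (sq_nonneg (wa * η - wb * ζ))]
  have i3 : wa * wb * (η - ζ) ^ 2 * k ≤ L * (wa * wb * (η - ζ) ^ 2 * W) := by
    have : 0 ≤ wa * wb * (η - ζ) ^ 2 := by positivity
    nlinarith [mul_le_mul_of_nonneg_left h2 this]
  have i4 : -(ε * (a - b) ^ 2 + 1 / (4 * ε) * D ^ 2) ≤ (a - b) * D := by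
    have : ε * (a - b) ^ 2 + 1 / (4 * ε) * D ^ 2 + (a - b) * D
        = 1 / (4 * ε) * (2 * ε * (a - b) + D) ^ 2 := by field_simp; ring
    have h0 : 0 ≤ 1 / (4 * ε) * (2 * ε * (a - b) + D) ^ 2 := by positivity
    linarith
  have i5 : (ε * (a - b) ^ 2 + 1 / (4 * ε) * D ^ 2) * k
      ≤ L * ε * ((a - b) ^ 2 * W) + L / (4 * ε) * (D ^ 2 * W) := by
    have h0 : 0 ≤ ε * (a - b) ^ 2 + 1 / (4 * ε) * D ^ 2 := by positivity
    refine (mul_le_mul_of_nonneg_left h2 h0).trans (le_of_eq ?_)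
    ring
  have i6 := mul_le_mul_of_nonneg_right i4 hk
  rw [e]
  linarith

/-! ### Bounds on a cylinder and the nonlocal splitting -/

section

variable {N : ℕ} {s q L : ℝ} {x₀ : RN N} {ρ d a b : ℝ} {v : RN N → ℝ → ℝ}
  {κ : RN N → RN N → ℝ → ℝ}

lemma CylinderSub.sq_bdd (hS : CylinderSub s q L x₀ ρ d a b v κ) (hq : 1 ≤ q) :
    ∃ M : ℝ, 0 < M ∧ ∀ᵐ t ∂(volume.restrict (Ioc a b)),
      ∫⁻ x in Metric.ball x₀ (ρ + d), ENNReal.ofReal (v x t ^ 2) ≤ ENNReal.ofReal M := by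
  obtain ⟨M, hM⟩ := hS.bdd
  set V := (volume (Metric.ball x₀ (ρ + d))).toReal with hV
  have hVt : volume (Metric.ball x₀ (ρ + d)) ≠ ⊤ := measure_ball_lt_top.ne
  refine ⟨V + |M| + 1, by positivity, ?_⟩
  filter_upwards [hM] with t ht
  have h1 : ∀ x, ENNReal.ofReal (v x t ^ 2) ≤ 1 + ENNReal.ofReal (v x t ^ (q + 1)) := by
    intro x
    rw [← ENNReal.ofReal_one, ← ENNReal.ofReal_add zero_le_one (Real.rpow_nonneg (hS.nonneg _ _) _)]
    refine ENNReal.ofReal_le_ofReal ?_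
    rcases le_total (v x t) 1 with h | h
    · have := Real.rpow_nonneg (hS.nonneg x t) (q + 1)
      have := pow_le_one₀ (n := 2) (hS.nonneg x t) h
      linarith
    · have : v x t ^ (2 : ℝ) ≤ v x t ^ (q + 1) := Real.rpow_le_rpow_of_exponent_le h (by linarith)
      rw [Real.rpow_two] at this
      linarith
  refine (lintegral_mono h1).trans ?_
  rw [lintegral_add_left measurable_const, lintegral_one, Measure.restrict_apply_univ,
    ← ENNReal.ofReal_toReal hVt]
  refine (add_le_add_right ht _).trans ?_
  rw [add_assoc, ENNReal.ofReal_add (by positivity) (by positivity)]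
  gcongr
  linarith [le_abs_self M]

lemma measurable_tailAt (hv : Measurable fun z : RN N × ℝ => v z.1 z.2) :
    Measurable (tailAt s v) := by
  have := measurable_tailWeight (N := N) s
  exact Measurable.lintegral_prod_left' (f := fun z : RN N × ℝ =>
    ENNReal.ofReal (v z.1 z.2 * tailWeight s z.1)) (by fun_prop)

lemma measurable_gagliardoSq (U : Set (RN N)) (hv : Measurable fun z : RN N × ℝ => v z.1 z.2) :
    Measurable fun τ => gagliardoSq s U (fun x => v x τ) := by
  have hwt := measurable_wt (N := N) s
  have e : (fun τ => gagliardoSq s U (fun x => v x τ))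
      = fun τ => ∫⁻ z, ENNReal.ofReal ((v z.1 τ - v z.2 τ) ^ 2 * wt s z.1 z.2)
        ∂((volume.restrict U).prod (volume.restrict U)) := by
    funext τ
    exact gagliardoSq_eq_prod s U (by fun_prop)
  rw [e]
  exact Measurable.lintegral_prod_left' (f := fun z : (RN N × RN N) × ℝ =>
    ENNReal.ofReal ((v z.1.1 z.2 - v z.1.2 z.2) ^ 2 * wt s z.1.1 z.1.2)) (by fun_prop)

lemma lintegral_mul_prod (f g : RN N → ℝ) (hf : Measurable f) (hg : Measurable g)
    (hf0 : ∀ x, 0 ≤ f x) :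
    ∫⁻ z : RN N × RN N, ENNReal.ofReal (f z.1 * g z.2)
      = (∫⁻ x, ENNReal.ofReal (f x)) * ∫⁻ y, ENNReal.ofReal (g y) := by
  rw [Measure.volume_eq_prod, ← lintegral_prod_mul (by fun_prop) (by fun_prop)]
  exact lintegral_congr fun z => ENNReal.ofReal_mul (hf0 _)

lemma lintegral_mul_prod' (f g : RN N → ℝ) (hf : Measurable f) (hg : Measurable g)
    (hf0 : ∀ x, 0 ≤ f x) :
    ∫⁻ z : RN N × RN N, ENNReal.ofReal (f z.2 * g z.1)
      = (∫⁻ x, ENNReal.ofReal (f x)) * ∫⁻ y, ENNReal.ofReal (g y) := by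
  rw [Measure.volume_eq_prod, mul_comm, ← lintegral_prod_mul (by fun_prop) (by fun_prop)]
  exact lintegral_congr fun z => by rw [ENNReal.ofReal_mul (hf0 _), mul_comm]

/-- Splitting the bilinear form into the part over `B × B` and the contribution of the tail. -/
lemma CylinderSub.far_split (hS : CylinderSub s q L x₀ ρ d a b v κ) (hq : 1 ≤ q) (hs0 : 0 < s)
    (hL : 0 < L) (hd : 0 < d) {c : ℝ} (hc : 0 < c)
    (hfar : ∀ x ∈ Metric.ball x₀ ρ, ∀ y ∉ Metric.ball x₀ (ρ + d),
      L * wt s x y ≤ c * tailWeight s y)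
    {I : Set ℝ} (hI : I ⊆ Ioc a b)
    {ψ : RN N → ℝ} (hψ : Measurable ψ) (hψ0 : ∀ x, 0 ≤ ψ x)
    (hψs : ∀ x, x ∉ Metric.ball x₀ ρ → ψ x = 0)
    (hψ2 : ∫⁻ x, ENNReal.ofReal (ψ x ^ 2) < ⊤) (hψ1 : ∫⁻ x, ENNReal.ofReal (ψ x) < ⊤)
    (hψg : gagliardoSq s (Metric.ball x₀ (ρ + d)) ψ < ⊤) :
    Integrable (fun z : (RN N × RN N) × ℝ =>
        (v z.1.1 z.2 - v z.1.2 z.2) * (ψ z.1.1 - ψ z.1.2) * κ z.1.1 z.1.2 z.2)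
      (((volume.restrict (Metric.ball x₀ (ρ + d))).prod
        (volume.restrict (Metric.ball x₀ (ρ + d)))).prod (volume.restrict I)) ∧
    (∫ z, (v z.1.1 z.2 - v z.1.2 z.2) * (ψ z.1.1 - ψ z.1.2) * κ z.1.1 z.1.2 z.2
      ∂(((volume.restrict (Metric.ball x₀ (ρ + d))).prod
        (volume.restrict (Metric.ball x₀ (ρ + d)))).prod (volume.restrict I)))
      - (∫ x, ψ x) * ∫ τ in I, 2 * c * (tailAt s v τ).toReal
      ≤ ∫ τ in I, ∫ z : RN N × RN N,
          (v z.1 τ - v z.2 τ) * (ψ z.1 - ψ z.2) * κ z.1 z.2 τ := by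
  set B := Metric.ball x₀ (ρ + d) with hB
  have hBm : MeasurableSet B := Metric.isOpen_ball.measurableSet
  have hwt := measurable_wt (N := N) s
  have htw := measurable_tailWeight (N := N) s
  have hvm := hS.meas
  have hkm := hS.meas_k
  have hvτ : ∀ τ, Measurable fun x => v x τ := fun τ => by fun_prop
  have hIab : volume.restrict I ≤ volume.restrict (Ioc a b) := Measure.restrict_mono_set _ hI
  have hIfin : volume I < ⊤ := (measure_mono hI).trans_lt measure_Ioc_lt_top
  have hψB : ∀ x, x ∉ B → ψ x = 0 := fun x hx =>
    hψs x fun h => hx (Metric.ball_subset_ball (by linarith) h)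
  set μ : Measure ((RN N × RN N) × ℝ) :=
    (volume : Measure (RN N × RN N)).prod (volume.restrict I) with hμ
  set J : (RN N × RN N) × ℝ → ℝ := fun z =>
    (v z.1.1 z.2 - v z.1.2 z.2) * (ψ z.1.1 - ψ z.1.2) * κ z.1.1 z.1.2 z.2 with hJ
  have hJm : Measurable J := Measurable.mul (by fun_prop) hkm
  set S : Set ((RN N × RN N) × ℝ) := (B ×ˢ B) ×ˢ univ with hSdef
  have hSm : MeasurableSet S := (hBm.prod hBm).prod MeasurableSet.univ
  have hμS : μ.restrict S = ((volume.restrict B).prod (volume.restrict B)).prod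
      (volume.restrict I) := by
    have h1 : (volume : Measure (RN N × RN N)).restrict (B ×ˢ B)
        = (volume.restrict B).prod (volume.restrict B) := by
      rw [Measure.volume_eq_prod, Measure.prod_restrict]
    refine (Measure.prod_restrict (B ×ˢ B) univ).symm.trans ?_
    rw [Measure.restrict_univ, h1]
  -- the dominating functions
  set E : (RN N × RN N) × ℝ → ℝ := fun z =>
    (v z.1.1 z.2 - v z.1.2 z.2) ^ 2 * wt s z.1.1 z.1.2 with hE
  set P : (RN N × RN N) × ℝ → ℝ := fun z => (ψ z.1.1 - ψ z.1.2) ^ 2 * wt s z.1.1 z.1.2 with hP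
  set T : (RN N × RN N) × ℝ → ℝ := fun z => ψ z.1.1 * (v z.1.2 z.2 * tailWeight s z.1.2) with hT
  set T' : (RN N × RN N) × ℝ → ℝ := fun z => ψ z.1.2 * (v z.1.1 z.2 * tailWeight s z.1.1) with hT'
  set U : (RN N × RN N) × ℝ → ℝ := fun z => ψ z.1.1 * v z.1.1 z.2 * tailWeight s z.1.2 with hU
  set U' : (RN N × RN N) × ℝ → ℝ := fun z => ψ z.1.2 * v z.1.2 z.2 * tailWeight s z.1.1 with hU'
  have hEint : Integrable E (μ.restrict S) := by
    rw [hμS]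
    refine (integrable_prod_of_lintegral (by fun_prop)
      (fun z => mul_nonneg (sq_nonneg _) (wt_nonneg _ _ _)) ?_).1
    refine lt_of_le_of_lt (le_of_eq_of_le ?_ (lintegral_mono' hIab le_rfl)) hS.energy
    exact lintegral_congr fun τ => (gagliardoSq_eq_prod s B (hvτ τ)).symm
  have hPint : Integrable P (μ.restrict S) := by
    rw [hμS]
    refine (integrable_prod_of_lintegral (by fun_prop)
      (fun z => mul_nonneg (sq_nonneg _) (wt_nonneg _ _ _)) ?_).1
    change ∫⁻ τ in I, ∫⁻ z : RN N × RN N, ENNReal.ofReal ((ψ z.1 - ψ z.2) ^ 2 * wt s z.1 z.2)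
      ∂((volume.restrict B).prod (volume.restrict B)) < ⊤
    rw [← gagliardoSq_eq_prod s B hψ, lintegral_const, Measure.restrict_apply_univ]
    exact ENNReal.mul_lt_top hψg hIfin
  have htailfin : ∫⁻ τ in I, tailAt s v τ < ⊤ :=
    lt_of_le_of_lt (lintegral_mono' hIab le_rfl) hS.tail
  have hTlin : ∀ τ, ∫⁻ z : RN N × RN N, ENNReal.ofReal (T (z, τ))
      = (∫⁻ x, ENNReal.ofReal (ψ x)) * tailAt s v τ := fun τ =>
    lintegral_mul_prod ψ (fun y => v y τ * tailWeight s y) hψ (by fun_prop) hψ0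
  have hTlin' : ∀ τ, ∫⁻ z : RN N × RN N, ENNReal.ofReal (T' (z, τ))
      = (∫⁻ x, ENNReal.ofReal (ψ x)) * tailAt s v τ := fun τ =>
    lintegral_mul_prod' ψ (fun y => v y τ * tailWeight s y) hψ (by fun_prop) hψ0
  have hTfin : ∫⁻ τ in I, (∫⁻ x, ENNReal.ofReal (ψ x)) * tailAt s v τ < ⊤ := by
    rw [lintegral_const_mul' _ _ hψ1.ne]
    exact ENNReal.mul_lt_top hψ1 htailfin
  have hT0 : ∀ z, 0 ≤ T z := fun z =>
    mul_nonneg (hψ0 _) (mul_nonneg (hS.nonneg _ _) (tailWeight_nonneg _ _))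
  have hT0' : ∀ z, 0 ≤ T' z := fun z =>
    mul_nonneg (hψ0 _) (mul_nonneg (hS.nonneg _ _) (tailWeight_nonneg _ _))
  have hU0 : ∀ z, 0 ≤ U z := fun z =>
    mul_nonneg (mul_nonneg (hψ0 _) (hS.nonneg _ _)) (tailWeight_nonneg _ _)
  have hU0' : ∀ z, 0 ≤ U' z := fun z =>
    mul_nonneg (mul_nonneg (hψ0 _) (hS.nonneg _ _)) (tailWeight_nonneg _ _)
  have hTint := integrable_prod_of_lintegral (ν := (volume : Measure (RN N × RN N))) (I := I)
    (Q := T) (by fun_prop) hT0 (by simp only [hTlin]; exact hTfin)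
  have hTint' := integrable_prod_of_lintegral (ν := (volume : Measure (RN N × RN N))) (I := I)
    (Q := T') (by fun_prop) hT0' (by simp only [hTlin']; exact hTfin)
  have hUfin : ∫⁻ τ in I, (∫⁻ x, ENNReal.ofReal (ψ x * v x τ))
      * ∫⁻ y : RN N, ENNReal.ofReal (tailWeight s y) < ⊤ := by
    have htop : ∫⁻ y : RN N, ENNReal.ofReal (tailWeight s y) < ⊤ := lintegral_tailWeight_lt_top hs0
    rw [lintegral_mul_const' _ _ htop.ne]
    refine ENNReal.mul_lt_top ?_ htop
    obtain ⟨M, -, hM⟩ := hS.sq_bdd hq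
    have hle : ∀ᵐ τ ∂(volume.restrict I), ∫⁻ x, ENNReal.ofReal (ψ x * v x τ)
        ≤ (∫⁻ x, ENNReal.ofReal (ψ x ^ 2)) + ENNReal.ofReal M := by
      filter_upwards [ae_mono hIab hM] with τ hτ
      refine le_trans ?_ (add_le_add_right hτ _)
      rw [← lintegral_indicator hBm, ← lintegral_add_left (by fun_prop)]
      refine lintegral_mono fun x => ?_
      by_cases hx : x ∈ B
      · rw [indicator_of_mem hx, ← ENNReal.ofReal_add (sq_nonneg _) (sq_nonneg _)]
        refine ENNReal.ofReal_le_ofReal ?_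
        nlinarith [sq_nonneg (ψ x - v x τ), sq_nonneg (ψ x), sq_nonneg (v x τ)]
      · simp [hψB x hx]
    refine lt_of_le_of_lt (lintegral_mono_ae hle) ?_
    rw [lintegral_const, Measure.restrict_apply_univ]
    exact ENNReal.mul_lt_top (ENNReal.add_lt_top.2 ⟨hψ2, ENNReal.ofReal_lt_top⟩) hIfin
  have hUint := (integrable_prod_of_lintegral (ν := (volume : Measure (RN N × RN N))) (I := I)
    (Q := U) (by fun_prop) hU0 (lt_of_eq_of_lt (lintegral_congr fun τ =>
      lintegral_mul_prod (fun x => ψ x * v x τ) (tailWeight s) (by fun_prop) htw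
        fun x => mul_nonneg (hψ0 _) (hS.nonneg _ _)) hUfin)).1
  have hUint' := (integrable_prod_of_lintegral (ν := (volume : Measure (RN N × RN N))) (I := I)
    (Q := U') (by fun_prop) hU0' (lt_of_eq_of_lt (lintegral_congr fun τ =>
      lintegral_mul_prod' (fun x => ψ x * v x τ) (tailWeight s) (by fun_prop) htw
        fun x => mul_nonneg (hψ0 _) (hS.nonneg _ _)) hUfin)).1
  have hk0 : ∀ x y t, 0 ≤ κ x y t := fun x y t =>
    le_trans (mul_nonneg (inv_nonneg.2 hL.le) (wt_nonneg _ _ _)) (hS.lower x y t)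
  -- integrability near
  have hJS : IntegrableOn J S μ := by
    refine Integrable.mono' ((hEint.add hPint).const_mul L) hJm.aestronglyMeasurable
      (ae_of_all _ fun z => ?_)
    simp only [hJ, hE, hP, Real.norm_eq_abs, abs_mul, Pi.add_apply]
    rw [abs_of_nonneg (hk0 _ _ _)]
    have hw := wt_nonneg s z.1.1 z.1.2
    set α := v z.1.1 z.2 - v z.1.2 z.2
    set β := ψ z.1.1 - ψ z.1.2
    have h1 : |α| * |β| ≤ α ^ 2 + β ^ 2 := by
      rw [← sq_abs α, ← sq_abs β]; nlinarith [sq_nonneg (|α| - |β|), sq_nonneg |α|, sq_nonneg |β|]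
    calc |α| * |β| * κ z.1.1 z.1.2 z.2 ≤ (α ^ 2 + β ^ 2) * (L * wt s z.1.1 z.1.2) :=
          mul_le_mul h1 (hS.upper _ _ _) (hk0 _ _ _) (by positivity)
      _ = L * (α ^ 2 * wt s z.1.1 z.1.2 + β ^ 2 * wt s z.1.1 z.1.2) := by ring
  -- pointwise bounds away from the ball
  have hoff : ∀ z ∉ S, |J z| ≤ c * (T z + T' z + (U z + U' z)) ∧ -(c * (T z + T' z)) ≤ J z := by
    rintro ⟨⟨x, y⟩, τ⟩ hz
    have hTz := hT0 ((x, y), τ)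
    have hTz' := hT0' ((x, y), τ)
    have hUz := hU0 ((x, y), τ)
    have hUz' := hU0' ((x, y), τ)
    have hzero : J ((x, y), τ) = 0 → |J ((x, y), τ)| ≤ c * (T ((x, y), τ) + T' ((x, y), τ)
        + (U ((x, y), τ) + U' ((x, y), τ))) ∧
        -(c * (T ((x, y), τ) + T' ((x, y), τ))) ≤ J ((x, y), τ) := by
      intro h0
      rw [h0, abs_zero]
      exact ⟨by positivity, by rw [neg_nonpos]; positivity⟩
    have hk := hk0 x y τ
    have hvx := hS.nonneg x τ
    have hvy := hS.nonneg y τ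
    have hxy : ¬ (x ∈ B ∧ y ∈ B) := fun h => hz ⟨⟨h.1, h.2⟩, mem_univ _⟩
    by_cases hx : x ∈ Metric.ball x₀ ρ
    · have hxB : x ∈ B := Metric.ball_subset_ball (by linarith) hx
      have hy : y ∉ B := fun h => hxy ⟨hxB, h⟩
      have hk2 : κ x y τ ≤ c * tailWeight s y := (hS.upper x y τ).trans (hfar x hx y hy)
      have e : J ((x, y), τ) = v x τ * ψ x * κ x y τ - v y τ * ψ x * κ x y τ := by
        simp only [hJ, hψB y hy]; ring
      have p1 : v y τ * ψ x * κ x y τ ≤ c * T ((x, y), τ) := by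
        refine (mul_le_mul_of_nonneg_left hk2 (mul_nonneg hvy (hψ0 x))).trans (le_of_eq ?_)
        simp only [hT]; ring
      have p2 : v x τ * ψ x * κ x y τ ≤ c * U ((x, y), τ) := by
        refine (mul_le_mul_of_nonneg_left hk2 (mul_nonneg hvx (hψ0 x))).trans (le_of_eq ?_)
        simp only [hU]; ring
      have p3 : 0 ≤ v y τ * ψ x * κ x y τ := mul_nonneg (mul_nonneg hvy (hψ0 x)) hk
      have p4 : 0 ≤ v x τ * ψ x * κ x y τ := mul_nonneg (mul_nonneg hvx (hψ0 x)) hk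
      rw [e]
      refine ⟨abs_le.2 ⟨?_, ?_⟩, ?_⟩ <;> nlinarith
    · by_cases hy : y ∈ Metric.ball x₀ ρ
      · have hyB : y ∈ B := Metric.ball_subset_ball (by linarith) hy
        have hxn : x ∉ B := fun h => hxy ⟨h, hyB⟩
        have hk2 : κ x y τ ≤ c * tailWeight s x := by
          refine (hS.upper x y τ).trans ?_
          rw [wt_symm]; exact hfar y hy x hxn
        have e : J ((x, y), τ) = v y τ * ψ y * κ x y τ - v x τ * ψ y * κ x y τ := by
          simp only [hJ, hψB x hxn]; ring
        have p1 : v x τ * ψ y * κ x y τ ≤ c * T' ((x, y), τ) := by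
          refine (mul_le_mul_of_nonneg_left hk2 (mul_nonneg hvx (hψ0 y))).trans (le_of_eq ?_)
          simp only [hT']; ring
        have p2 : v y τ * ψ y * κ x y τ ≤ c * U' ((x, y), τ) := by
          refine (mul_le_mul_of_nonneg_left hk2 (mul_nonneg hvy (hψ0 y))).trans (le_of_eq ?_)
          simp only [hU']; ring
        have p3 : 0 ≤ v x τ * ψ y * κ x y τ := mul_nonneg (mul_nonneg hvx (hψ0 y)) hk
        have p4 : 0 ≤ v y τ * ψ y * κ x y τ := mul_nonneg (mul_nonneg hvy (hψ0 y)) hk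
        rw [e]
        refine ⟨abs_le.2 ⟨?_, ?_⟩, ?_⟩ <;> nlinarith
      · exact hzero (by simp [hJ, hψs x hx, hψs y hy])
  have hTT : Integrable (fun z => c * (T z + T' z)) μ := (hTint.1.add hTint'.1).const_mul c
  have hJSc : IntegrableOn J Sᶜ μ := by
    refine Integrable.mono' (((hTint.1.add hTint'.1).add (hUint.add hUint')).const_mul
      c).integrableOn hJm.aestronglyMeasurable ?_
    refine (ae_restrict_iff' hSm.compl).2 (ae_of_all _ fun z hz => ?_)
    exact (hoff z hz).1
  have hJint : Integrable J μ := by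
    rw [← integrableOn_univ, ← union_compl_self S]; exact hJS.union hJSc
  refine ⟨by rw [← hμS]; exact hJS, ?_⟩
  have e1 : ∫ τ in I, ∫ z : RN N × RN N, (v z.1 τ - v z.2 τ) * (ψ z.1 - ψ z.2) * κ z.1 z.2 τ
      = ∫ z, J z ∂μ := (integral_prod_symm _ hJint).symm
  rw [e1, ← integral_add_compl hSm hJint, ← hμS]
  -- Only the negative part is kept for the lower bound. The two symmetric contributions of `T` and
  -- `T'` account for the factor `2c`.
  have e2 : -(∫ z in Sᶜ, c * (T z + T' z) ∂μ) ≤ ∫ z in Sᶜ, J z ∂μ := by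
    rw [← integral_neg]
    exact setIntegral_mono_on hTT.neg.integrableOn hJSc hSm.compl fun z hz => (hoff z hz).2
  have e3 : ∫ z in Sᶜ, c * (T z + T' z) ∂μ ≤ ∫ z, c * (T z + T' z) ∂μ :=
    setIntegral_le_integral hTT (ae_of_all _ fun z =>
      mul_nonneg hc.le (add_nonneg (hT0 z) (hT0' z)))
  have e4 : ∫ z, c * (T z + T' z) ∂μ = (∫ x, ψ x) * ∫ τ in I, 2 * c * (tailAt s v τ).toReal := by
    have hψi : ∫ x, ψ x = (∫⁻ x, ENNReal.ofReal (ψ x)).toReal :=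
      integral_eq_lintegral_of_nonneg_ae (ae_of_all _ hψ0) hψ.aestronglyMeasurable
    rw [integral_const_mul, integral_add hTint.1 hTint'.1, hTint.2, hTint'.2]
    simp only [hTlin, hTlin', ENNReal.toReal_mul, integral_const_mul]
    rw [hψi]; ring
  linarith

end

lemma integral_lincomb {α : Type*} [MeasurableSpace α] {μ : Measure α} {f₁ f₂ f₃ f₄ : α → ℝ}
    (h₁ : Integrable f₁ μ) (h₂ : Integrable f₂ μ) (h₃ : Integrable f₃ μ) (h₄ : Integrable f₄ μ)
    (c₁ c₂ c₃ c₄ : ℝ) :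
    Integrable (fun x => c₁ * f₁ x - c₂ * f₂ x - c₃ * f₃ x - c₄ * f₄ x) μ ∧
    ∫ x, (c₁ * f₁ x - c₂ * f₂ x - c₃ * f₃ x - c₄ * f₄ x) ∂μ
      = c₁ * (∫ x, f₁ x ∂μ) - c₂ * (∫ x, f₂ x ∂μ) - c₃ * (∫ x, f₃ x ∂μ) - c₄ * ∫ x, f₄ x ∂μ := by
  have i₁ := h₁.const_mul c₁
  have i₂ := h₂.const_mul c₂
  have i₃ := h₃.const_mul c₃
  have i₄ := h₄.const_mul c₄
  have j₂ : Integrable (fun x => c₁ * f₁ x - c₂ * f₂ x) μ := i₁.sub i₂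
  have j₃ : Integrable (fun x => c₁ * f₁ x - c₂ * f₂ x - c₃ * f₃ x) μ := j₂.sub i₃
  refine ⟨j₃.sub i₄, ?_⟩
  rw [integral_sub j₃ i₄, integral_sub j₂ i₃, integral_sub i₁ i₂]
  simp only [integral_const_mul]

/-! ### The near part of the form and the time lag -/

section

variable {N : ℕ} {s q L : ℝ} {x₀ : RN N} {ρ d a b : ℝ} {v : RN N → ℝ → ℝ}
  {κ : RN N → RN N → ℝ → ℝ}

lemma crossTerm_eq_prod (U : Set (RN N)) {η g : RN N → ℝ} (hη : Measurable η)
    (hg : Measurable g) :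
    crossTerm s U η g = ∫⁻ z, ENNReal.ofReal (g z.1 * g z.2 * (η z.1 - η z.2) ^ 2 * wt s z.1 z.2)
      ∂((volume.restrict U).prod (volume.restrict U)) := by
  have := measurable_wt (N := N) s
  rw [crossTerm, lintegral_prod _ (by fun_prop)]

lemma sq_posPart_le {α ℓ : ℝ} (hα : 0 ≤ α) (hℓ : 0 ≤ ℓ) : (max (α - ℓ) 0) ^ 2 ≤ α ^ 2 :=
  pow_le_pow_left₀ (le_max_right _ _) (max_le (by linarith) hα) 2

lemma CylinderSub.lintegral_sq_lt_top (hS : CylinderSub s q L x₀ ρ d a b v κ) (hq : 1 ≤ q) :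
    ∫⁻ t in Ioc a b, ∫⁻ x in Metric.ball x₀ (ρ + d), ENNReal.ofReal (v x t ^ 2) < ⊤ := by
  obtain ⟨M, -, hM⟩ := hS.sq_bdd hq
  refine lt_of_le_of_lt (lintegral_mono_ae hM) ?_
  rw [lintegral_const]
  exact ENNReal.mul_lt_top ENNReal.ofReal_lt_top (by simp)

lemma CylinderSub.trunc_energy_lt_top (hS : CylinderSub s q L x₀ ρ d a b v κ) (hq : 1 ≤ q)
    {C Λ : ℝ} (hC : KernelMoment N s C) {η : RN N → ℝ} (hη : IsCutoff Λ η) {ℓ : ℝ → ℝ}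
    (hℓ : ∀ t, 0 ≤ ℓ t) :
    ∫⁻ t in Ioc a b, gagliardoSq s (Metric.ball x₀ (ρ + d))
      (fun x => max (v x t - ℓ t) 0 * η x) < ⊤ := by
  have hvm := hS.meas
  have h1 : ∀ t, gagliardoSq s (Metric.ball x₀ (ρ + d)) (fun x => max (v x t - ℓ t) 0 * η x)
      ≤ 2 * gagliardoSq s (Metric.ball x₀ (ρ + d)) (fun x => v x t)
        + ENNReal.ofReal (2 * (Λ ^ 2 * C))
          * ∫⁻ x in Metric.ball x₀ (ρ + d), ENNReal.ofReal (v x t ^ 2) := by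
    intro t
    refine (gagliardoSq_mul_cutoff_le hC hη _ (by fun_prop)).trans (add_le_add ?_ ?_)
    · exact mul_le_mul_right (gagliardoSq_posPart_le s (ℓ t) _ _) _
    · exact mul_le_mul_right (lintegral_mono fun x =>
        ENNReal.ofReal_le_ofReal (sq_posPart_le (hS.nonneg x t) (hℓ t))) _
  refine lt_of_le_of_lt (lintegral_mono h1) ?_
  rw [lintegral_add_left ((measurable_gagliardoSq _ hvm).const_mul 2),
    lintegral_const_mul' _ _ (by norm_num), lintegral_const_mul' _ _ ENNReal.ofReal_ne_top]
  exact ENNReal.add_lt_top.2 ⟨ENNReal.mul_lt_top (by norm_num) hS.energy,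
    ENNReal.mul_lt_top ENNReal.ofReal_lt_top (hS.lintegral_sq_lt_top hq)⟩

lemma CylinderSub.crossTerm_lt_top (hS : CylinderSub s q L x₀ ρ d a b v κ) (hq : 1 ≤ q)
    {C Λ : ℝ} (hC : KernelMoment N s C) {η : RN N → ℝ} (hη : IsCutoff Λ η) {ℓ : ℝ → ℝ}
    (hℓ : ∀ t, 0 ≤ ℓ t) :
    ∫⁻ t in Ioc a b, crossTerm s (Metric.ball x₀ (ρ + d)) η
      (fun x => max (v x t - ℓ t) 0) < ⊤ := by
  have hvm := hS.meas
  have h1 : ∀ t, crossTerm s (Metric.ball x₀ (ρ + d)) η (fun x => max (v x t - ℓ t) 0)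
      ≤ ENNReal.ofReal (2 * (Λ ^ 2 * C))
          * ∫⁻ x in Metric.ball x₀ (ρ + d), ENNReal.ofReal (v x t ^ 2) := by
    intro t
    refine (crossTerm_le hC hη _ (by fun_prop)).trans ?_
    exact mul_le_mul_right (lintegral_mono fun x =>
        ENNReal.ofReal_le_ofReal (sq_posPart_le (hS.nonneg x t) (hℓ t))) _
  refine lt_of_le_of_lt (lintegral_mono h1) ?_
  rw [lintegral_const_mul' _ _ ENNReal.ofReal_ne_top]
  exact ENNReal.mul_lt_top ENNReal.ofReal_lt_top (hS.lintegral_sq_lt_top hq)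

/-- Lower bound for the near part of the form, with the time-lag absorbed into an error term. -/
lemma CylinderSub.near_lower (hS : CylinderSub s q L x₀ ρ d a b v κ) (hq : 1 ≤ q)
    (hL : 0 < L) {ε : ℝ} (hε : 0 < ε) {C Λ : ℝ} (hC : KernelMoment N s C) {η : RN N → ℝ}
    (hη : IsCutoff Λ η) {ℓ : ℝ → ℝ} (hℓm : Measurable ℓ) (hℓ : ∀ t, 0 ≤ ℓ t)
    {I : Set ℝ} (hI : I ⊆ Ioc a b) {ψ : RN N → ℝ} (hψ : Measurable ψ)
    (hψg : gagliardoSq s (Metric.ball x₀ (ρ + d)) ψ < ⊤)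
    (hJ : Integrable (fun z : (RN N × RN N) × ℝ =>
        (v z.1.1 z.2 - v z.1.2 z.2) * (ψ z.1.1 - ψ z.1.2) * κ z.1.1 z.1.2 z.2)
      (((volume.restrict (Metric.ball x₀ (ρ + d))).prod
        (volume.restrict (Metric.ball x₀ (ρ + d)))).prod (volume.restrict I))) :
    (∫⁻ τ in I, gagliardoSq s (Metric.ball x₀ (ρ + d))
      (fun x => ψ x - max (v x τ - ℓ τ) 0 * η x ^ 2) < ⊤) ∧
    L⁻¹ * (∫ τ in I, (gagliardoSq s (Metric.ball x₀ (ρ + d))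
        (fun x => max (v x τ - ℓ τ) 0 * η x)).toReal)
      - L * (∫ τ in I, (crossTerm s (Metric.ball x₀ (ρ + d)) η
        (fun x => max (v x τ - ℓ τ) 0)).toReal)
      - L * ε * (∫ τ in I, (gagliardoSq s (Metric.ball x₀ (ρ + d)) (fun x => v x τ)).toReal)
      - L / (4 * ε) * (∫ τ in I, (gagliardoSq s (Metric.ball x₀ (ρ + d))
        (fun x => ψ x - max (v x τ - ℓ τ) 0 * η x ^ 2)).toReal)
      ≤ ∫ z, (v z.1.1 z.2 - v z.1.2 z.2) * (ψ z.1.1 - ψ z.1.2) * κ z.1.1 z.1.2 z.2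
      ∂(((volume.restrict (Metric.ball x₀ (ρ + d))).prod
        (volume.restrict (Metric.ball x₀ (ρ + d)))).prod (volume.restrict I)) := by
  set B := Metric.ball x₀ (ρ + d) with hB
  have hwt := measurable_wt (N := N) s
  have hvm := hS.meas
  have hηm := hη.cont.measurable
  have hIab : volume.restrict I ≤ volume.restrict (Ioc a b) := Measure.restrict_mono_set _ hI
  have hIfin : volume I < ⊤ := (measure_mono hI).trans_lt measure_Ioc_lt_top
  have hW0 : ∀ z : (RN N × RN N) × ℝ, 0 ≤ wt s z.1.1 z.1.2 := fun z => wt_nonneg _ _ _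
  set Q₁ : (RN N × RN N) × ℝ → ℝ := fun z => (max (v z.1.1 z.2 - ℓ z.2) 0 * η z.1.1
    - max (v z.1.2 z.2 - ℓ z.2) 0 * η z.1.2) ^ 2 * wt s z.1.1 z.1.2 with hQ₁
  set Q₂ : (RN N × RN N) × ℝ → ℝ := fun z => max (v z.1.1 z.2 - ℓ z.2) 0
    * max (v z.1.2 z.2 - ℓ z.2) 0 * (η z.1.1 - η z.1.2) ^ 2 * wt s z.1.1 z.1.2 with hQ₂
  set Q₃ : (RN N × RN N) × ℝ → ℝ := fun z =>
    (v z.1.1 z.2 - v z.1.2 z.2) ^ 2 * wt s z.1.1 z.1.2 with hQ₃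
  set Q₄ : (RN N × RN N) × ℝ → ℝ := fun z => (ψ z.1.1 - max (v z.1.1 z.2 - ℓ z.2) 0 * η z.1.1 ^ 2
    - (ψ z.1.2 - max (v z.1.2 z.2 - ℓ z.2) 0 * η z.1.2 ^ 2)) ^ 2 * wt s z.1.1 z.1.2 with hQ₄
  have l₁ : ∀ τ, ∫⁻ z, ENNReal.ofReal (Q₁ (z, τ)) ∂((volume.restrict B).prod (volume.restrict B))
      = gagliardoSq s B (fun x => max (v x τ - ℓ τ) 0 * η x) := fun τ =>
    by rw [gagliardoSq_eq_prod s B (by fun_prop)]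
  have l₂ : ∀ τ, ∫⁻ z, ENNReal.ofReal (Q₂ (z, τ)) ∂((volume.restrict B).prod (volume.restrict B))
      = crossTerm s B η (fun x => max (v x τ - ℓ τ) 0) := fun τ =>
    by rw [crossTerm_eq_prod B hηm (by fun_prop)]
  have l₃ : ∀ τ, ∫⁻ z, ENNReal.ofReal (Q₃ (z, τ)) ∂((volume.restrict B).prod (volume.restrict B))
      = gagliardoSq s B (fun x => v x τ) := fun τ =>
    by rw [gagliardoSq_eq_prod s B (by fun_prop)]
  have l₄ : ∀ τ, ∫⁻ z, ENNReal.ofReal (Q₄ (z, τ)) ∂((volume.restrict B).prod (volume.restrict B))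
      = gagliardoSq s B (fun x => ψ x - max (v x τ - ℓ τ) 0 * η x ^ 2) := fun τ =>
    by rw [gagliardoSq_eq_prod s B (by fun_prop)]
  have f₄ : ∫⁻ τ in I, gagliardoSq s B (fun x => ψ x - max (v x τ - ℓ τ) 0 * η x ^ 2) < ⊤ := by
    refine lt_of_le_of_lt (lintegral_mono fun τ => gagliardoSq_sub_le s B hψ) ?_
    rw [lintegral_add_left measurable_const, lintegral_const, Measure.restrict_apply_univ,
      lintegral_const_mul' _ _ (by norm_num)]
    exact ENNReal.add_lt_top.2 ⟨ENNReal.mul_lt_top (ENNReal.mul_lt_top (by norm_num) hψg) hIfin,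
      ENNReal.mul_lt_top (by norm_num) (lt_of_le_of_lt (lintegral_mono' hIab le_rfl)
        (hS.trunc_energy_lt_top hq hC hη.sq hℓ))⟩
  have f₁ : ∫⁻ τ in I, gagliardoSq s B (fun x => max (v x τ - ℓ τ) 0 * η x) < ⊤ :=
    lt_of_le_of_lt (lintegral_mono' hIab le_rfl) (hS.trunc_energy_lt_top hq hC hη hℓ)
  have f₂ : ∫⁻ τ in I, crossTerm s B η (fun x => max (v x τ - ℓ τ) 0) < ⊤ :=
    lt_of_le_of_lt (lintegral_mono' hIab le_rfl) (hS.crossTerm_lt_top hq hC hη hℓ)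
  have i₁ := integrable_prod_of_lintegral (ν := (volume.restrict B).prod (volume.restrict B))
    (I := I) (Q := Q₁) (by fun_prop) (fun z => mul_nonneg (sq_nonneg _) (hW0 z))
    (by simp only [l₁]; exact f₁)
  have i₂ := integrable_prod_of_lintegral (ν := (volume.restrict B).prod (volume.restrict B))
    (I := I) (Q := Q₂) (by fun_prop) (fun z => mul_nonneg (mul_nonneg (mul_nonneg
      (le_max_right _ _) (le_max_right _ _)) (sq_nonneg _)) (hW0 z))
    (by simp only [l₂]; exact f₂)
  have i₃ := integrable_prod_of_lintegral (ν := (volume.restrict B).prod (volume.restrict B))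
    (I := I) (Q := Q₃) (by fun_prop) (fun z => mul_nonneg (sq_nonneg _) (hW0 z))
    (by simp only [l₃]; exact lt_of_le_of_lt (lintegral_mono' hIab le_rfl) hS.energy)
  have i₄ := integrable_prod_of_lintegral (ν := (volume.restrict B).prod (volume.restrict B))
    (I := I) (Q := Q₄) (by fun_prop) (fun z => mul_nonneg (sq_nonneg _) (hW0 z))
    (by simp only [l₄]; exact f₄)
  simp only [l₁] at i₁
  simp only [l₂] at i₂
  simp only [l₃] at i₃
  simp only [l₄] at i₄
  refine ⟨f₄, ?_⟩
  have hlin := integral_lincomb i₁.1 i₂.1 i₃.1 i₄.1 L⁻¹ L (L * ε) (L / (4 * ε))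
  rw [← i₁.2, ← i₂.2, ← i₃.2, ← i₄.2, ← hlin.2]
  refine integral_mono hlin.1 hJ fun z => ?_
  exact near_pointwise hL hε (hW0 z) (hS.lower _ _ _) (hS.upper _ _ _)

/-- The translation estimate in time for the truncated, localized function. -/
lemma CylinderSub.lag_small (hS : CylinderSub s q L x₀ ρ d a b v κ) (hq : 1 ≤ q)
    {C Λ : ℝ} (hC : KernelMoment N s C) {η : RN N → ℝ}
    (hη : IsCutoff Λ η) {ℓ : ℝ → ℝ} (hℓm : Measurable ℓ) (hℓ : ∀ t, 0 ≤ ℓ t) :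
    ∀ ε > 0, ∃ δ > 0, ∀ h, 0 < h → h < δ →
      ∫⁻ t in Ioc (a + h) b, ∫⁻ τ in Ioc (t - h) t, gagliardoSq s (Metric.ball x₀ (ρ + d))
        (fun x => max (v x t - ℓ t) 0 * η x - max (v x τ - ℓ τ) 0 * η x)
        ≤ ENNReal.ofReal (ε * h) := by
  intro ε hε
  set B := Metric.ball x₀ (ρ + d) with hB
  have hBm : MeasurableSet B := Metric.isOpen_ball.measurableSet
  have hwt := measurable_wt (N := N) s
  have hvm := hS.meas
  have hηm := hη.cont.measurable
  set ψ : RN N → ℝ → ℝ := fun x t => max (v x t - ℓ t) 0 * η x with hψ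
  have hψm : Measurable fun z : RN N × ℝ => ψ z.1 z.2 := by simp only [hψ]; fun_prop
  -- The Gagliardo energy becomes a plain `L²` norm of this function on pairs of points. Translating
  -- it in time therefore falls under continuity of translations.
  set H₀ : (RN N × RN N) × ℝ → ℝ := fun z =>
    (ψ z.1.1 z.2 - ψ z.1.2 z.2) * √(wt s z.1.1 z.1.2) with hH₀
  have hH₀m : Measurable H₀ := by simp only [hH₀]; fun_prop
  set S : Set ((RN N × RN N) × ℝ) := (B ×ˢ B) ×ˢ Ioc a b with hSdef
  have hSm : MeasurableSet S := (hBm.prod hBm).prod measurableSet_Ioc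
  have hsq : ∀ z, H₀ z ^ 2 = (ψ z.1.1 z.2 - ψ z.1.2 z.2) ^ 2 * wt s z.1.1 z.1.2 := fun z => by
    simp only [hH₀, mul_pow, Real.sq_sqrt (wt_nonneg s _ _)]
  have hBB : (volume : Measure (RN N × RN N)).restrict (B ×ˢ B)
      = (volume.restrict B).prod (volume.restrict B) := by
    rw [Measure.volume_eq_prod, Measure.prod_restrict]
  have hrest : (volume : Measure ((RN N × RN N) × ℝ)).restrict S
      = ((volume.restrict B).prod (volume.restrict B)).prod (volume.restrict (Ioc a b)) := by
    rw [← hBB, Measure.prod_restrict, ← Measure.volume_eq_prod]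
  have hint := integrable_prod_of_lintegral
    (ν := (volume.restrict B).prod (volume.restrict B)) (I := Ioc a b) (Q := fun z => H₀ z ^ 2)
    (by fun_prop) (fun z => sq_nonneg _) (by
      refine lt_of_eq_of_lt (lintegral_congr fun τ => ?_) (hS.trunc_energy_lt_top hq hC hη hℓ)
      simp only [hsq]
      rw [gagliardoSq_eq_prod s B (by fun_prop)])
  have hmem : MemLp (S.indicator H₀) 2 volume := by
    rw [memLp_indicator_iff_restrict hSm, hrest, memLp_two_iff_integrable_sq
      hH₀m.aestronglyMeasurable]
    exact hint.1
  obtain ⟨δ, hδ, hT⟩ := time_translation_L2 hmem ε hε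
  refine ⟨δ, hδ, fun h h0 hhδ => ?_⟩
  -- substitute `τ = t - σ`
  set g : ℝ → ℝ → ℝ≥0∞ := fun t σ => gagliardoSq s B (fun x => ψ x t - ψ x (t - σ)) with hg
  have hgm : Measurable (Function.uncurry g) := by
    have e : Function.uncurry g = fun p : ℝ × ℝ => ∫⁻ z, ENNReal.ofReal
        ((ψ z.1 p.1 - ψ z.1 (p.1 - p.2) - (ψ z.2 p.1 - ψ z.2 (p.1 - p.2))) ^ 2 * wt s z.1 z.2)
        ∂((volume.restrict B).prod (volume.restrict B)) := by
      funext p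
      exact gagliardoSq_eq_prod s B (by fun_prop)
    rw [e]
    exact Measurable.lintegral_prod_left' (f := fun w : (RN N × RN N) × (ℝ × ℝ) => ENNReal.ofReal
      ((ψ w.1.1 w.2.1 - ψ w.1.1 (w.2.1 - w.2.2) - (ψ w.1.2 w.2.1 - ψ w.1.2 (w.2.1 - w.2.2))) ^ 2
        * wt s w.1.1 w.1.2)) (by fun_prop)
  have hsub : ∀ t, ∫⁻ τ in Ioc (t - h) t, gagliardoSq s B (fun x => ψ x t - ψ x τ)
      = ∫⁻ σ in Ico 0 h, g t σ := by
    intro t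
    rw [← lintegral_indicator measurableSet_Ioc, ← lintegral_indicator measurableSet_Ico,
      ← lintegral_sub_left_eq_self (μ := (volume : Measure ℝ)) _ t]
    refine lintegral_congr fun σ => ?_
    by_cases hσ : σ ∈ Ico 0 h
    · rw [indicator_of_mem hσ, indicator_of_mem (show t - σ ∈ Ioc (t - h) t from
        ⟨by linarith [hσ.2], by linarith [hσ.1]⟩)]
    · rw [indicator_of_notMem hσ, indicator_of_notMem]
      rintro ⟨h1, h2⟩
      exact hσ ⟨by linarith, by linarith⟩
  -- For each fixed lag the integral over `t` is at most `ε`. Integrating over lags in `[0, h)` then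
  -- yields the factor `h`. Starting at `a + h` keeps both times inside `(a, b]`.
  have hσ : ∀ σ ∈ Ico 0 h, ∫⁻ t in Ioc (a + h) b, g t σ ≤ ENNReal.ofReal ε := by
    intro σ hσ
    refine le_trans ?_ (hT σ (by rw [abs_of_nonneg hσ.1]; linarith [hσ.2]))
    have hHm : Measurable (S.indicator H₀) := hH₀m.indicator hSm
    rw [Measure.volume_eq_prod (RN N × RN N) ℝ, lintegral_prod_symm _ (by fun_prop)]
    refine le_trans (setLIntegral_mono' measurableSet_Ioc fun t ht => ?_)
      (setLIntegral_le_lintegral (Ioc (a + h) b) _)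
    simp only [hg]
    rw [gagliardoSq_eq_prod s B (by fun_prop), ← hBB]
    refine le_trans (le_of_eq (setLIntegral_congr_fun (hBm.prod hBm) fun z hz => ?_))
      (setLIntegral_le_lintegral (B ×ˢ B) _)
    have m1 : ((z, t) : (RN N × RN N) × ℝ) ∈ S := ⟨hz, by linarith [ht.1], ht.2⟩
    have m2 : ((z, t - σ) : (RN N × RN N) × ℝ) ∈ S :=
      ⟨hz, by show a < t - σ; linarith [ht.1, hσ.2], by show t - σ ≤ b; linarith [ht.2, hσ.1]⟩
    simp only [indicator_of_mem m1, indicator_of_mem m2]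
    congr 1
    rw [show H₀ (z, t) - H₀ (z, t - σ)
        = (ψ z.1 t - ψ z.1 (t - σ) - (ψ z.2 t - ψ z.2 (t - σ))) * √(wt s z.1 z.2) by
      simp only [hH₀]; ring, mul_pow, Real.sq_sqrt (wt_nonneg s _ _)]
  change ∫⁻ t in Ioc (a + h) b, ∫⁻ τ in Ioc (t - h) t,
    gagliardoSq s B (fun x => ψ x t - ψ x τ) ≤ _
  simp only [hsub]
  rw [lintegral_lintegral_swap hgm.aemeasurable]
  refine (setLIntegral_mono' measurableSet_Ico hσ).trans ?_
  rw [setLIntegral_const, Real.volume_Ico, sub_zero, ← ENNReal.ofReal_mul hε.le]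

end

lemma ae_shift {a b h : ℝ} (hh : 0 < h) {p : ℝ → Prop}
    (hp : ∀ᵐ t ∂(volume.restrict (Ioc a b)), p t) :
    ∀ᵐ t ∂(volume.restrict (Ioc (a + h) b)), p t ∧ p (t - h) := by
  rw [ae_restrict_iff' measurableSet_Ioc] at hp ⊢
  have h2 := (measurePreserving_sub_right (volume : Measure ℝ) h).quasiMeasurePreserving.ae hp
  filter_upwards [hp, h2] with t h3 h4 ht
  exact ⟨h3 ⟨by linarith [ht.1], ht.2⟩, h4 ⟨by linarith [ht.1], by linarith [ht.2]⟩⟩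

lemma memLp_of_lintegral_rpow {α : Type*} [MeasurableSpace α] {μ : Measure α} {f : α → ℝ}
    (hf : Measurable f) (h0 : ∀ x, 0 ≤ f x) {p : ℝ} (hp : 0 < p)
    (h : ∫⁻ x, ENNReal.ofReal (f x ^ p) ∂μ < ⊤) : MemLp f (ENNReal.ofReal p) μ := by
  refine ⟨hf.aestronglyMeasurable, ?_⟩
  rw [eLpNorm_lt_top_iff_lintegral_rpow_enorm_lt_top (by simpa using hp) ENNReal.ofReal_ne_top,
    ENNReal.toReal_ofReal hp.le]
  refine lt_of_eq_of_lt (lintegral_congr fun x => ?_) h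
  rw [← ENNReal.ofReal_rpow_of_nonneg (h0 x) hp.le, ← ofReal_norm, Real.norm_of_nonneg (h0 x)]

/-! ### The rising truncation level and one time step -/

section

variable {N : ℕ} {s q L : ℝ} {x₀ : RN N} {ρ d a b : ℝ} {v : RN N → ℝ → ℝ}
  {κ : RN N → RN N → ℝ → ℝ}

/-- The accumulated tail, by which the truncation level is raised in time. -/
noncomputable def tailLevel (s c a b : ℝ) (v : RN N → ℝ → ℝ) (t : ℝ) : ℝ :=
  ∫ τ in Iic t, (Ioc a b).indicator (fun τ => 2 * c * (tailAt s v τ).toReal) τ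

lemma CylinderSub.integrableOn_tail (hS : CylinderSub s q L x₀ ρ d a b v κ) (c : ℝ) :
    IntegrableOn (fun τ => 2 * c * (tailAt s v τ).toReal) (Ioc a b) :=
  (integrable_toReal_of_lintegral_ne_top (measurable_tailAt hS.meas).aemeasurable
    hS.tail.ne).const_mul _

lemma CylinderSub.integrable_tail (hS : CylinderSub s q L x₀ ρ d a b v κ) (c : ℝ) :
    Integrable ((Ioc a b).indicator (fun τ => 2 * c * (tailAt s v τ).toReal)) :=
  (integrable_indicator_iff measurableSet_Ioc).2 (hS.integrableOn_tail c)

lemma tail_indicator_nonneg {c : ℝ} (hc : 0 < c) (τ : ℝ) :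
    0 ≤ (Ioc a b).indicator (fun τ => 2 * c * (tailAt s v τ).toReal) τ :=
  indicator_nonneg (fun τ _ => by positivity) τ

lemma tailLevel_nonneg {c : ℝ} (hc : 0 < c) (t : ℝ) : 0 ≤ tailLevel s c a b v t :=
  integral_nonneg fun τ => tail_indicator_nonneg hc τ

lemma CylinderSub.tailLevel_le (hS : CylinderSub s q L x₀ ρ d a b v κ) {c : ℝ} (hc : 0 < c)
    (t : ℝ) : tailLevel s c a b v t
      ≤ ∫ τ, (Ioc a b).indicator (fun τ => 2 * c * (tailAt s v τ).toReal) τ :=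
  setIntegral_le_integral (hS.integrable_tail c)
    (ae_of_all _ fun τ => tail_indicator_nonneg hc τ)

lemma CylinderSub.tailLevel_mono (hS : CylinderSub s q L x₀ ρ d a b v κ) {c : ℝ} (hc : 0 < c) :
    Monotone (tailLevel s c a b v) := fun _ _ h =>
  setIntegral_mono_set (hS.integrable_tail c).integrableOn
    (ae_of_all _ fun τ => tail_indicator_nonneg hc τ) (Iic_subset_Iic.2 h).eventuallyLE

lemma CylinderSub.tailLevel_sub (hS : CylinderSub s q L x₀ ρ d a b v κ) {c t t' : ℝ}
    (ht : a ≤ t) (h : t ≤ t') (ht' : t' ≤ b) :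
    tailLevel s c a b v t' - tailLevel s c a b v t
      = ∫ τ in Ioc t t', 2 * c * (tailAt s v τ).toReal := by
  have h1 : Iic t' = Iic t ∪ Ioc t t' := (Iic_union_Ioc_eq_Iic h).symm
  unfold tailLevel
  rw [h1, setIntegral_union (Iic_disjoint_Ioc le_rfl) measurableSet_Ioc
    (hS.integrable_tail c).integrableOn (hS.integrable_tail c).integrableOn, add_sub_cancel_left]
  refine setIntegral_congr_fun measurableSet_Ioc fun τ hτ => ?_
  exact indicator_of_mem (show τ ∈ Ioc a b from ⟨by linarith [hτ.1], by linarith [hτ.2]⟩) _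

/-- The truncated energy at a fixed time. -/
noncomputable def sliceEnergy (q : ℝ) (U : Set (RN N)) (η : RN N → ℝ) (ℓ : ℝ → ℝ)
    (v : RN N → ℝ → ℝ) (t : ℝ) : ℝ :=
  ∫ x in U, truncEnergy q (ℓ t) (v x t) * η x ^ 2

lemma measurable_truncEnergy : Measurable fun z : ℝ × ℝ => truncEnergy q z.1 z.2 := by
  unfold truncEnergy; fun_prop

lemma rpow_mul_le_add {α β : ℝ} (hα : 0 ≤ α) (hβ : 0 ≤ β) (hq : 0 < q) :
    α ^ q * β ≤ α ^ (q + 1) + β ^ (q + 1) := by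
  have h := mul_rpow_le_young hq hβ hα
  have h1 : β ^ (q + 1) / (q + 1) ≤ β ^ (q + 1) := div_le_self (by positivity) (by linarith)
  have h2 : q / (q + 1) * α ^ (q + 1) ≤ 1 * α ^ (q + 1) := by
    gcongr
    rw [div_le_one (by linarith)]; linarith
  linarith

/-- The change of the truncated energy between two times, for a slice with finite norms. -/
lemma sliceEnergy_sub_le (hq : 1 ≤ q) {U : Set (RN N)}
    (hUfin : volume U < ⊤) {η : RN N → ℝ} {Λ : ℝ} (hη : IsCutoff Λ η) {ℓ : ℝ → ℝ}
    (hv : Measurable fun z : RN N × ℝ => v z.1 z.2) (hv0 : ∀ x t, 0 ≤ v x t)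
    {t₁ t₂ : ℝ} (hℓ : 1 ≤ ℓ t₁) (hℓ' : ℓ t₁ ≤ ℓ t₂)
    (h₁ : ∫⁻ x in U, ENNReal.ofReal (v x t₁ ^ (q + 1)) < ⊤)
    (h₂ : ∫⁻ x in U, ENNReal.ofReal (v x t₂ ^ (q + 1)) < ⊤)
    {ε : ℝ} (hε : 0 ≤ ε)
    (hlag : ∫⁻ x in U, ENNReal.ofReal |v x t₂ - v x t₁| ≤ ENNReal.ofReal ε) :
    sliceEnergy q U η ℓ v t₂ - sliceEnergy q U η ℓ v t₁
        + (ℓ t₂ - ℓ t₁) * ((∫ x in U, max (v x t₂ - ℓ t₂) 0 * η x ^ 2) - ε)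
      ≤ ∫ x in U, (v x t₂ ^ q - v x t₁ ^ q) * (max (v x t₂ - ℓ t₂) 0 * η x ^ 2) := by
  have hq0 : 0 < q := by linarith
  have hηm := hη.cont.measurable
  have hG := measurable_truncEnergy (q := q)
  have hη2 : ∀ x, η x ^ 2 ≤ 1 := fun x => pow_le_one₀ (hη.nonneg x) (hη.le_one x)
  have p₁ : IntegrableOn (fun x => v x t₁ ^ (q + 1)) U :=
    ⟨Measurable.aestronglyMeasurable (by fun_prop), by
      rw [hasFiniteIntegral_iff_ofReal (ae_of_all _ fun x => Real.rpow_nonneg (hv0 _ _) _)]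
      exact h₁⟩
  have p₂ : IntegrableOn (fun x => v x t₂ ^ (q + 1)) U :=
    ⟨Measurable.aestronglyMeasurable (by fun_prop), by
      rw [hasFiniteIntegral_iff_ofReal (ae_of_all _ fun x => Real.rpow_nonneg (hv0 _ _) _)]
      exact h₂⟩
  have hone : IntegrableOn (fun _ : RN N => (1 : ℝ)) U := integrableOn_const hUfin.ne
  have hle1 : ∀ r : ℝ, 0 ≤ r → r ≤ 1 + r ^ (q + 1) := by
    intro r hr
    rcases le_total r 1 with h | h
    · linarith [Real.rpow_nonneg hr (q + 1)]
    · have := Real.rpow_le_rpow_of_exponent_le h (show (1 : ℝ) ≤ q + 1 by linarith)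
      rw [Real.rpow_one] at this
      linarith
  have hS : ∀ (ℓ₀ : ℝ), 1 ≤ ℓ₀ → ∀ t, IntegrableOn (fun x => v x t ^ (q + 1)) U →
      IntegrableOn (fun x => truncEnergy q ℓ₀ (v x t) * η x ^ 2) U := by
    intro ℓ₀ hℓ₀ t hp
    refine Integrable.mono' hp (by fun_prop) (ae_of_all _ fun x => ?_)
    have h0 := truncEnergy_nonneg (q := q) (ℓ := ℓ₀) (v := v x t) hq0 (by linarith)
    rw [Real.norm_of_nonneg (mul_nonneg h0 (sq_nonneg _))]
    exact (mul_le_of_le_one_right h0 (hη2 x)).trans (truncEnergy_le hq0 (by linarith) (hv0 x t))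
  have hM : ∀ t, IntegrableOn (fun x => v x t ^ (q + 1)) U →
      IntegrableOn (fun x => max (v x t - ℓ t₂) 0 * η x ^ 2) U := by
    intro t hp
    refine Integrable.mono' (hone.add hp) (by fun_prop) (ae_of_all _ fun x => ?_)
    have h0 : 0 ≤ max (v x t - ℓ t₂) 0 := le_max_right _ _
    rw [Real.norm_of_nonneg (mul_nonneg h0 (sq_nonneg _))]
    refine (mul_le_of_le_one_right h0 (hη2 x)).trans (le_trans ?_ (hle1 _ (hv0 x t)))
    exact max_le (by linarith) (hv0 x t)
  have hR : IntegrableOn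
      (fun x => (v x t₂ ^ q - v x t₁ ^ q) * (max (v x t₂ - ℓ t₂) 0 * η x ^ 2)) U := by
    refine Integrable.mono' ((p₁.add p₂).add p₂) (by fun_prop) (ae_of_all _ fun x => ?_)
    have h0 : 0 ≤ max (v x t₂ - ℓ t₂) 0 := le_max_right _ _
    have h1 : max (v x t₂ - ℓ t₂) 0 * η x ^ 2 ≤ v x t₂ :=
      (mul_le_of_le_one_right h0 (hη2 x)).trans (max_le (by linarith) (hv0 x t₂))
    have h2 : 0 ≤ max (v x t₂ - ℓ t₂) 0 * η x ^ 2 := mul_nonneg h0 (sq_nonneg _)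
    have a1 := Real.rpow_nonneg (hv0 x t₁) q
    have a2 := Real.rpow_nonneg (hv0 x t₂) q
    have h3 := rpow_mul_le_add (hv0 x t₁) (hv0 x t₂) hq0
    have h4 := rpow_add_one_eq hq0 (hv0 x t₂)
    have h5 := Real.rpow_nonneg (hv0 x t₁) (q + 1)
    simp only [Pi.add_apply]
    rw [Real.norm_eq_abs, abs_le]
    constructor <;> nlinarith
  -- Raising the level gains a term in `v(t₁)`, whereas the tail to be absorbed is multiplied by a
  -- truncation of `v(t₂)`. The exchange costs at most `ε`, by closeness of the two slices in `L¹`.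
  have hlag' : (∫ x in U, max (v x t₂ - ℓ t₂) 0 * η x ^ 2)
      - (∫ x in U, max (v x t₁ - ℓ t₂) 0 * η x ^ 2) ≤ ε := by
    rw [← integral_sub (hM _ p₂) (hM _ p₁)]
    have hD : IntegrableOn (fun x => |v x t₂ - v x t₁|) U :=
      ⟨by fun_prop, by
        rw [hasFiniteIntegral_iff_ofReal (ae_of_all _ fun x => abs_nonneg _)]
        exact hlag.trans_lt ENNReal.ofReal_lt_top⟩
    refine (integral_mono ((hM _ p₂).sub (hM _ p₁)) hD fun x => ?_).trans ?_
    · have := abs_max_sub_max_le_abs (v x t₂ - ℓ t₂) (v x t₁ - ℓ t₂) 0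
      rw [sub_sub_sub_cancel_right] at this
      have h3 := (le_abs_self _).trans this
      change max (v x t₂ - ℓ t₂) 0 * η x ^ 2 - max (v x t₁ - ℓ t₂) 0 * η x ^ 2 ≤ _
      rw [← sub_mul]
      exact (mul_le_mul_of_nonneg_right h3 (sq_nonneg _)).trans
        (mul_le_of_le_one_right (abs_nonneg _) (hη2 x))
    · rw [integral_eq_lintegral_of_nonneg_ae (ae_of_all _ fun x => abs_nonneg _) (by fun_prop)]
      exact ENNReal.toReal_le_of_le_ofReal hε hlag
  have hpt : ∀ x, truncEnergy q (ℓ t₂) (v x t₂) * η x ^ 2 - truncEnergy q (ℓ t₁) (v x t₁) * η x ^ 2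
      + (ℓ t₂ - ℓ t₁) * (max (v x t₁ - ℓ t₂) 0 * η x ^ 2)
      ≤ (v x t₂ ^ q - v x t₁ ^ q) * (max (v x t₂ - ℓ t₂) 0 * η x ^ 2) := by
    intro x
    have i1 := truncEnergy_sub_le (ℓ := ℓ t₂) hq0 (hv0 x t₂) (hv0 x t₁)
    have i2 := truncEnergy_level (v := v x t₁) hq hℓ hℓ'
    have i3 := mul_le_mul_of_nonneg_right (show truncEnergy q (ℓ t₂) (v x t₂)
      - truncEnergy q (ℓ t₁) (v x t₁) + (ℓ t₂ - ℓ t₁) * max (v x t₁ - ℓ t₂) 0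
      ≤ (v x t₂ ^ q - v x t₁ ^ q) * max (v x t₂ - ℓ t₂) 0 by linarith) (sq_nonneg (η x))
    linarith
  have j₂ := hS _ (hℓ.trans hℓ') t₂ p₂
  have j₁ := hS _ hℓ t₁ p₁
  have j₃ : IntegrableOn (fun x => truncEnergy q (ℓ t₂) (v x t₂) * η x ^ 2
    - truncEnergy q (ℓ t₁) (v x t₁) * η x ^ 2) U := j₂.sub j₁
  have j₄ : IntegrableOn (fun x => (ℓ t₂ - ℓ t₁) * (max (v x t₁ - ℓ t₂) 0 * η x ^ 2)) U :=
    (hM _ p₁).const_mul _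
  have hmono := integral_mono (j₃.add j₄) hR hpt
  have e : ∫ x in U, ((fun x => truncEnergy q (ℓ t₂) (v x t₂) * η x ^ 2
      - truncEnergy q (ℓ t₁) (v x t₁) * η x ^ 2)
      + fun x => (ℓ t₂ - ℓ t₁) * (max (v x t₁ - ℓ t₂) 0 * η x ^ 2)) x
      = sliceEnergy q U η ℓ v t₂ - sliceEnergy q U η ℓ v t₁
        + (ℓ t₂ - ℓ t₁) * ∫ x in U, max (v x t₁ - ℓ t₂) 0 * η x ^ 2 := by
    rw [integral_add' j₃ j₄, integral_sub j₂ j₁, integral_const_mul]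
    rfl
  rw [e] at hmono
  have : (ℓ t₂ - ℓ t₁) * ((∫ x in U, max (v x t₂ - ℓ t₂) 0 * η x ^ 2) - ε)
      ≤ (ℓ t₂ - ℓ t₁) * ∫ x in U, max (v x t₁ - ℓ t₂) 0 * η x ^ 2 :=
    mul_le_mul_of_nonneg_left (by linarith) (by linarith)
  linarith

/-- One time step of the energy inequality. -/
lemma CylinderSub.step_inequality (hS : CylinderSub s q L x₀ ρ d a b v κ) (hq : 1 ≤ q)
    (hs0 : 0 < s) (hL : 0 < L) (hd : 0 < d) (hd1 : d ≤ 1) {c : ℝ} (hc : 0 < c)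
    (hfar : ∀ x ∈ Metric.ball x₀ ρ, ∀ y ∉ Metric.ball x₀ (ρ + d),
      L * wt s x y ≤ c * tailWeight s y)
    {C Λ : ℝ} (hC : KernelMoment N s C) {η : RN N → ℝ} (hη : IsCutoff Λ η)
    (hηs : ∀ x, x ∉ Metric.ball x₀ ρ → η x = 0) {k : ℝ} (hk : 1 ≤ k) {ε : ℝ} (hε : 0 < ε) :
    ∃ δ > 0, ∀ h, 0 < h → h < δ → ∀ᵐ t ∂(volume.restrict (Ioc (a + h) b)),
      (∫⁻ τ in Ioc (t - h) t, gagliardoSq s (Metric.ball x₀ (ρ + d))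
        (fun x => max (v x t - (k + tailLevel s c a b v t)) 0 * η x ^ 2
          - max (v x τ - (k + tailLevel s c a b v τ)) 0 * η x ^ 2) < ⊤) ∧
      sliceEnergy q (Metric.ball x₀ (ρ + d)) η (fun t => k + tailLevel s c a b v t) v t
        - sliceEnergy q (Metric.ball x₀ (ρ + d)) η (fun t => k + tailLevel s c a b v t) v (t - h)
        + (L⁻¹ * (∫ τ in Ioc (t - h) t, (gagliardoSq s (Metric.ball x₀ (ρ + d))
            (fun x => max (v x τ - (k + tailLevel s c a b v τ)) 0 * η x)).toReal)
          - L * (∫ τ in Ioc (t - h) t, (crossTerm s (Metric.ball x₀ (ρ + d)) η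
            (fun x => max (v x τ - (k + tailLevel s c a b v τ)) 0)).toReal)
          - L * ε * (∫ τ in Ioc (t - h) t,
            (gagliardoSq s (Metric.ball x₀ (ρ + d)) (fun x => v x τ)).toReal)
          - ε * ∫ τ in Ioc (t - h) t, 2 * c * (tailAt s v τ).toReal)
      ≤ L / (4 * ε) * (∫ τ in Ioc (t - h) t, (gagliardoSq s (Metric.ball x₀ (ρ + d))
        (fun x => max (v x t - (k + tailLevel s c a b v t)) 0 * η x ^ 2
          - max (v x τ - (k + tailLevel s c a b v τ)) 0 * η x ^ 2)).toReal) := by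
  obtain ⟨δ, hδ, hu⟩ := hS.unif ε hε
  refine ⟨δ, hδ, fun h h0 hh => ?_⟩
  set B := Metric.ball x₀ (ρ + d) with hB
  have hBm : MeasurableSet B := Metric.isOpen_ball.measurableSet
  set ℓ : ℝ → ℝ := fun t => k + tailLevel s c a b v t with hℓdef
  have hℓm : Measurable ℓ := (hS.tailLevel_mono hc).measurable.const_add k
  have hℓ1 : ∀ t, 1 ≤ ℓ t := fun t => by
    have := tailLevel_nonneg (s := s) (a := a) (b := b) (v := v) hc t
    simp only [hℓdef]; linarith
  have hℓ0 : ∀ t, 0 ≤ ℓ t := fun t => zero_le_one.trans (hℓ1 t)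
  have hvm := hS.meas
  have hηm := hη.cont.measurable
  obtain ⟨M, hM⟩ := hS.bdd
  obtain ⟨M₂, -, hM₂⟩ := hS.sq_bdd hq
  have hgψ : ∀ᵐ t ∂(volume.restrict (Ioc a b)),
      gagliardoSq s B (fun x => max (v x t - ℓ t) 0 * η x ^ 2) < ⊤ := by
    refine ae_lt_top ?_ (hS.trunc_energy_lt_top hq hC hη.sq hℓ0).ne
    exact measurable_gagliardoSq (v := fun x t => max (v x t - ℓ t) 0 * η x ^ 2) B (by fun_prop)
  filter_upwards [hS.ineq h h0, hu h h0 hh, ae_shift h0 hM, ae_shift h0 hM₂, ae_shift h0 hgψ,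
    ae_restrict_mem measurableSet_Ioc] with t hineq hlag hMt hM₂t hgt ht
  -- The cylinder inequality holds, for almost every `t`, for all `ψ` at once. Hence `ψ` may depend
  -- on `t` and be the truncation of the solution itself.
  set ψ : RN N → ℝ := fun x => max (v x t - ℓ t) 0 * η x ^ 2 with hψ
  have hψm : Measurable ψ := by simp only [hψ]; fun_prop
  have hψ0 : ∀ x, 0 ≤ ψ x := fun x => mul_nonneg (le_max_right _ _) (sq_nonneg _)
  have hψs : ∀ x, x ∉ Metric.ball x₀ ρ → ψ x = 0 := fun x hx => by simp [hψ, hηs x hx]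
  have hψB : ∀ x, x ∉ B → ψ x = 0 := fun x hx =>
    hψs x fun h => hx (Metric.ball_subset_ball (by linarith) h)
  have hψv : ∀ x, ψ x ≤ v x t := fun x =>
    (mul_le_of_le_one_right (le_max_right _ _) (pow_le_one₀ (hη.nonneg x) (hη.le_one x))).trans
      (max_le (by linarith [hℓ0 t]) (hS.nonneg x t))
  have hψint : ∀ p : ℝ, 0 < p → ∫⁻ x, ENNReal.ofReal (ψ x ^ p)
      ≤ ∫⁻ x in B, ENNReal.ofReal (v x t ^ p) := by
    intro p hp
    rw [← lintegral_indicator hBm]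
    refine lintegral_mono fun x => ?_
    by_cases hx : x ∈ B
    · rw [indicator_of_mem hx]
      exact ENNReal.ofReal_le_ofReal (Real.rpow_le_rpow (hψ0 x) (hψv x) hp.le)
    · simp [hψB x hx, Real.zero_rpow hp.ne']
  have hψq : ∫⁻ x, ENNReal.ofReal (ψ x ^ (q + 1)) < ⊤ :=
    (hψint _ (by linarith)).trans_lt (hMt.1.trans_lt ENNReal.ofReal_lt_top)
  have hψ2 : ∫⁻ x, ENNReal.ofReal (ψ x ^ (2 : ℝ)) < ⊤ := by
    refine (hψint _ (by norm_num)).trans_lt ?_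
    simp only [Real.rpow_two]
    exact hM₂t.1.trans_lt ENNReal.ofReal_lt_top
  have hψ2' : ∫⁻ x, ENNReal.ofReal (ψ x ^ 2) < ⊤ := by simpa only [Real.rpow_two] using hψ2
  have hBfin : volume B < ⊤ := measure_ball_lt_top
  have hψ1 : ∫⁻ x, ENNReal.ofReal (ψ x) < ⊤ := by
    have : ∀ x, ENNReal.ofReal (ψ x) ≤ B.indicator 1 x + ENNReal.ofReal (ψ x ^ 2) := by
      intro x
      by_cases hx : x ∈ B
      · rw [indicator_of_mem hx, Pi.one_apply, ← ENNReal.ofReal_one,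
          ← ENNReal.ofReal_add zero_le_one (sq_nonneg _)]
        exact ENNReal.ofReal_le_ofReal (by nlinarith [sq_nonneg (ψ x - 1), hψ0 x])
      · simp [hψB x hx]
    refine (lintegral_mono this).trans_lt ?_
    rw [lintegral_add_left (measurable_one.indicator hBm), lintegral_indicator_one hBm]
    exact ENNReal.add_lt_top.2 ⟨hBfin, hψ2'⟩
  have hψuniv : gagliardoSq s univ ψ < ⊤ :=
    (gagliardoSq_univ_le hC hd hd1 x₀ hψm hψs).trans_lt (ENNReal.add_lt_top.2
      ⟨hgt.1, ENNReal.mul_lt_top ENNReal.ofReal_lt_top hψ2'⟩)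
  have main := hineq ψ hψm hψ0 hψB (memLp_of_lintegral_rpow hψm hψ0 (by linarith) hψq)
    (by simpa using memLp_of_lintegral_rpow hψm hψ0 (by norm_num) hψ2) hψuniv
  have hI : Ioc (t - h) t ⊆ Ioc a b := Ioc_subset_Ioc (by linarith [ht.1]) ht.2
  obtain ⟨hJ, hfs⟩ := hS.far_split hq hs0 hL hd hc hfar hI hψm hψ0 hψs hψ2' hψ1 hgt.1
  obtain ⟨hfin, hnl⟩ := hS.near_lower hq hL hε hC hη hℓm hℓ0 hI hψm hgt.1 hJ
  have hsl := sliceEnergy_sub_le hq hBfin hη hvm hS.nonneg (ℓ := ℓ) (hℓ1 (t - h))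
    (add_le_add_right (hS.tailLevel_mono hc (by linarith)) k) (hMt.2.trans_lt ENNReal.ofReal_lt_top)
    (hMt.1.trans_lt ENNReal.ofReal_lt_top) hε.le hlag
  -- The level increment equals the integral multiplying `∫ψ` in the nonlocal splitting. The two
  -- cancel, up to `ε` times the tail.
  have hΔ : ℓ t - ℓ (t - h) = ∫ τ in Ioc (t - h) t, 2 * c * (tailAt s v τ).toReal := by
    rw [← hS.tailLevel_sub (c := c) (by linarith [ht.1]) (by linarith) ht.2]
    simp only [hℓdef]; ring
  have hψI : ∫ x in B, max (v x t - ℓ t) 0 * η x ^ 2 = ∫ x, ψ x :=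
    setIntegral_eq_integral_of_forall_compl_eq_zero fun x hx => hψB x hx
  rw [hψI, hΔ] at hsl
  refine ⟨hfin, ?_⟩
  simp only [hψ] at hnl hfs main hsl
  linarith

end

/-! ### The energy inequality -/

section

variable {N : ℕ} {s q L : ℝ} {x₀ : RN N} {ρ d a b : ℝ} {v : RN N → ℝ → ℝ}
  {κ : RN N → RN N → ℝ → ℝ}

lemma measurable_crossTerm (U : Set (RN N)) {η : RN N → ℝ} (hη : Measurable η)
    (hv : Measurable fun z : RN N × ℝ => v z.1 z.2) :
    Measurable fun τ => crossTerm s U η (fun x => v x τ) := by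
  have hwt := measurable_wt (N := N) s
  have e : (fun τ => crossTerm s U η (fun x => v x τ))
      = fun τ => ∫⁻ z, ENNReal.ofReal (v z.1 τ * v z.2 τ * (η z.1 - η z.2) ^ 2 * wt s z.1 z.2)
        ∂((volume.restrict U).prod (volume.restrict U)) := by
    funext τ
    rw [crossTerm_eq_prod U hη (by fun_prop)]
  rw [e]
  exact Measurable.lintegral_prod_left' (f := fun z : (RN N × RN N) × ℝ => ENNReal.ofReal
    (v z.1.1 z.2 * v z.1.2 z.2 * (η z.1.1 - η z.1.2) ^ 2 * wt s z.1.1 z.1.2)) (by fun_prop)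

/-- The energy inequality with an absorbed tail and a small multiple of the remaining terms. -/
lemma CylinderSub.perturbed_energy (hS : CylinderSub s q L x₀ ρ d a b v κ) (hab : a < b)
    (hq : 1 ≤ q) (hs0 : 0 < s) (hL : 0 < L) (hd : 0 < d) (hd1 : d ≤ 1) {c : ℝ} (hc : 0 < c)
    (hfar : ∀ x ∈ Metric.ball x₀ ρ, ∀ y ∉ Metric.ball x₀ (ρ + d),
      L * wt s x y ≤ c * tailWeight s y)
    {C Λ : ℝ} (hC : KernelMoment N s C) {η : RN N → ℝ} (hη : IsCutoff Λ η)
    (hηs : ∀ x, x ∉ Metric.ball x₀ ρ → η x = 0) {k : ℝ} (hk : 1 ≤ k) {ε : ℝ} (hε : 0 < ε) :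
    ∃ G : Set ℝ, G ⊆ Ioo a b ∧ (∀ᵐ t ∂(volume.restrict (Ioc a b)), t ∈ G) ∧
      ∀ t₁ ∈ G, ∀ t₂ ∈ G, t₁ < t₂ →
      sliceEnergy q (Metric.ball x₀ (ρ + d)) η (fun t => k + tailLevel s c a b v t) v t₂
        + (L⁻¹ * (∫ τ in Ioc t₁ t₂, (gagliardoSq s (Metric.ball x₀ (ρ + d))
            (fun x => max (v x τ - (k + tailLevel s c a b v τ)) 0 * η x)).toReal)
          - L * (∫ τ in Ioc t₁ t₂, (crossTerm s (Metric.ball x₀ (ρ + d)) η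
            (fun x => max (v x τ - (k + tailLevel s c a b v τ)) 0)).toReal)
          - L * ε * (∫ τ in Ioc t₁ t₂,
            (gagliardoSq s (Metric.ball x₀ (ρ + d)) (fun x => v x τ)).toReal)
          - ε * ∫ τ in Ioc t₁ t₂, 2 * c * (tailAt s v τ).toReal)
      ≤ sliceEnergy q (Metric.ball x₀ (ρ + d)) η (fun t => k + tailLevel s c a b v t) v t₁ := by
  set B := Metric.ball x₀ (ρ + d) with hB
  have hBm : MeasurableSet B := Metric.isOpen_ball.measurableSet
  have hBfin : volume B < ⊤ := measure_ball_lt_top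
  set ℓ : ℝ → ℝ := fun t => k + tailLevel s c a b v t with hℓdef
  have hℓm : Measurable ℓ := (hS.tailLevel_mono hc).measurable.const_add k
  have hℓ1 : ∀ t, 1 ≤ ℓ t := fun t => by
    have := tailLevel_nonneg (s := s) (a := a) (b := b) (v := v) hc t
    simp only [hℓdef]; linarith
  have hℓ0 : ∀ t, 0 ≤ ℓ t := fun t => zero_le_one.trans (hℓ1 t)
  have hvm := hS.meas
  have hηm := hη.cont.measurable
  have hGm := measurable_truncEnergy (q := q)
  have hq0 : 0 < q := by linarith
  -- the integrands in time
  have iA : IntegrableOn (fun τ => (gagliardoSq s B (fun x => max (v x τ - ℓ τ) 0 * η x)).toReal)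
      (Ioc a b) := integrable_toReal_of_lintegral_ne_top
    (measurable_gagliardoSq (v := fun x t => max (v x t - ℓ t) 0 * η x) B
      (by fun_prop)).aemeasurable (hS.trunc_energy_lt_top hq hC hη hℓ0).ne
  have iZ : IntegrableOn (fun τ => (crossTerm s B η (fun x => max (v x τ - ℓ τ) 0)).toReal)
      (Ioc a b) := integrable_toReal_of_lintegral_ne_top
    (measurable_crossTerm (v := fun x t => max (v x t - ℓ t) 0) B hηm (by fun_prop)).aemeasurable
    (hS.crossTerm_lt_top hq hC hη hℓ0).ne
  have iE : IntegrableOn (fun τ => (gagliardoSq s B (fun x => v x τ)).toReal) (Ioc a b) :=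
    integrable_toReal_of_lintegral_ne_top (measurable_gagliardoSq B hvm).aemeasurable hS.energy.ne
  have iF := hS.integrableOn_tail c
  set e : ℝ → ℝ := fun τ => L⁻¹ * (gagliardoSq s B (fun x => max (v x τ - ℓ τ) 0 * η x)).toReal
    - L * (crossTerm s B η (fun x => max (v x τ - ℓ τ) 0)).toReal
    - L * ε * (gagliardoSq s B (fun x => v x τ)).toReal
    - ε * (2 * c * (tailAt s v τ).toReal) with he
  have hlin : ∀ t₁ t₂, a ≤ t₁ → t₂ ≤ b → IntegrableOn e (Ioc t₁ t₂) ∧ ∫ τ in Ioc t₁ t₂, e τ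
      = L⁻¹ * (∫ τ in Ioc t₁ t₂, (gagliardoSq s B (fun x => max (v x τ - ℓ τ) 0 * η x)).toReal)
        - L * (∫ τ in Ioc t₁ t₂, (crossTerm s B η (fun x => max (v x τ - ℓ τ) 0)).toReal)
        - L * ε * (∫ τ in Ioc t₁ t₂, (gagliardoSq s B (fun x => v x τ)).toReal)
        - ε * ∫ τ in Ioc t₁ t₂, 2 * c * (tailAt s v τ).toReal := by
    intro t₁ t₂ h1 h2
    have hsub := Ioc_subset_Ioc h1 h2
    exact integral_lincomb (iA.mono_set hsub) (iZ.mono_set hsub) (iE.mono_set hsub)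
      (iF.mono_set hsub) L⁻¹ L (L * ε) ε
  have hei : IntervalIntegrable e volume a b :=
    (intervalIntegrable_iff_integrableOn_Ioc_of_le hab.le).2 (hlin a b le_rfl le_rfl).1
  -- The inequality says that `Φ` decreases. One time step gives this with the lag as right-hand
  -- side, which is `o(h)` after integration in `t`.
  set Φ : ℝ → ℝ := fun t => sliceEnergy q B η ℓ v t + ∫ τ in a..t, e τ with hΦ
  have hdiff : ∀ t₁ t₂, a ≤ t₁ → t₁ ≤ t₂ → t₂ ≤ b →
      Φ t₂ - Φ t₁ = sliceEnergy q B η ℓ v t₂ - sliceEnergy q B η ℓ v t₁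
        + ∫ τ in Ioc t₁ t₂, e τ := by
    intro t₁ t₂ h1 h2 h3
    have j1 : IntervalIntegrable e volume a t₁ := (intervalIntegrable_iff_integrableOn_Ioc_of_le
      h1).2 (hlin a t₁ le_rfl (h2.trans h3)).1
    have j2 : IntervalIntegrable e volume a t₂ := (intervalIntegrable_iff_integrableOn_Ioc_of_le
      (h1.trans h2)).2 (hlin a t₂ le_rfl h3).1
    rw [← intervalIntegral.integral_of_le h2,
      ← intervalIntegral.integral_interval_sub_left j2 j1]
    simp only [hΦ]; ring
  have hΦint : IntervalIntegrable Φ volume a b := by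
    refine IntervalIntegrable.add ?_ ?_
    · rw [intervalIntegrable_iff_integrableOn_Ioc_of_le hab.le]
      obtain ⟨M, hM⟩ := hS.bdd
      have hmeas : StronglyMeasurable fun t => sliceEnergy q B η ℓ v t := by
        have : Measurable fun z : RN N × ℝ => truncEnergy q (ℓ z.2) (v z.1 z.2) * η z.1 ^ 2 := by
          fun_prop
        exact this.stronglyMeasurable.integral_prod_left'
      refine Integrable.mono' (g := fun _ => |M|) (integrableOn_const (by simp))
        hmeas.aestronglyMeasurable ?_
      filter_upwards [hM] with t ht
      have h0 : ∀ x, 0 ≤ truncEnergy q (ℓ t) (v x t) * η x ^ 2 := fun x =>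
        mul_nonneg (truncEnergy_nonneg hq0 (hℓ0 t)) (sq_nonneg _)
      rw [sliceEnergy, Real.norm_of_nonneg (integral_nonneg h0),
        integral_eq_lintegral_of_nonneg_ae (ae_of_all _ h0)
          (Measurable.aestronglyMeasurable (by fun_prop))]
      refine ENNReal.toReal_le_of_le_ofReal (abs_nonneg _) (le_trans (lintegral_mono fun x => ?_)
        (ht.trans (ENNReal.ofReal_le_ofReal (le_abs_self M))))
      refine ENNReal.ofReal_le_ofReal ((mul_le_of_le_one_right (truncEnergy_nonneg hq0 (hℓ0 t))
        (pow_le_one₀ (hη.nonneg x) (hη.le_one x))).trans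
          (truncEnergy_le hq0 (hℓ0 t) (hS.nonneg x t)))
    · have hcont := intervalIntegral.continuousOn_primitive_interval'
        hei (left_mem_uIcc)
      exact hcont.intervalIntegrable
  have hshift : ∀ ε' > 0, ∃ δ > 0, ∀ h, 0 < h → h < δ →
      ∫⁻ t in Ioc (a + h) b, ENNReal.ofReal (Φ t - Φ (t - h)) ≤ ENNReal.ofReal (ε' * h) := by
    intro ε' hε'
    obtain ⟨δ₁, hδ₁, h₁⟩ := hS.step_inequality hq hs0 hL hd hd1 hc hfar hC hη hηs hk hε
    have hA : 0 < L / (4 * ε) := by positivity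
    -- `ε` is fixed before `h` becomes small, so the large factor `L / (4ε)` in front of the lag is
    -- absorbed by demanding a smaller lag.
    obtain ⟨δ₂, hδ₂, h₂⟩ := hS.lag_small hq hC hη.sq hℓm hℓ0 (ε' / (L / (4 * ε))) (by positivity)
    refine ⟨min δ₁ δ₂, lt_min hδ₁ hδ₂, fun h h0 hh => ?_⟩
    have hle : ∀ᵐ t ∂(volume.restrict (Ioc (a + h) b)), ENNReal.ofReal (Φ t - Φ (t - h))
        ≤ ENNReal.ofReal (L / (4 * ε)) * ∫⁻ τ in Ioc (t - h) t, gagliardoSq s B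
          (fun x => max (v x t - ℓ t) 0 * η x ^ 2 - max (v x τ - ℓ τ) 0 * η x ^ 2) := by
      filter_upwards [h₁ h h0 (hh.trans_le (min_le_left _ _)),
        ae_restrict_mem measurableSet_Ioc] with t ht htm
      rw [hdiff (t - h) t (by linarith [htm.1]) (by linarith) htm.2,
        (hlin (t - h) t (by linarith [htm.1]) htm.2).2]
      refine (ENNReal.ofReal_le_ofReal ht.2).trans ?_
      rw [ENNReal.ofReal_mul hA.le]
      refine mul_le_mul_right (le_of_eq ?_) _
      have hm : Measurable fun τ => gagliardoSq s B
          (fun x => max (v x t - ℓ t) 0 * η x ^ 2 - max (v x τ - ℓ τ) 0 * η x ^ 2) :=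
        measurable_gagliardoSq (v := fun x τ => max (v x t - ℓ t) 0 * η x ^ 2
          - max (v x τ - ℓ τ) 0 * η x ^ 2) B (by fun_prop)
      rw [integral_toReal hm.aemeasurable (ae_lt_top hm ht.1.ne), ENNReal.ofReal_toReal ht.1.ne]
    refine (lintegral_mono_ae hle).trans ?_
    rw [lintegral_const_mul' _ _ ENNReal.ofReal_ne_top]
    refine (mul_le_mul_right (h₂ h h0 (hh.trans_le (min_le_right _ _))) _).trans (le_of_eq ?_)
    rw [← ENNReal.ofReal_mul hA.le]
    congr 1
    field_simp
  obtain ⟨G, hG, hGae, hGm⟩ := ae_antitone_of_shift hab hΦint hshift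
  refine ⟨G, hG, hGae, fun t₁ h₁ t₂ h₂ hlt => ?_⟩
  have := hGm t₁ h₁ t₂ h₂ hlt
  have e1 := hdiff t₁ t₂ (hG h₁).1.le hlt.le (hG h₂).2.le
  rw [(hlin t₁ t₂ (hG h₁).1.le (hG h₂).2.le).2] at e1
  linarith

/-- The energy inequality above the level `k + tailLevel`. -/
theorem CylinderSub.energy_estimate (hS : CylinderSub s q L x₀ ρ d a b v κ) (hab : a < b)
    (hq : 1 ≤ q) (hs0 : 0 < s) (hL : 0 < L) (hd : 0 < d) (hd1 : d ≤ 1) {c : ℝ} (hc : 0 < c)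
    (hfar : ∀ x ∈ Metric.ball x₀ ρ, ∀ y ∉ Metric.ball x₀ (ρ + d),
      L * wt s x y ≤ c * tailWeight s y)
    {C Λ : ℝ} (hC : KernelMoment N s C) {η : RN N → ℝ} (hη : IsCutoff Λ η)
    (hηs : ∀ x, x ∉ Metric.ball x₀ ρ → η x = 0) {k : ℝ} (hk : 1 ≤ k) :
    ∃ G : Set ℝ, G ⊆ Ioo a b ∧ (∀ᵐ t ∂(volume.restrict (Ioc a b)), t ∈ G) ∧
      ∀ t₁ ∈ G, ∀ t₂ ∈ G, t₁ < t₂ →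
      (∫⁻ x in Metric.ball x₀ (ρ + d), ENNReal.ofReal
          (truncEnergy q (k + tailLevel s c a b v t₂) (v x t₂) * η x ^ 2))
        + ENNReal.ofReal L⁻¹ * (∫⁻ τ in Ioc t₁ t₂, gagliardoSq s (Metric.ball x₀ (ρ + d))
            (fun x => max (v x τ - (k + tailLevel s c a b v τ)) 0 * η x))
      ≤ (∫⁻ x in Metric.ball x₀ (ρ + d), ENNReal.ofReal
          (truncEnergy q (k + tailLevel s c a b v t₁) (v x t₁) * η x ^ 2))
        + ENNReal.ofReal L * ∫⁻ τ in Ioc t₁ t₂, crossTerm s (Metric.ball x₀ (ρ + d)) η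
            (fun x => max (v x τ - (k + tailLevel s c a b v τ)) 0) := by
  set B := Metric.ball x₀ (ρ + d) with hB
  set ℓ : ℝ → ℝ := fun t => k + tailLevel s c a b v t with hℓdef
  have hℓm : Measurable ℓ := (hS.tailLevel_mono hc).measurable.const_add k
  have hℓ0 : ∀ t, 0 ≤ ℓ t := fun t => by
    have := tailLevel_nonneg (s := s) (a := a) (b := b) (v := v) hc t
    simp only [hℓdef]; linarith
  have hvm := hS.meas
  have hηm := hη.cont.measurable
  have hGm := measurable_truncEnergy (q := q)
  have hq0 : 0 < q := by linarith
  -- Take `ε = 1/(n+1)` and intersect the countably many sets of good times. The two error terms are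
  -- `ε` times finite integrals and vanish in the limit.
  have hpos : ∀ n : ℕ, 0 < 1 / ((n : ℝ) + 1) := fun n => by positivity
  choose G hG hGae hGle using fun n : ℕ =>
    hS.perturbed_energy hab hq hs0 hL hd hd1 hc hfar hC hη hηs hk (hpos n)
  obtain ⟨M, hM⟩ := hS.bdd
  refine ⟨{t | (∀ n, t ∈ G n) ∧ ∫⁻ x in B, ENNReal.ofReal (v x t ^ (q + 1)) ≤ ENNReal.ofReal M},
    fun t ht => hG 0 (ht.1 0), ?_, ?_⟩
  · filter_upwards [ae_all_iff.2 hGae, hM] with t h1 h2 using ⟨h1, h2⟩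
  rintro t₁ ⟨g₁, m₁⟩ t₂ ⟨g₂, m₂⟩ hlt
  have hsub : Ioc t₁ t₂ ⊆ Ioc a b := Ioc_subset_Ioc (hG 0 (g₁ 0)).1.le (hG 0 (g₂ 0)).2.le
  have hmono : volume.restrict (Ioc t₁ t₂) ≤ volume.restrict (Ioc a b) :=
    Measure.restrict_mono_set _ hsub
  -- slices
  have hslice : ∀ t, ∫⁻ x in B, ENNReal.ofReal (v x t ^ (q + 1)) ≤ ENNReal.ofReal M →
      0 ≤ sliceEnergy q B η ℓ v t ∧
      ∫⁻ x in B, ENNReal.ofReal (truncEnergy q (ℓ t) (v x t) * η x ^ 2)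
        = ENNReal.ofReal (sliceEnergy q B η ℓ v t) := by
    intro t ht
    have h0 : ∀ x, 0 ≤ truncEnergy q (ℓ t) (v x t) * η x ^ 2 := fun x =>
      mul_nonneg (truncEnergy_nonneg hq0 (hℓ0 t)) (sq_nonneg _)
    refine ⟨integral_nonneg h0, ?_⟩
    rw [sliceEnergy, integral_eq_lintegral_of_nonneg_ae (ae_of_all _ h0)
      (Measurable.aestronglyMeasurable (by fun_prop)), ENNReal.ofReal_toReal]
    refine ne_top_of_le_ne_top ENNReal.ofReal_ne_top (le_trans (lintegral_mono fun x => ?_) ht)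
    exact ENNReal.ofReal_le_ofReal ((mul_le_of_le_one_right (truncEnergy_nonneg hq0 (hℓ0 t))
      (pow_le_one₀ (hη.nonneg x) (hη.le_one x))).trans
        (truncEnergy_le hq0 (hℓ0 t) (hS.nonneg x t)))
  -- time integrals
  have htime : ∀ g : ℝ → ℝ≥0∞, Measurable g → ∫⁻ τ in Ioc a b, g τ < ⊤ →
      0 ≤ ∫ τ in Ioc t₁ t₂, (g τ).toReal ∧
      ∫⁻ τ in Ioc t₁ t₂, g τ = ENNReal.ofReal (∫ τ in Ioc t₁ t₂, (g τ).toReal) := by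
    intro g hg hfin
    have hfin' : ∫⁻ τ in Ioc t₁ t₂, g τ < ⊤ := (lintegral_mono' hmono le_rfl).trans_lt hfin
    refine ⟨integral_nonneg fun τ => ENNReal.toReal_nonneg, ?_⟩
    rw [integral_toReal hg.aemeasurable (ae_lt_top hg hfin'.ne), ENNReal.ofReal_toReal hfin'.ne]
  obtain ⟨a0, hA⟩ := htime (fun τ => gagliardoSq s B (fun x => max (v x τ - ℓ τ) 0 * η x))
    (measurable_gagliardoSq (v := fun x t => max (v x t - ℓ t) 0 * η x) B (by fun_prop))
    (hS.trunc_energy_lt_top hq hC hη hℓ0)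
  obtain ⟨z0, hZ⟩ := htime (fun τ => crossTerm s B η (fun x => max (v x τ - ℓ τ) 0))
    (measurable_crossTerm (v := fun x t => max (v x t - ℓ t) 0) B hηm (by fun_prop))
    (hS.crossTerm_lt_top hq hC hη hℓ0)
  obtain ⟨s1, hs1⟩ := hslice t₁ m₁
  obtain ⟨s2, hs2⟩ := hslice t₂ m₂
  change (∫⁻ x in B, ENNReal.ofReal (truncEnergy q (ℓ t₂) (v x t₂) * η x ^ 2))
    + ENNReal.ofReal L⁻¹ * (∫⁻ τ in Ioc t₁ t₂,
        gagliardoSq s B (fun x => max (v x τ - ℓ τ) 0 * η x))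
    ≤ (∫⁻ x in B, ENNReal.ofReal (truncEnergy q (ℓ t₁) (v x t₁) * η x ^ 2))
    + ENNReal.ofReal L * ∫⁻ τ in Ioc t₁ t₂, crossTerm s B η (fun x => max (v x τ - ℓ τ) 0)
  rw [hs1, hs2, hA, hZ, ← ENNReal.ofReal_mul (by positivity), ← ENNReal.ofReal_mul hL.le,
    ← ENNReal.ofReal_add s2 (by positivity), ← ENNReal.ofReal_add s1 (by positivity)]
  refine ENNReal.ofReal_le_ofReal ?_
  set E := ∫ τ in Ioc t₁ t₂, (gagliardoSq s B (fun x => v x τ)).toReal with hE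
  set T := ∫ τ in Ioc t₁ t₂, 2 * c * (tailAt s v τ).toReal with hT
  have hlim : Tendsto (fun n : ℕ => 1 / ((n : ℝ) + 1) * (L * E + T)) atTop
      (𝓝 (0 * (L * E + T))) := tendsto_one_div_add_atTop_nhds_zero_nat.mul_const _
  rw [zero_mul] at hlim
  refine le_of_tendsto_of_tendsto' (tendsto_const_nhds (x := _))
    ((tendsto_const_nhds (x := sliceEnergy q B η ℓ v t₁
      + L * ∫ τ in Ioc t₁ t₂, (crossTerm s B η (fun x => max (v x τ - ℓ τ) 0)).toReal)).add hlim)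
    (fun n => ?_) |>.trans_eq (add_zero _)
  have := hGle n t₁ (g₁ n) t₂ (g₂ n) hlt
  linarith

end

/-! ### De Giorgi iteration -/

/-- The excess only sees the ball of radius `r`, so the cross term on the large ball must be
localized. If one point leaves the ball of radius `r`, the other must lie in the support of `η`, at
distance at least `δ`. The kernel is then bounded, and the outer factor is estimated by the `L¹`
norm of `V`. -/
lemma crossTerm_local_le {N : ℕ} {s C Λ r δ R : ℝ} {x₀ : RN N} (hs0 : 0 < s)
    (hC : KernelMoment N s C) {η : RN N → ℝ} (hη : IsCutoff Λ η) (hδ : 0 < δ)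
    (hηs : ∀ x, x ∉ Metric.ball x₀ (r - δ) → η x = 0) {g V : RN N → ℝ}
    (hg : Measurable g) (hV : Measurable V) (hg0 : ∀ x, 0 ≤ g x) (hgV : ∀ x, g x ≤ V x) :
    crossTerm s (Metric.ball x₀ R) η g
      ≤ ENNReal.ofReal (2 * (Λ ^ 2 * C)) * (∫⁻ x in Metric.ball x₀ r, ENNReal.ofReal (g x ^ 2))
        + ENNReal.ofReal (2 * (δ ^ ((N : ℝ) + 2 * s))⁻¹)
          * ((∫⁻ x in Metric.ball x₀ r, ENNReal.ofReal (g x))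
            * ∫⁻ x in Metric.ball x₀ R, ENNReal.ofReal (V x)) := by
  have hwt := measurable_wt (N := N) s
  have hηm := hη.cont.measurable
  set D := Metric.ball x₀ r with hD
  set B := Metric.ball x₀ R with hB
  have hDm : MeasurableSet D := Metric.isOpen_ball.measurableSet
  set c : ℝ := (δ ^ ((N : ℝ) + 2 * s))⁻¹ with hc
  have hc0 : 0 ≤ c := by positivity
  set I : RN N → RN N → ℝ≥0∞ := fun x y =>
    ENNReal.ofReal (g x * g y * (η x - η y) ^ 2 * wt s x y) with hI
  set gD : RN N → ℝ := D.indicator g with hgD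
  have hgDm : Measurable gD := hg.indicator hDm
  have hgD0 : ∀ x, 0 ≤ gD x := fun x => indicator_nonneg (fun x _ => hg0 x) x
  have hV0 : ∀ x, 0 ≤ V x := fun x => (hg0 x).trans (hgV x)
  have hout : ∀ x ∉ D, η x = 0 := fun x hx =>
    hηs x fun h => hx (Metric.ball_subset_ball (by linarith) h)
  have hoff : ∀ x ∈ D, ∀ y ∉ D, g x * g y * (η x - η y) ^ 2 * wt s x y ≤ c * (g x * V y) := by
    intro x _ y hy
    rw [hout y hy, sub_zero]
    by_cases hx' : x ∈ Metric.ball x₀ (r - δ)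
    · have h1 : δ ≤ ‖x - y‖ := by
        have h1 := dist_triangle y x x₀
        rw [Metric.mem_ball] at hx'
        rw [hD, Metric.mem_ball, not_lt] at hy
        rw [← dist_eq_norm, dist_comm]; linarith
      have h2 : wt s x y ≤ c := by
        unfold wt
        rw [hc]
        gcongr
      have h3 : η x ^ 2 ≤ 1 := pow_le_one₀ (hη.nonneg x) (hη.le_one x)
      have h4 : g x * g y * η x ^ 2 ≤ g x * V y :=
        (mul_le_of_le_one_right (mul_nonneg (hg0 x) (hg0 y)) h3).trans
          (mul_le_mul_of_nonneg_left (hgV y) (hg0 x))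
      rw [mul_comm c]
      exact mul_le_mul h4 h2 (wt_nonneg _ _ _) (mul_nonneg (hg0 x) (hV0 y))
    · rw [hηs x hx']
      have := mul_nonneg hc0 (mul_nonneg (hg0 x) (hV0 y))
      simpa using this
  have hpt : ∀ x y, I x y ≤ D.indicator (fun x => D.indicator (fun y => I x y) y) x
      + (ENNReal.ofReal c * (ENNReal.ofReal (gD x) * ENNReal.ofReal (V y))
        + ENNReal.ofReal c * (ENNReal.ofReal (V x) * ENNReal.ofReal (gD y))) := by
    intro x y
    by_cases hx : x ∈ D <;> by_cases hy : y ∈ D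
    · rw [indicator_of_mem hx, indicator_of_mem hy]; exact le_self_add
    · refine le_trans ?_ le_add_self
      refine le_trans ?_ le_self_add
      rw [hgD, indicator_of_mem hx, ← ENNReal.ofReal_mul (hg0 x), ← ENNReal.ofReal_mul hc0]
      exact ENNReal.ofReal_le_ofReal (hoff x hx y hy)
    · refine le_trans ?_ le_add_self
      refine le_trans ?_ le_add_self
      rw [hgD, indicator_of_mem hy, ← ENNReal.ofReal_mul (hV0 x), ← ENNReal.ofReal_mul hc0]
      refine ENNReal.ofReal_le_ofReal ?_
      have := hoff y hy x hx
      rw [wt_symm s y x] at this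
      nlinarith
    · simp [hI, hout x hx, hout y hy]
  have hIm : Measurable fun z : RN N × RN N => I z.1 z.2 := by fun_prop
  have h1 : ∫⁻ x in B, ∫⁻ y in B, D.indicator (fun x => D.indicator (fun y => I x y) y) x
      ≤ crossTerm s D η g := by
    rw [crossTerm, ← lintegral_indicator hDm]
    refine (setLIntegral_le_lintegral B _).trans (lintegral_mono fun x => ?_)
    by_cases hx : x ∈ D
    · simp only [indicator_of_mem hx]
      rw [← lintegral_indicator hDm]
      exact setLIntegral_le_lintegral B _
    · simp [indicator_of_notMem hx]
  have hgDint : ∫⁻ x in B, ENNReal.ofReal (gD x) ≤ ∫⁻ x in D, ENNReal.ofReal (g x) := by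
    rw [← lintegral_indicator hDm]
    refine (setLIntegral_le_lintegral B _).trans (lintegral_mono fun x => ?_)
    by_cases hx : x ∈ D
    · rw [hgD, indicator_of_mem hx, indicator_of_mem hx]
    · simp [hgD, indicator_of_notMem hx]
  have h2 : ∫⁻ x in B, ∫⁻ y in B, ENNReal.ofReal c * (ENNReal.ofReal (gD x) * ENNReal.ofReal (V y))
      ≤ ENNReal.ofReal c * ((∫⁻ x in D, ENNReal.ofReal (g x)) * ∫⁻ x in B, ENNReal.ofReal (V x)) := by
    simp only [lintegral_const_mul' _ _ ENNReal.ofReal_ne_top]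
    rw [lintegral_mul_const _ (by fun_prop)]
    gcongr
  have h3 : ∫⁻ x in B, ∫⁻ y in B, ENNReal.ofReal c * (ENNReal.ofReal (V x) * ENNReal.ofReal (gD y))
      ≤ ENNReal.ofReal c * ((∫⁻ x in D, ENNReal.ofReal (g x)) * ∫⁻ x in B, ENNReal.ofReal (V x)) := by
    simp only [lintegral_const_mul' _ _ ENNReal.ofReal_ne_top]
    rw [lintegral_mul_const _ (by fun_prop), mul_comm (∫⁻ x in B, ENNReal.ofReal (V x))]
    gcongr
  have hDD : Measurable fun z : RN N × RN N =>
      D.indicator (fun x => D.indicator (fun y => I x y) z.2) z.1 := by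
    have e : (fun z : RN N × RN N => D.indicator (fun x => D.indicator (fun y => I x y) z.2) z.1)
        = (D ×ˢ D).indicator fun z => I z.1 z.2 := by
      funext z
      by_cases hx : z.1 ∈ D <;> by_cases hy : z.2 ∈ D <;> simp [indicator, hx, hy]
    rw [e]
    exact hIm.indicator (hDm.prod hDm)
  calc crossTerm s B η g
      ≤ ∫⁻ x in B, ∫⁻ y in B, (D.indicator (fun x => D.indicator (fun y => I x y) y) x
      + (ENNReal.ofReal c * (ENNReal.ofReal (gD x) * ENNReal.ofReal (V y))
        + ENNReal.ofReal c * (ENNReal.ofReal (V x) * ENNReal.ofReal (gD y)))) :=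
        lintegral_mono fun x => lintegral_mono fun y => hpt x y
    _ = (∫⁻ x in B, ∫⁻ y in B, D.indicator (fun x => D.indicator (fun y => I x y) y) x)
      + ((∫⁻ x in B, ∫⁻ y in B, ENNReal.ofReal c * (ENNReal.ofReal (gD x) * ENNReal.ofReal (V y)))
        + ∫⁻ x in B, ∫⁻ y in B,
          ENNReal.ofReal c * (ENNReal.ofReal (V x) * ENNReal.ofReal (gD y))) := by
        rw [← lintegral_add_left (by fun_prop), ← lintegral_add_left
          (Measurable.lintegral_prod_right' (f := fun z : RN N × RN N =>
            D.indicator (fun x => D.indicator (fun y => I x y) z.2) z.1) hDD)]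
        refine lintegral_congr fun x => ?_
        rw [← lintegral_add_left (by fun_prop), ← lintegral_add_left]
        exact hDD.comp measurable_prodMk_left
    _ ≤ crossTerm s D η g + (ENNReal.ofReal c * ((∫⁻ x in D, ENNReal.ofReal (g x))
          * ∫⁻ x in B, ENNReal.ofReal (V x))
        + ENNReal.ofReal c * ((∫⁻ x in D, ENNReal.ofReal (g x))
          * ∫⁻ x in B, ENNReal.ofReal (V x))) := by gcongr
    _ ≤ _ := by
        rw [← two_mul, ENNReal.ofReal_mul (p := 2) (q := c) (by norm_num), ENNReal.ofReal_ofNat,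
          mul_assoc]
        gcongr
        exact crossTerm_le hC hη D hg

section

variable {N : ℕ} {s q L : ℝ} {x₀ : RN N} {ρ d a b : ℝ} {v : RN N → ℝ → ℝ}
  {κ : RN N → RN N → ℝ → ℝ}

/-- Pointwise comparison of truncations at two levels with gap `g`. -/
lemma truncation_gap {q l m g k₀ α : ℝ} (hq : 1 ≤ q) (hl : 0 < l) (hl1 : l ≤ 1) (hk₀ : 1 ≤ k₀)
    (hg : g = k₀ * l) (hm0 : 0 ≤ m) (hm : m + g ≤ 3 * k₀) (hα : 0 ≤ α) :
    (max (α - (m + g)) 0) ^ 2 ≤ (4 / l) ^ (q + 1) * (max (α - m) 0) ^ (q + 1) ∧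
    max (α - (m + g)) 0 ≤ (4 / l) ^ (q + 1) * (max (α - m) 0) ^ (q + 1) ∧
    truncEnergy q (m + g) α ≤ (4 / l) ^ (q + 1) * (max (α - m) 0) ^ (q + 1) := by
  have hg0 : 0 < g := by rw [hg]; positivity
  have hlg : l ≤ g := by rw [hg]; nlinarith
  have hq0 : 0 < q := by linarith
  rcases le_total α (m + g) with h | h
  · have h1 : max (α - (m + g)) 0 = 0 := max_eq_right (by linarith)
    have h2 : 0 ≤ (4 / l) ^ (q + 1) * (max (α - m) 0) ^ (q + 1) := by positivity
    rw [truncEnergy_of_le h, h1]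
    exact ⟨by simpa using h2, h2, h2⟩
  · have e1 : max (α - (m + g)) 0 = α - (m + g) := max_eq_left (by linarith)
    have e2 : max (α - m) 0 = α - m := max_eq_left (by linarith)
    rw [e1, e2]
    set w := α - m with hw
    have hw0 : g ≤ w := by linarith
    have hwpos : 0 < w := by linarith
    rw [← Real.mul_rpow (by positivity) hwpos.le]
    have hbase : 4 ≤ 4 / l * w := by
      rw [div_mul_eq_mul_div, le_div_iff₀ hl]; nlinarith
    have hb1 : (1 : ℝ) ≤ 4 / l * w := by linarith
    have hwb : w ≤ 4 / l * w := by
      refine le_mul_of_one_le_left hwpos.le ?_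
      rw [one_le_div hl]; linarith
    have hp1 : 4 / l * w ≤ (4 / l * w) ^ (q + 1) := by
      have := Real.rpow_le_rpow_of_exponent_le hb1 (show (1 : ℝ) ≤ q + 1 by linarith)
      rwa [Real.rpow_one] at this
    have hp2 : (4 / l * w) ^ 2 ≤ (4 / l * w) ^ (q + 1) := by
      have := Real.rpow_le_rpow_of_exponent_le hb1 (show (2 : ℝ) ≤ q + 1 by linarith)
      rwa [Real.rpow_two] at this
    refine ⟨le_trans ?_ hp2, by linarith, ?_⟩
    · exact pow_le_pow_left₀ (by linarith) (by linarith) 2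
    · refine (truncEnergy_le hq0 (by linarith) hα).trans
        (Real.rpow_le_rpow hα ?_ (by linarith))
      -- Above the upper level, `w ≥ k₀ l` while the lower level `m` is at most `3k₀`. So `m` is at
      -- most `(3/l) w`, and `α ≤ (4/l) w` with a constant free of `k₀`.
      have h3 : k₀ * 3 ≤ 3 / l * w := by
        rw [div_mul_eq_mul_div, le_div_iff₀ hl]
        have : k₀ * l ≤ w := by rw [← hg]; exact hw0
        nlinarith
      have h4 : 4 / l * w = 3 / l * w + 1 / l * w := by ring
      have h5 : w ≤ 1 / l * w := by
        refine le_mul_of_one_le_left hwpos.le ?_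
        rw [one_le_div hl]; exact hl1
      have : α = w + m := by rw [hw]; ring
      linarith

/-- The excess integral of the De Giorgi iteration. -/
noncomputable def excess (q : ℝ) (x₀ : RN N) (v : RN N → ℝ → ℝ) (F : ℝ → ℝ) (b r a' k : ℝ) :
    ℝ≥0∞ :=
  ∫⁻ t in Ioc a' b, ∫⁻ x in Metric.ball x₀ r,
    ENNReal.ofReal ((max (v x t - (k + F t)) 0) ^ (q + 1))

lemma CylinderSub.l1_bdd (hS : CylinderSub s q L x₀ ρ d a b v κ) (hq : 1 ≤ q) :
    ∃ M : ℝ, 0 < M ∧ ∀ᵐ t ∂(volume.restrict (Ioc a b)),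
      ∫⁻ x in Metric.ball x₀ (ρ + d), ENNReal.ofReal (v x t) ≤ ENNReal.ofReal M := by
  obtain ⟨M, hM0, hM⟩ := hS.sq_bdd hq
  have hVt : volume (Metric.ball x₀ (ρ + d)) ≠ ⊤ := measure_ball_lt_top.ne
  refine ⟨(volume (Metric.ball x₀ (ρ + d))).toReal + M, by positivity, ?_⟩
  filter_upwards [hM] with t ht
  have h1 : ∀ x, ENNReal.ofReal (v x t) ≤ 1 + ENNReal.ofReal (v x t ^ 2) := by
    intro x
    rw [← ENNReal.ofReal_one, ← ENNReal.ofReal_add zero_le_one (sq_nonneg _)]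
    exact ENNReal.ofReal_le_ofReal (by nlinarith [sq_nonneg (v x t - 1), hS.nonneg x t])
  refine (lintegral_mono h1).trans ?_
  rw [lintegral_add_left measurable_const, lintegral_one, Measure.restrict_apply_univ,
    ENNReal.ofReal_add (by positivity) hM0.le, ENNReal.ofReal_toReal hVt]
  exact add_le_add_right ht _

end

section

variable {N : ℕ} {s q L : ℝ} {x₀ : RN N} {ρ d a b : ℝ} {v : RN N → ℝ → ℝ}
  {κ : RN N → RN N → ℝ → ℝ}

/-- Some point of any set of full measure has a value not exceeding the average. This selects a good
initial time and makes a cut-off in time unnecessary. -/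
lemma exists_mem_le_of_setLIntegral_le {f : ℝ → ℝ≥0∞} (hf : Measurable f) {a b y : ℝ} (hab : a < b)
    (hy : ∫⁻ t in Ioc a b, f t ≤ ENNReal.ofReal y) {G : Set ℝ}
    (hG : ∀ᵐ t ∂(volume.restrict (Ioc a b)), t ∈ G) :
    ∃ t ∈ Ioc a b, t ∈ G ∧ f t ≤ ENNReal.ofReal (y / (b - a)) := by
  have hμ : volume.restrict (Ioc a b) ≠ 0 := by
    rw [Ne, Measure.restrict_eq_zero, Real.volume_Ioc]
    simpa using hab
  have hG' : ∀ᵐ t ∂(volume.restrict (Ioc a b)), t ∈ Ioc a b ∧ t ∈ G := by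
    filter_upwards [hG, ae_restrict_mem measurableSet_Ioc] with t h1 h2 using ⟨h2, h1⟩
  obtain ⟨t, ht, h⟩ := exists_notMem_null_le_laverage hμ hf.aemeasurable (ae_iff.1 hG')
  have ht' : t ∈ Ioc a b ∧ t ∈ G := by
    by_contra hc
    exact ht hc
  refine ⟨t, ht'.1, ht'.2, h.trans ?_⟩
  rw [setLAverage_eq, Real.volume_Ioc, ENNReal.ofReal_div_of_pos (by linarith)]
  gcongr

/-- Exhaustion from inside. It is needed because the energy inequality holds only between good
times, all of which are smaller than `b`. -/
lemma setLIntegral_Ioc_le_of_forall {f : ℝ → ℝ≥0∞} {a b : ℝ} {A : ℝ≥0∞}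
    (h : ∀ t < b, a < t → ∫⁻ τ in Ioc a t, f τ ≤ A) : ∫⁻ τ in Ioc a b, f τ ≤ A := by
  have e : Ioo a b = ⋃ n : ℕ, Ioc a (b - 1 / ((n : ℝ) + 1)) := by
    ext t
    simp only [mem_Ioo, mem_iUnion, mem_Ioc]
    constructor
    · rintro ⟨h1, h2⟩
      obtain ⟨n, hn⟩ := exists_nat_one_div_lt (show 0 < b - t by linarith)
      exact ⟨n, h1, by linarith⟩
    · rintro ⟨n, h1, h2⟩
      have : 0 < 1 / ((n : ℝ) + 1) := by positivity
      exact ⟨h1, by linarith⟩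
  rw [setLIntegral_congr Ioo_ae_eq_Ioc.symm, e, setLIntegral_iUnion_of_directed]
  · refine iSup_le fun n => ?_
    have : 0 < 1 / ((n : ℝ) + 1) := by positivity
    rcases lt_or_ge a (b - 1 / ((n : ℝ) + 1)) with h1 | h1
    · exact h _ (by linarith) h1
    · rw [Ioc_eq_empty (by linarith)]; simp
  · refine directed_of_isDirected_le fun m n hmn => Ioc_subset_Ioc_right ?_
    have : 1 / ((n : ℝ) + 1) ≤ 1 / ((m : ℝ) + 1) := by gcongr
    linarith

/-- Energy bounds on a smaller cylinder and at a higher level, in terms of the excess. -/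
lemma CylinderSub.energy_le_excess (hS : CylinderSub s q L x₀ ρ d a b v κ) (hab : a < b)
    (hq : 1 ≤ q) (hs0 : 0 < s) (hL : 0 < L) (hd : 0 < d) (hd1 : d ≤ 1) {c : ℝ} (hc : 0 < c)
    (hfar : ∀ x ∈ Metric.ball x₀ ρ, ∀ y ∉ Metric.ball x₀ (ρ + d),
      L * wt s x y ≤ c * tailWeight s y)
    {C Λ : ℝ} (hC0 : 0 < C) (hC : KernelMoment N s C) {η : RN N → ℝ} (hη : IsCutoff Λ η)
    {r δ : ℝ} (hrρ : r ≤ ρ) (hδ : 0 < δ) (hηs : ∀ x, x ∉ Metric.ball x₀ (r - δ) → η x = 0)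
    {M : ℝ} (hM0 : 0 < M) (hM : ∀ᵐ t ∂(volume.restrict (Ioc a b)),
      ∫⁻ x in Metric.ball x₀ (ρ + d), ENNReal.ofReal (v x t) ≤ ENNReal.ofReal M)
    {k₀ l k : ℝ} (hk₀ : 1 ≤ k₀) (hF : ∀ t, tailLevel s c a b v t ≤ k₀) (hl : 0 < l) (hl1 : l ≤ 1)
    (hk : 0 ≤ k) (hkl : 1 ≤ k + k₀ * l) (hk2 : k + k₀ * l ≤ 2 * k₀)
    {a' a'' : ℝ} (ha : a ≤ a') (haa : a' < a'') (hab' : a'' < b) {y : ℝ} (hy : 0 < y)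
    (hY : excess q x₀ v (tailLevel s c a b v) b r a' k ≤ ENNReal.ofReal y) {X : ℝ}
    (hX : X = (4 / l) ^ (q + 1) * y * (1 / (a'' - a')
      + L * (2 * (Λ ^ 2 * C) + 2 * (δ ^ ((N : ℝ) + 2 * s))⁻¹ * M))) :
    (∀ᵐ t ∂(volume.restrict (Ioc a'' b)), ∫⁻ x in Metric.ball x₀ (ρ + d), ENNReal.ofReal
        (truncEnergy q (k + k₀ * l + tailLevel s c a b v t) (v x t) * η x ^ 2)
        ≤ ENNReal.ofReal X) ∧
      ∫⁻ τ in Ioc a'' b, gagliardoSq s (Metric.ball x₀ (ρ + d))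
        (fun x => max (v x τ - (k + k₀ * l + tailLevel s c a b v τ)) 0 * η x)
        ≤ ENNReal.ofReal (L * X) := by
  set B := Metric.ball x₀ (ρ + d) with hB
  set F := tailLevel s c a b v with hFdef
  have hFm : Measurable F := (hS.tailLevel_mono hc).measurable
  have hF0 : ∀ t, 0 ≤ F t := fun t => tailLevel_nonneg hc t
  have hvm := hS.meas
  have hηm := hη.cont.measurable
  set P : ℝ := (4 / l) ^ (q + 1) with hP
  have hP0 : 0 < P := by positivity
  set D := Metric.ball x₀ r with hD
  have hDm : MeasurableSet D := Metric.isOpen_ball.measurableSet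
  have hDB : D ⊆ B := Metric.ball_subset_ball (by linarith)
  set E : ℝ → ℝ≥0∞ := fun t => ∫⁻ x in D, ENNReal.ofReal ((max (v x t - (k + F t)) 0) ^ (q + 1))
    with hE
  have hEm : Measurable E := by
    refine Measurable.lintegral_prod_left' (f := fun z : RN N × ℝ =>
      ENNReal.ofReal ((max (v z.1 z.2 - (k + F z.2)) 0) ^ (q + 1))) ?_
    fun_prop
  have hgap : ∀ x t, _ := fun x t => truncation_gap (q := q) (l := l) (m := k + F t) (g := k₀ * l)
    (k₀ := k₀) (α := v x t) hq hl hl1 hk₀ rfl (by linarith [hF0 t]) (by linarith [hF t])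
    (hS.nonneg x t)
  have hlev : ∀ t, k + k₀ * l + F t = k + F t + k₀ * l := fun t => by ring
  have hPE : ∀ t, ENNReal.ofReal P * E t
      = ∫⁻ x in D, ENNReal.ofReal (P * (max (v x t - (k + F t)) 0) ^ (q + 1)) := fun t => by
    rw [hE, ← lintegral_const_mul' _ _ ENNReal.ofReal_ne_top]
    simp_rw [ENNReal.ofReal_mul hP0.le]
  have hslice : ∀ t, ∫⁻ x in B, ENNReal.ofReal
      (truncEnergy q (k + k₀ * l + F t) (v x t) * η x ^ 2) ≤ ENNReal.ofReal P * E t := by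
    intro t
    rw [hPE, ← lintegral_indicator hDm]
    refine (setLIntegral_le_lintegral B _).trans (lintegral_mono fun x => ?_)
    by_cases hx : x ∈ D
    · rw [indicator_of_mem hx]
      refine ENNReal.ofReal_le_ofReal ?_
      rw [hlev]
      refine le_trans ?_ (hgap x t).2.2
      refine mul_le_of_le_one_right (truncEnergy_nonneg (by linarith) ?_)
        (pow_le_one₀ (hη.nonneg x) (hη.le_one x))
      linarith [hF0 t, mul_pos (zero_lt_one.trans_le hk₀) hl]
    · rw [hηs x fun h => hx (Metric.ball_subset_ball (by linarith) h)]
      simp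
  set Z : ℝ := 2 * (Λ ^ 2 * C) + 2 * (δ ^ ((N : ℝ) + 2 * s))⁻¹ * M with hZ
  have hZ0 : 0 ≤ Z := by positivity
  have hcross : ∀ᵐ t ∂(volume.restrict (Ioc a b)), crossTerm s B η
      (fun x => max (v x t - (k + k₀ * l + F t)) 0) ≤ ENNReal.ofReal (Z * P) * E t := by
    filter_upwards [hM] with t ht
    refine (crossTerm_local_le (V := fun x => v x t) (r := r) hs0 hC hη hδ hηs (by fun_prop)
      (by fun_prop) (fun x => le_max_right _ _) (fun x => max_le ?_ (hS.nonneg x t))).trans ?_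
    · linarith [hF0 t]
    · have h1 : ∫⁻ x in D, ENNReal.ofReal ((max (v x t - (k + k₀ * l + F t)) 0) ^ 2)
          ≤ ENNReal.ofReal P * E t := by
        rw [hPE]
        exact lintegral_mono fun x => ENNReal.ofReal_le_ofReal (by rw [hlev]; exact (hgap x t).1)
      have h2 : ∫⁻ x in D, ENNReal.ofReal (max (v x t - (k + k₀ * l + F t)) 0)
          ≤ ENNReal.ofReal P * E t := by
        rw [hPE]
        exact lintegral_mono fun x => ENNReal.ofReal_le_ofReal (by rw [hlev]; exact (hgap x t).2.1)
      calc _ ≤ ENNReal.ofReal (2 * (Λ ^ 2 * C)) * (ENNReal.ofReal P * E t)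
            + ENNReal.ofReal (2 * (δ ^ ((N : ℝ) + 2 * s))⁻¹)
              * ((ENNReal.ofReal P * E t) * ENNReal.ofReal M) := by gcongr
        _ = ENNReal.ofReal (Z * P) * E t := by
            rw [hZ, add_mul, ENNReal.ofReal_add (by positivity) (by positivity),
              ENNReal.ofReal_mul (p := 2 * (Λ ^ 2 * C)) (by positivity),
              ENNReal.ofReal_mul (p := 2 * (δ ^ ((N : ℝ) + 2 * s))⁻¹ * M) (by positivity),
              ENNReal.ofReal_mul (p := 2 * (δ ^ ((N : ℝ) + 2 * s))⁻¹) (by positivity)]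
            ring
  obtain ⟨G, hGs, hGae, hGe⟩ := hS.energy_estimate hab hq hs0 hL hd hd1 hc hfar hC hη
    (fun x hx => hηs x fun h => hx (Metric.ball_subset_ball (by linarith) h)) hkl
  have hsub1 : Ioc a' a'' ⊆ Ioc a' b := Ioc_subset_Ioc_right hab'.le
  -- The initial time lies in `(a', a'']` and has slice excess at most `y / (a'' - a')`, the source
  -- of the first term of `X`. Every good time after `a''` can then serve as the final time.
  obtain ⟨t₁, ht₁, ht₁G, hEt⟩ := exists_mem_le_of_setLIntegral_le hEm haa
    ((lintegral_mono_set hsub1).trans hY)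
    (ae_restrict_of_ae_restrict_of_subset (Ioc_subset_Ioc ha hab'.le) hGae)
  have hX' : X = P * (y / (a'' - a')) + L * (Z * P * y) := by
    rw [hX]; ring
  have hda : 0 < a'' - a' := by linarith
  have hmain : ∀ t₂ ∈ G, a'' < t₂ →
      (∫⁻ x in B, ENNReal.ofReal (truncEnergy q (k + k₀ * l + F t₂) (v x t₂) * η x ^ 2))
        + ENNReal.ofReal L⁻¹ * (∫⁻ τ in Ioc t₁ t₂, gagliardoSq s B
            (fun x => max (v x τ - (k + k₀ * l + F τ)) 0 * η x)) ≤ ENNReal.ofReal X := by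
    intro t₂ ht₂ h2
    refine (hGe t₁ ht₁G t₂ ht₂ (by linarith [ht₁.2])).trans ?_
    rw [hX', ENNReal.ofReal_add (by positivity) (by positivity), ENNReal.ofReal_mul hP0.le,
      ENNReal.ofReal_mul hL.le]
    have hcr : ∫⁻ τ in Ioc t₁ t₂, crossTerm s B η (fun x => max (v x τ - (k + k₀ * l + F τ)) 0)
        ≤ ENNReal.ofReal (Z * P * y) := by
      have hs1 : Ioc t₁ t₂ ⊆ Ioc a b := Ioc_subset_Ioc (by linarith [ht₁.1]) (hGs ht₂).2.le
      have hs2 : Ioc t₁ t₂ ⊆ Ioc a' b := Ioc_subset_Ioc ht₁.1.le (hGs ht₂).2.le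
      calc _ ≤ ∫⁻ τ in Ioc t₁ t₂, ENNReal.ofReal (Z * P) * E τ :=
            lintegral_mono_ae (ae_restrict_of_ae_restrict_of_subset hs1 hcross)
        _ ≤ ∫⁻ τ in Ioc a' b, ENNReal.ofReal (Z * P) * E τ := lintegral_mono_set hs2
        _ = ENNReal.ofReal (Z * P) * ∫⁻ τ in Ioc a' b, E τ :=
            lintegral_const_mul' _ _ ENNReal.ofReal_ne_top
        _ ≤ _ := by
            rw [ENNReal.ofReal_mul (p := Z * P) (by positivity)]
            gcongr
            exact hY
    gcongr
    exact (hslice t₁).trans (by gcongr)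
  refine ⟨?_, ?_⟩
  · filter_upwards [ae_restrict_of_ae_restrict_of_subset
      (Ioc_subset_Ioc_left (by linarith : a ≤ a'')) hGae, ae_restrict_mem measurableSet_Ioc]
      with t ht ht'
    exact le_self_add.trans (hmain t ht ht'.1)
  · have hL' : ∀ A : ℝ≥0∞, ENNReal.ofReal L⁻¹ * A ≤ ENNReal.ofReal X → A ≤ ENNReal.ofReal (L * X) := by
      intro A hA
      have h1 : ENNReal.ofReal L * ENNReal.ofReal L⁻¹ = 1 := by
        rw [← ENNReal.ofReal_mul hL.le, mul_inv_cancel₀ hL.ne', ENNReal.ofReal_one]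
      calc A = ENNReal.ofReal L * (ENNReal.ofReal L⁻¹ * A) := by rw [← mul_assoc, h1, one_mul]
        _ ≤ ENNReal.ofReal L * ENNReal.ofReal X := by gcongr
        _ = _ := (ENNReal.ofReal_mul hL.le).symm
    refine setLIntegral_Ioc_le_of_forall fun t htb hat => ?_
    -- With `f = 0` this merely supplies a good time between `t` and `b`.
    obtain ⟨t₂, ht₂, ht₂G, -⟩ := exists_mem_le_of_setLIntegral_le (f := fun _ => 0) (y := 0)
      measurable_const htb (by simp)
      (ae_restrict_of_ae_restrict_of_subset (Ioc_subset_Ioc_left (by linarith : a ≤ t)) hGae)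
    refine (lintegral_mono_set ?_).trans (hL' _ (le_add_self.trans (hmain t₂ ht₂G
      (by linarith [ht₂.1]))))
    exact Ioc_subset_Ioc ht₁.2 ht₂.1.le

end

section

variable {N : ℕ} {s q L : ℝ} {x₀ : RN N} {ρ d a b : ℝ} {v : RN N → ℝ → ℝ}
  {κ : RN N → RN N → ℝ → ℝ}

/-- The excess gains integrability through the Sobolev-type inequality. -/
lemma excess_le_of_energy (hvm : Measurable fun z : RN N × ℝ => v z.1 z.2)
    (hv0 : ∀ x t, 0 ≤ v x t) (hq : 1 ≤ q) (hd : 0 < d) (hd1 : d ≤ 1)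
    {C Cs Λ : ℝ} (hCs0 : 0 < Cs) (hC0 : 0 < C) (hC : KernelMoment N s C) {p β : ℝ}
    (hCs : ∀ (f : RN N → ℝ) (a : ℝ), Measurable f → 0 < a →
      ∫⁻ x, ENNReal.ofReal (|f x| ^ (q + 1)) ≤ ENNReal.ofReal a →
      ∫⁻ x, ENNReal.ofReal (|f x| ^ p) ≤ ENNReal.ofReal (Cs * a ^ β) * gagliardoSq s univ f)
    (hp : q + 1 ≤ p)
    {η : RN N → ℝ} (hη : IsCutoff Λ η) {r r' : ℝ} (hrρ : r ≤ ρ)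
    (hηs : ∀ x, x ∉ Metric.ball x₀ r → η x = 0) (hη1 : ∀ x ∈ Metric.ball x₀ r', η x = 1)
    {F : ℝ → ℝ} (hFm : Measurable F) (hF0 : ∀ t, 0 ≤ F t)
    {k₀ l k : ℝ} (hk₀ : 1 ≤ k₀) (hF : ∀ t, F t ≤ k₀) (hl : 0 < l) (hl1 : l ≤ 1)
    (hk : 0 ≤ k) (hk2 : k + k₀ * l ≤ 2 * k₀)
    {a' a'' : ℝ} (haa : a' ≤ a'') {y X A : ℝ} (hX0 : 0 < X) (hA0 : 0 ≤ A)
    (hY : excess q x₀ v F b r a' k ≤ ENNReal.ofReal y)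
    (hyX : (4 / l) ^ (q + 1) * y ≤ A * X)
    (hslice : ∀ᵐ t ∂(volume.restrict (Ioc a'' b)), ∫⁻ x in Metric.ball x₀ (ρ + d), ENNReal.ofReal
        (truncEnergy q (k + k₀ * l + F t) (v x t) * η x ^ 2) ≤ ENNReal.ofReal X)
    (hgrad : ∫⁻ τ in Ioc a'' b, gagliardoSq s (Metric.ball x₀ (ρ + d))
        (fun x => max (v x τ - (k + k₀ * l + F τ)) 0 * η x) ≤ ENNReal.ofReal (L * X))
    (hL : 0 < L) :
    excess q x₀ v F b r' a'' (k + 2 * (k₀ * l))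
      ≤ ENNReal.ofReal ((1 / l) ^ (p - (q + 1)) * (Cs * (2 ^ (q + 1) * X) ^ β
        * (L * X + 2 * ((d ^ 2)⁻¹ * C) * (A * X)))) := by
  set B := Metric.ball x₀ (ρ + d) with hB
  have hηm := hη.cont.measurable
  set D := Metric.ball x₀ r with hD
  have hDm : MeasurableSet D := Metric.isOpen_ball.measurableSet
  have hDB : D ⊆ B := Metric.ball_subset_ball (by linarith)
  set w : RN N → ℝ → ℝ := fun x t => max (v x t - (k + k₀ * l + F t)) 0 with hw
  have hwm : Measurable fun z : RN N × ℝ => w z.1 z.2 := by fun_prop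
  have hw0 : ∀ x t, 0 ≤ w x t := fun x t => le_max_right _ _
  have hg0 : 0 < k₀ * l := by positivity
  have hη0 := hη.nonneg
  have hpow : ∀ᵐ t ∂(volume.restrict (Ioc a'' b)),
      ∫⁻ x, ENNReal.ofReal (|w x t * η x| ^ (q + 1)) ≤ ENNReal.ofReal (2 ^ (q + 1) * X) := by
    filter_upwards [hslice] with t ht
    rw [ENNReal.ofReal_mul (by positivity)]
    refine le_trans ?_ (mul_le_mul_right ht _)
    rw [← lintegral_const_mul' _ _ ENNReal.ofReal_ne_top,
      ← lintegral_indicator Metric.isOpen_ball.measurableSet]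
    refine lintegral_mono fun x => ?_
    by_cases hx : x ∈ B
    · rw [indicator_of_mem hx, ← ENNReal.ofReal_mul (by positivity)]
      refine ENNReal.ofReal_le_ofReal ?_
      have h1 := truncEnergy_lower (q := q) (ℓ := k + k₀ * l + F t) (v := v x t) hq
        (by linarith [hF0 t]) (hv0 x t)
      have h2 : η x ^ (q + 1) ≤ η x ^ 2 := by
        rcases (hη0 x).eq_or_lt with h | h
        · rw [← h, Real.zero_rpow (by linarith)]; simp
        · have := Real.rpow_le_rpow_of_exponent_ge h (hη.le_one x) (show 2 ≤ q + 1 by linarith)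
          rwa [Real.rpow_two] at this
      rw [abs_of_nonneg (mul_nonneg (hw0 x t) (hη0 x)), Real.mul_rpow (hw0 x t) (hη0 x),
        ← mul_assoc]
      rw [Real.div_rpow (hw0 x t) (by norm_num), div_le_iff₀ (by positivity)] at h1
      rw [mul_comm ((2 : ℝ) ^ (q + 1))]
      exact mul_le_mul h1 h2 (Real.rpow_nonneg (hη0 x) _) ((Real.rpow_nonneg (hw0 x t) _).trans h1)
    · rw [hηs x fun h => hx (hDB h), mul_zero, abs_zero, Real.zero_rpow (by linarith)]
      simp
  have hsq : ∀ t, ∫⁻ x, ENNReal.ofReal ((w x t * η x) ^ 2) ≤ ENNReal.ofReal ((4 / l) ^ (q + 1))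
      * ∫⁻ x in D, ENNReal.ofReal ((max (v x t - (k + F t)) 0) ^ (q + 1)) := by
    intro t
    rw [← lintegral_const_mul' _ _ ENNReal.ofReal_ne_top, ← lintegral_indicator hDm]
    refine lintegral_mono fun x => ?_
    by_cases hx : x ∈ D
    · rw [indicator_of_mem hx, ← ENNReal.ofReal_mul (by positivity)]
      refine ENNReal.ofReal_le_ofReal ?_
      have h := (truncation_gap (q := q) (l := l) (m := k + F t) (g := k₀ * l)
        (k₀ := k₀) (α := v x t) hq hl hl1 hk₀ rfl (by linarith [hF0 t]) (by linarith [hF t])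
        (hv0 x t)).1
      rw [show k + F t + k₀ * l = k + k₀ * l + F t by ring] at h
      refine le_trans ?_ h
      rw [mul_pow]
      exact mul_le_of_le_one_right (sq_nonneg _) (pow_le_one₀ (hη0 x) (hη.le_one x))
    · rw [hηs x hx]; simp
  have hsqm : Measurable fun t => ∫⁻ x, ENNReal.ofReal ((w x t * η x) ^ 2) :=
    Measurable.lintegral_prod_left' (f := fun z : RN N × ℝ =>
      ENNReal.ofReal ((w z.1 z.2 * η z.1) ^ 2)) (by fun_prop)
  have hsqI : ∫⁻ t in Ioc a'' b, ∫⁻ x, ENNReal.ofReal ((w x t * η x) ^ 2)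
      ≤ ENNReal.ofReal (A * X) := by
    calc _ ≤ ∫⁻ t in Ioc a'' b, ENNReal.ofReal ((4 / l) ^ (q + 1))
          * ∫⁻ x in D, ENNReal.ofReal ((max (v x t - (k + F t)) 0) ^ (q + 1)) :=
          lintegral_mono hsq
      _ ≤ ENNReal.ofReal ((4 / l) ^ (q + 1)) * excess q x₀ v F b r a' k := by
          rw [lintegral_const_mul' _ _ ENNReal.ofReal_ne_top]
          gcongr
          exact lintegral_mono_set (Ioc_subset_Ioc_left haa)
      _ ≤ ENNReal.ofReal ((4 / l) ^ (q + 1)) * ENNReal.ofReal y := by gcongr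
      _ ≤ _ := by
          rw [← ENNReal.ofReal_mul (by positivity)]
          exact ENNReal.ofReal_le_ofReal hyX
  set S : ℝ := Cs * (2 ^ (q + 1) * X) ^ β with hS
  have hS0 : 0 ≤ S := by positivity
  set D₀ : ℝ := 2 * ((d ^ 2)⁻¹ * C) with hD₀
  have hD₀0 : 0 ≤ D₀ := by positivity
  have hSob : ∀ᵐ t ∂(volume.restrict (Ioc a'' b)),
      ∫⁻ x, ENNReal.ofReal (|w x t * η x| ^ p) ≤ ENNReal.ofReal S
        * (gagliardoSq s B (fun x => w x t * η x)
          + ENNReal.ofReal D₀ * ∫⁻ x, ENNReal.ofReal ((w x t * η x) ^ 2)) := by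
    filter_upwards [hpow] with t ht
    refine (hCs (fun x => w x t * η x) _ (by fun_prop) (by positivity) ht).trans ?_
    gcongr
    exact gagliardoSq_univ_le hC hd hd1 x₀ (by fun_prop) fun x hx => by
      rw [hηs x fun h => hx (Metric.ball_subset_ball hrρ h), mul_zero]
  have hgm : Measurable fun t => gagliardoSq s B (fun x => w x t * η x) :=
    measurable_gagliardoSq (v := fun x t => w x t * η x) B (by fun_prop)
  have hpI : ∫⁻ t in Ioc a'' b, ∫⁻ x, ENNReal.ofReal (|w x t * η x| ^ p)
      ≤ ENNReal.ofReal (S * (L * X + D₀ * (A * X))) := by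
    refine (lintegral_mono_ae hSob).trans ?_
    rw [lintegral_const_mul' _ _ ENNReal.ofReal_ne_top, lintegral_add_left hgm,
      lintegral_const_mul' _ _ ENNReal.ofReal_ne_top, ENNReal.ofReal_mul hS0,
      ENNReal.ofReal_add (by positivity) (by positivity), ENNReal.ofReal_mul hD₀0]
    gcongr
  -- Above the level `k + 2 k₀ l`, the truncation at `k + k₀ l` is at least `k₀ l ≥ l`. The surplus
  -- power `p - (q + 1) ≥ 0` therefore costs only a power of `1/l`.
  have hpt : ∀ t, ∀ x ∈ Metric.ball x₀ r',
      (max (v x t - (k + 2 * (k₀ * l) + F t)) 0) ^ (q + 1)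
        ≤ (1 / l) ^ (p - (q + 1)) * |w x t * η x| ^ p := by
    intro t x hx
    rw [hη1 x hx, mul_one, abs_of_nonneg (hw0 x t)]
    rcases le_total (v x t) (k + 2 * (k₀ * l) + F t) with h | h
    · rw [max_eq_right (by linarith), Real.zero_rpow (by linarith)]
      have := hw0 x t
      positivity
    · have e : w x t = v x t - (k + k₀ * l + F t) := max_eq_left (by linarith)
      have h1 : l ≤ w x t := by rw [e]; nlinarith
      have hwp : 0 < w x t := hl.trans_le h1
      rw [max_eq_left (by linarith)]
      calc (v x t - (k + 2 * (k₀ * l) + F t)) ^ (q + 1) ≤ w x t ^ (q + 1) :=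
            Real.rpow_le_rpow (by linarith) (by rw [e]; linarith) (by linarith)
        _ ≤ (1 / l * w x t) ^ (p - (q + 1)) * w x t ^ (q + 1) := by
            refine le_mul_of_one_le_left (by positivity) (Real.one_le_rpow ?_ (by linarith))
            rw [one_div, inv_mul_eq_div, one_le_div hl]; exact h1
        _ = (1 / l) ^ (p - (q + 1)) * w x t ^ p := by
            rw [Real.mul_rpow (by positivity) hwp.le, mul_assoc, ← Real.rpow_add hwp]
            ring_nf
  have hlp : 0 ≤ (1 / l) ^ (p - (q + 1)) := by positivity
  rw [ENNReal.ofReal_mul hlp]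
  refine le_trans ?_ (mul_le_mul_right hpI _)
  rw [← lintegral_const_mul' _ _ ENNReal.ofReal_ne_top]
  refine lintegral_mono fun t => ?_
  dsimp only
  rw [← lintegral_const_mul' _ _ ENNReal.ofReal_ne_top,
    ← lintegral_indicator Metric.isOpen_ball.measurableSet]
  refine lintegral_mono fun x => ?_
  by_cases hx : x ∈ Metric.ball x₀ r'
  · rw [indicator_of_mem hx, ← ENNReal.ofReal_mul hlp]
    exact ENNReal.ofReal_le_ofReal (hpt t x hx)
  · rw [indicator_of_notMem hx]; exact zero_le

end

section

variable {N : ℕ} {s q L : ℝ} {x₀ : RN N} {ρ d a b : ℝ} {v : RN N → ℝ → ℝ}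
  {κ : RN N → RN N → ℝ → ℝ}

set_option maxHeartbeats 1000000 in
/-- One step of the De Giorgi iteration. -/
lemma CylinderSub.excess_step (hS : CylinderSub s q L x₀ ρ d a b v κ) (hN : 1 ≤ N) (hab : a < b)
    (hq : 1 ≤ q) (hs0 : 0 < s) (hs1 : s < 1) (hqp : q + 1 ≤ 2 + 2 * s * (q + 1) / N)
    (hL : 0 < L) (hρ : 0 < ρ) (hρ1 : ρ ≤ 1) (hd : 0 < d) (hd1 : d ≤ 1) {c : ℝ} (hc : 0 < c)
    (hfar : ∀ x ∈ Metric.ball x₀ ρ, ∀ y ∉ Metric.ball x₀ (ρ + d),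
      L * wt s x y ≤ c * tailWeight s y) :
    ∃ A : ℝ, 0 < A ∧ ∃ m : ℝ, 0 < m ∧ ∀ k₀ l k r a' y : ℝ, 1 ≤ k₀ →
      (∀ t, tailLevel s c a b v t ≤ k₀) → 0 < l → l ≤ 1 → k₀ ≤ k → k + 2 * (k₀ * l) ≤ 2 * k₀ →
      r ≤ ρ → a ≤ a' → a' + (b - a) * l < b → 0 < y →
      excess q x₀ v (tailLevel s c a b v) b r a' k ≤ ENNReal.ofReal y →
      excess q x₀ v (tailLevel s c a b v) b (r - ρ * l) (a' + (b - a) * l) (k + 2 * (k₀ * l))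
        ≤ ENNReal.ofReal (A * (1 / l) ^ m * y ^ (1 + 2 * s / N)) := by
  obtain ⟨C, hC0, hC⟩ := exists_kernel_moment hN hs0 hs1
  obtain ⟨Cs, hCs0, hCs⟩ := lintegral_rpow_le_gagliardoSq hN hs0 (show 0 < q + 1 by linarith)
  obtain ⟨M, hM0, hM⟩ := hS.l1_bdd hq
  set F := tailLevel s c a b v with hFdef
  have hFm : Measurable F := (hS.tailLevel_mono hc).measurable
  have hF0 : ∀ t, 0 ≤ F t := fun t => tailLevel_nonneg hc t
  set p : ℝ := 2 + 2 * s * (q + 1) / N with hp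
  set β : ℝ := 2 * s / N with hβ
  set T : ℝ := b - a with hT
  have hT0 : 0 < T := by linarith
  have hN' : (1 : ℝ) ≤ N := by exact_mod_cast hN
  have hβ0 : 0 < β := by positivity
  set n : ℝ := (N : ℝ) + 2 * s with hn
  set Z : ℝ := 2 * ((2 / ρ) ^ 2 * C) + 2 * ((ρ / 2) ^ n)⁻¹ * M with hZ
  have hZ0 : 0 < Z := by positivity
  set K : ℝ := 4 ^ (q + 1) * (1 / T + L * Z) with hK
  have hK0 : 0 < K := by positivity
  -- Here `q + 1` comes from `(4/l)^(q+1)`. The power `N + 2` dominates the three further blow-ups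
  -- in `1/l`: exponent `1` from the length of the time step, `2` from the cut-off, and `N + 2s`
  -- from the far part of the cross term.
  set e : ℝ := (q + 1) + (N + 2) with he
  have he0 : 0 < e := by linarith
  set D₀ : ℝ := 2 * ((d ^ 2)⁻¹ * C) with hD₀
  have hD₀0 : 0 ≤ D₀ := by positivity
  -- In the exponent `m`, `p - (q + 1)` is the price of passing from `L^(q+1)` to `L^p`, and `e (1 +
  -- β)` appears because the energy bound `X'` enters with power `1 + β`.
  refine ⟨Cs * (2 ^ (q + 1) * K) ^ β * ((L + D₀ * T) * K), by positivity,
    (p - (q + 1)) + e * (1 + β), by nlinarith, ?_⟩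
  intro k₀ l k r a' y hk₀ hF hl hl1 hk hk2 hr ha hab' hy hY
  set u : ℝ := 1 / l with hu
  have hu1 : 1 ≤ u := by rw [hu, one_le_div hl]; exact hl1
  have hu0 : 0 < u := by linarith
  have hlu : l = u⁻¹ := by rw [hu]; simp
  have hρl : 0 < ρ * l := by positivity
  -- Half of the radius loss `ρ l` is spent on the transition of `η`. The other half separates its
  -- support from the boundary of the ball of radius `r`, as the localized cross term requires.
  obtain ⟨η, hη1, hη2, hη3, hη4, hη5, hη6⟩ := exists_cutoff x₀
    (show r - ρ * l < r - ρ * l / 2 by linarith)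
  have hη : IsCutoff (2 / ρ * u) η := by
    refine ⟨?_, hη1, hη2, hη3, fun x y => (hη6 x y).trans (le_of_eq ?_)⟩
    · have : 1 ≤ 2 / ρ := by rw [one_le_div hρ]; linarith
      nlinarith
    · rw [hu]
      have : r - ρ * l / 2 - (r - ρ * l) = ρ * l / 2 := by ring
      rw [this]; field_simp
  set X : ℝ := (4 / l) ^ (q + 1) * y * (1 / (a' + T * l - a')
      + L * (2 * ((2 / ρ * u) ^ 2 * C) + 2 * ((ρ * l / 2) ^ n)⁻¹ * M)) with hX
  set X' : ℝ := K * u ^ e * y with hX'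
  have hX'0 : 0 < X' := by positivity
  have h4 : (4 / l) ^ (q + 1) = 4 ^ (q + 1) * u ^ (q + 1) := by
    rw [← Real.mul_rpow (by norm_num) hu0.le, hu]; ring_nf
  have hun : ∀ t ≤ (N : ℝ) + 2, u ^ t ≤ u ^ ((N : ℝ) + 2) := fun t ht =>
    Real.rpow_le_rpow_of_exponent_le hu1 ht
  have hun1 : u ≤ u ^ ((N : ℝ) + 2) := by
    have := hun 1 (by linarith)
    rwa [Real.rpow_one] at this
  have hun2 : u ^ 2 ≤ u ^ ((N : ℝ) + 2) := by
    have := hun 2 (by linarith)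
    rwa [Real.rpow_two] at this
  have hun3 : u ^ n ≤ u ^ ((N : ℝ) + 2) := hun _ (by linarith)
  have hue : u ^ e = u ^ (q + 1) * u ^ ((N : ℝ) + 2) := Real.rpow_add hu0 _ _
  have hXX : X ≤ X' := by
    have e1 : 1 / (a' + T * l - a') = 1 / T * u := by
      rw [add_sub_cancel_left, hu]; field_simp
    have e2 : ((ρ * l / 2) ^ n)⁻¹ = ((ρ / 2) ^ n)⁻¹ * u ^ n := by
      rw [show ρ * l / 2 = ρ / 2 * l by ring, Real.mul_rpow (by positivity) hl.le, mul_inv, hlu,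
        Real.inv_rpow hu0.le, inv_inv]
    rw [hX, hX', hK, hue, h4, e1, e2, mul_pow]
    have h5 : 1 / T * u + L * (2 * ((2 / ρ) ^ 2 * u ^ 2 * C) + 2 * (((ρ / 2) ^ n)⁻¹ * u ^ n) * M)
        ≤ (1 / T + L * Z) * u ^ ((N : ℝ) + 2) := by
      have e3 : (1 / T + L * Z) * u ^ ((N : ℝ) + 2) = 1 / T * u ^ ((N : ℝ) + 2)
        + L * (2 * ((2 / ρ) ^ 2 * u ^ ((N : ℝ) + 2) * C)
          + 2 * (((ρ / 2) ^ n)⁻¹ * u ^ ((N : ℝ) + 2)) * M) := by rw [hZ]; ring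
      rw [e3]
      gcongr
    calc _ ≤ 4 ^ (q + 1) * u ^ (q + 1) * y * ((1 / T + L * Z) * u ^ ((N : ℝ) + 2)) := by gcongr
      _ = _ := by ring
  have hyX : (4 / l) ^ (q + 1) * y ≤ T * X' := by
    rw [h4, hX', hK, hue]
    have h6 : 1 ≤ T * (1 / T + L * Z) := by
      have e5 : T * (1 / T + L * Z) = 1 + T * (L * Z) := by field_simp
      rw [e5]
      have : 0 ≤ T * (L * Z) := by positivity
      linarith
    have h7 : 1 ≤ u ^ ((N : ℝ) + 2) := hu1.trans hun1
    have h8 : 1 ≤ T * (1 / T + L * Z) * u ^ ((N : ℝ) + 2) := one_le_mul_of_one_le_of_one_le h6 h7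
    have h9 : 0 ≤ 4 ^ (q + 1) * u ^ (q + 1) * y := by positivity
    calc _ ≤ 4 ^ (q + 1) * u ^ (q + 1) * y * (T * (1 / T + L * Z) * u ^ ((N : ℝ) + 2)) :=
          le_mul_of_one_le_right h9 h8
      _ = _ := by ring
  have hkl0 : 0 < k₀ * l := by positivity
  obtain ⟨hsl, hgr⟩ := hS.energy_le_excess hab hq hs0 hL hd hd1 hc hfar hC0 hC hη hr
    (δ := ρ * l / 2) (by positivity) hη5 hM0 hM hk₀ hF hl hl1 (k := k) (by linarith)
    (by linarith) (by linarith) ha (a'' := a' + T * l) (by nlinarith) hab' hy hY hX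
  refine (excess_le_of_energy (r := r) hS.meas hS.nonneg hq hd hd1 hCs0 hC0 hC hCs hqp hη hr
    (fun x hx => hη5 x fun h => hx (Metric.ball_subset_ball (by linarith) h)) hη4 hFm hF0 hk₀ hF
    hl hl1 (k := k) (by linarith) (by linarith) (a' := a') (by nlinarith) (A := T) hX'0 hT0.le hY
    hyX
    (by filter_upwards [hsl] with t ht using ht.trans (ENNReal.ofReal_le_ofReal hXX))
    (hgr.trans (ENNReal.ofReal_le_ofReal (by gcongr))) hL).trans (le_of_eq ?_)
  congr 1
  rw [hX', ← mul_assoc (2 ^ (q + 1)), ← mul_assoc (2 ^ (q + 1)), Real.mul_rpow (by positivity) hy.le,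
    Real.mul_rpow (by positivity) (by positivity), ← Real.rpow_mul hu0.le,
    Real.rpow_add hu0 (p - (q + 1)), mul_add e, mul_one, Real.rpow_add hu0 e,
    Real.rpow_add hy, Real.rpow_one]
  ring

end

section

variable {N : ℕ} {s q L : ℝ} {x₀ : RN N} {ρ d a b : ℝ} {v : RN N → ℝ → ℝ}
  {κ : RN N → RN N → ℝ → ℝ}

/-- Dominated convergence, first in space and then in time, using the essential bound in time on the
`L^(q+1)` norm over the ball. -/
lemma CylinderSub.tendsto_excess (hS : CylinderSub s q L x₀ ρ d a b v κ) (hq : 0 < q)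
    (hd : 0 < d) {F : ℝ → ℝ} (hFm : Measurable F) (hF0 : ∀ t, 0 ≤ F t) :
    Tendsto (fun n : ℕ => excess q x₀ v F b ρ a n) atTop (𝓝 0) := by
  obtain ⟨M, hM⟩ := hS.bdd
  have hvm := hS.meas
  have hle : ∀ (n : ℕ) x t, (max (v x t - (n + F t)) 0) ^ (q + 1) ≤ v x t ^ (q + 1) := by
    intro n x t
    have hn : (0 : ℝ) ≤ n := n.cast_nonneg
    exact Real.rpow_le_rpow (le_max_right _ _)
      (max_le (by linarith [hF0 t]) (hS.nonneg x t)) (by linarith)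
  have hM' : ∀ᵐ t ∂(volume.restrict (Ioc a b)),
      ∫⁻ x in Metric.ball x₀ ρ, ENNReal.ofReal (v x t ^ (q + 1)) ≤ ENNReal.ofReal M := by
    filter_upwards [hM] with t ht
    exact (lintegral_mono_set (Metric.ball_subset_ball (by linarith))).trans ht
  have hinner : ∀ᵐ t ∂(volume.restrict (Ioc a b)), Tendsto (fun n : ℕ =>
      ∫⁻ x in Metric.ball x₀ ρ, ENNReal.ofReal ((max (v x t - (n + F t)) 0) ^ (q + 1)))
      atTop (𝓝 0) := by
    filter_upwards [hM'] with t ht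
    have h := tendsto_lintegral_of_dominated_convergence
      (μ := volume.restrict (Metric.ball x₀ ρ)) (f := fun _ => 0)
      (F := fun (n : ℕ) x => ENNReal.ofReal ((max (v x t - (n + F t)) 0) ^ (q + 1)))
      (fun x => ENNReal.ofReal (v x t ^ (q + 1))) (fun n => by fun_prop)
      (fun n => ae_of_all _ fun x => ENNReal.ofReal_le_ofReal (hle n x t))
      (ht.trans_lt ENNReal.ofReal_lt_top).ne
      (ae_of_all _ fun x => by
        obtain ⟨n₀, hn₀⟩ := exists_nat_ge (v x t)
        refine tendsto_const_nhds.congr' ?_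
        filter_upwards [eventually_ge_atTop n₀] with n hn
        have : (n₀ : ℝ) ≤ n := by exact_mod_cast hn
        rw [max_eq_right (by linarith [hF0 t]), Real.zero_rpow (by linarith), ENNReal.ofReal_zero])
    simpa using h
  have h := tendsto_lintegral_of_dominated_convergence
    (μ := volume.restrict (Ioc a b)) (f := fun _ => 0)
    (F := fun (n : ℕ) t => ∫⁻ x in Metric.ball x₀ ρ,
      ENNReal.ofReal ((max (v x t - (n + F t)) 0) ^ (q + 1)))
    (fun _ => ENNReal.ofReal M)
    (fun n => Measurable.lintegral_prod_left' (f := fun z : RN N × ℝ =>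
      ENNReal.ofReal ((max (v z.1 z.2 - (n + F z.2)) 0) ^ (q + 1))) (by fun_prop))
    (fun n => by
      filter_upwards [hM'] with t ht
      exact (lintegral_mono fun x => ENNReal.ofReal_le_ofReal (hle n x t)).trans ht)
    (by simp [ENNReal.mul_ne_top]) hinner
  simpa [excess] using h

lemma excess_anti {F : ℝ → ℝ} {r r' a' a'' k k' : ℝ} (hq : 0 ≤ q) (hr : r' ≤ r) (ha : a' ≤ a'')
    (hk : k ≤ k') : excess q x₀ v F b r' a'' k' ≤ excess q x₀ v F b r a' k := by
  refine (lintegral_mono_set (Ioc_subset_Ioc_left ha)).trans (lintegral_mono fun t => ?_)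
  refine (lintegral_mono_set (Metric.ball_subset_ball hr)).trans (lintegral_mono fun x => ?_)
  refine ENNReal.ofReal_le_ofReal (Real.rpow_le_rpow (le_max_right _ _) ?_ (by linarith))
  exact max_le_max (by linarith) le_rfl

/-- Sub-solutions on a cylinder are bounded on a smaller cylinder. -/
theorem CylinderSub.bounded (hS : CylinderSub s q L x₀ ρ d a b v κ) (hN : 1 ≤ N) (hab : a < b)
    (hq : 1 ≤ q) (hs0 : 0 < s) (hs1 : s < 1) (hqp : q + 1 ≤ 2 + 2 * s * (q + 1) / N)
    (hL : 0 < L) (hρ : 0 < ρ) (hρ1 : ρ ≤ 1) (hd : 0 < d) (hd1 : d ≤ 1) {c : ℝ} (hc : 0 < c)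
    (hfar : ∀ x ∈ Metric.ball x₀ ρ, ∀ y ∉ Metric.ball x₀ (ρ + d),
      L * wt s x y ≤ c * tailWeight s y) :
    ∃ M : ℝ, ∀ᵐ z ∂(volume.restrict (Metric.ball x₀ (ρ / 2) ×ˢ Ioc ((a + b) / 2) b)),
      v z.1 z.2 ≤ M := by
  obtain ⟨A, hA, m, hm, hstep⟩ := hS.excess_step hN hab hq hs0 hs1 hqp hL hρ hρ1 hd hd1 hc hfar
  set F := tailLevel s c a b v with hF
  have hFm : Measurable F := (hS.tailLevel_mono hc).measurable
  have hF0 : ∀ t, 0 ≤ F t := fun t => tailLevel_nonneg hc t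
  have hN' : (1 : ℝ) ≤ N := by exact_mod_cast hN
  obtain ⟨δ, hδ, hconv⟩ := tendsto_zero_of_superlinear (C := A * 4 ^ m) (b := 2 ^ m)
    (β := 2 * s / N) (by positivity) (Real.one_lt_rpow (by norm_num) hm) (by positivity)
  -- A single large integer serves as base level: it is at least one, it bounds the accumulated
  -- tail, and it makes the initial excess smaller than `δ`. There is no circularity, since `δ`
  -- depends on `A` and `m` but not on the level.
  obtain ⟨n, hn1, hnT, hnδ⟩ := ((eventually_ge_atTop 1).and ((tendsto_natCast_atTop_atTop (R := ℝ)
    |>.eventually_ge_atTop (∫ τ, (Ioc a b).indicator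
      (fun τ => 2 * c * (tailAt s v τ).toReal) τ)).and
    ((hS.tendsto_excess (by linarith) hd hFm hF0).eventually_le_const
      (ENNReal.ofReal_pos.2 hδ)))).exists
  set k₀ : ℝ := (n : ℝ) with hk₀
  have hk1 : 1 ≤ k₀ := Nat.one_le_cast.2 hn1
  have hFk : ∀ t, F t ≤ k₀ := fun t => (hS.tailLevel_le hc t).trans hnT
  set l : ℕ → ℝ := fun j => (1 / 2) ^ j with hl
  have hl0 : ∀ j, 0 < l j := fun j => by positivity
  have hl1 : ∀ j, l j ≤ 1 := fun j => pow_le_one₀ (by norm_num) (by norm_num)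
  have hls : ∀ j, l (j + 1) = l j / 2 := fun j => by simp only [hl, pow_succ]; ring
  set Y : ℕ → ℝ≥0∞ := fun j => excess q x₀ v F b (ρ / 2 + ρ / 2 * l j)
    (a + (b - a) / 2 * (1 - l j)) (k₀ * (2 - l j)) with hY
  have hY0 : Y 0 ≤ ENNReal.ofReal δ := by
    have e : Y 0 = excess q x₀ v F b ρ a k₀ := by
      simp only [hY, hl, pow_zero]; ring_nf
    rw [e]; exact hnδ
  -- The step parameter is `l j / 4` because radius, time and level move by `ρ l j / 4`, `(b - a) l
  -- j / 4` and `k₀ l j / 2`, exactly the increments of the three sequences. Its inverse is `4 ·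
  -- 2^j`, whence the constants `A * 4 ^ m` and `2 ^ m` above.
  have hlim := hconv Y hY0 fun j y hy hYj => by
    have h := hstep k₀ (l j / 4) (k₀ * (2 - l j)) (ρ / 2 + ρ / 2 * l j)
      (a + (b - a) / 2 * (1 - l j)) y hk1 hFk (by linarith [hl0 j]) (by linarith [hl1 j])
      (by nlinarith [hl1 j]) (by nlinarith [hl0 j]) (by nlinarith [hl1 j]) (by nlinarith [hl1 j])
      (by nlinarith [hl0 j]) hy hYj
    have e1 : Y (j + 1) = excess q x₀ v F b (ρ / 2 + ρ / 2 * l j - ρ * (l j / 4))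
        (a + (b - a) / 2 * (1 - l j) + (b - a) * (l j / 4))
        (k₀ * (2 - l j) + 2 * (k₀ * (l j / 4))) := by
      simp only [hY, hls]; ring_nf
    have e2 : (1 / (l j / 4)) ^ m = 4 ^ m * (2 ^ m) ^ j := by
      have e3 : 1 / (l j / 4) = 4 * 2 ^ j := by
        simp only [hl, one_div, inv_pow, inv_div]; field_simp
      rw [e3, Real.mul_rpow (by norm_num) (by positivity), ← Real.rpow_natCast,
        ← Real.rpow_natCast, ← Real.rpow_mul (by norm_num), ← Real.rpow_mul (by norm_num),
        mul_comm m]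
    rw [e1]
    refine h.trans (le_of_eq ?_)
    rw [e2]; ring_nf
  -- The limiting cylinder is contained in all the others and the limiting level lies above all the
  -- others, so its excess is below every term of a null sequence.
  have hzero : excess q x₀ v F b (ρ / 2) ((a + b) / 2) (2 * k₀) = 0 := by
    refine le_antisymm (ge_of_tendsto' hlim fun j => ?_) zero_le
    exact excess_anti (by linarith) (by nlinarith [hl0 j]) (by nlinarith [hl0 j])
      (by nlinarith [hl0 j])
  have hvm := hS.meas
  have hgm : Measurable fun z : RN N × ℝ =>
      ENNReal.ofReal ((max (v z.1 z.2 - (2 * k₀ + F z.2)) 0) ^ (q + 1)) := by fun_prop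
  rw [excess, ← lintegral_prod_symm' (μ := volume.restrict (Metric.ball x₀ (ρ / 2)))
    (f := fun z : RN N × ℝ =>
      ENNReal.ofReal ((max (v z.1 z.2 - (2 * k₀ + F z.2)) 0) ^ (q + 1))) hgm,
    lintegral_eq_zero_iff hgm, Measure.prod_restrict, ← Measure.volume_eq_prod] at hzero
  refine ⟨3 * k₀, ?_⟩
  filter_upwards [hzero] with z hz
  by_contra hlt
  have h1 : 0 < v z.1 z.2 - (2 * k₀ + F z.2) := by linarith [hFk z.2]
  rw [Pi.zero_apply, max_eq_left h1.le, ENNReal.ofReal_eq_zero] at hz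
  exact absurd hz (not_le.2 (Real.rpow_pos_of_pos h1 _))

end

/-! ### From weak sub-solutions to cylinders -/

lemma ae_ae_swap_of_ae_restrict {α : Type*} [MeasureSpace α] [SFinite (volume : Measure α)]
    {I : Set ℝ} {p : α → ℝ → Prop}
    (h : ∀ᵐ z : α × ℝ ∂(volume.restrict (univ ×ˢ I)), p z.1 z.2) :
    ∀ᵐ t ∂(volume.restrict I), ∀ᵐ x : α, p x t := by
  rw [Measure.volume_eq_prod, ← Measure.prod_restrict, Measure.restrict_univ] at h
  have h1 : ∀ᵐ z : ℝ × α ∂((volume.restrict I).prod volume), p z.2 z.1 :=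
    Measure.measurePreserving_swap.quasiMeasurePreserving.ae h
  exact Measure.ae_ae_of_ae_prod h1

/-! ### Uniformity in time on compact intervals -/

section ContinuousInLp

variable {N : ℕ} {p : ℝ} [Fact (1 ≤ ENNReal.ofReal p)] {U : Set (RN N)} {I J : Set ℝ} {u : RN N → ℝ → ℝ}

/-- A function that is continuous in time with values in `L^p`, as a curve in `Lp`. -/
lemma ContinuousInLp.exists_curve (hu : ContinuousInLp p U I u) :
    ∃ Φ : ℝ → Lp ℝ (ENNReal.ofReal p) (volume.restrict U), ContinuousOn Φ I ∧
      (∀ t ∈ I, eLpNorm (fun x => u x t) (ENNReal.ofReal p) (volume.restrict U)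
        = ENNReal.ofReal ‖Φ t‖) ∧
      ∀ t ∈ I, ∀ t' ∈ I,
        eLpNorm (fun x => u x t - u x t') (ENNReal.ofReal p) (volume.restrict U)
          = edist (Φ t) (Φ t') := by
  classical
  have he : ∀ t (ht : t ∈ I) t' (ht' : t' ∈ I),
      eLpNorm (fun x => u x t - u x t') (ENNReal.ofReal p) (volume.restrict U)
        = edist ((hu.1 t ht).toLp _) ((hu.1 t' ht').toLp _) := fun t ht t' ht' =>
    (Lp.edist_toLp_toLp _ _ (hu.1 t ht) (hu.1 t' ht')).symm
  refine ⟨fun t => if ht : t ∈ I then (hu.1 t ht).toLp _ else 0, ?_, fun t ht => ?_,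
    fun t ht t' ht' => ?_⟩
  · intro t₀ ht₀
    rw [ContinuousWithinAt, tendsto_iff_edist_tendsto_0]
    refine (hu.2 t₀ ht₀).congr' ?_
    filter_upwards [self_mem_nhdsWithin] with t ht
    rw [dif_pos ht, dif_pos ht₀, he t ht t₀ ht₀]
  · simp only [dif_pos ht]
    rw [Lp.norm_toLp, ENNReal.ofReal_toReal (hu.1 t ht).2.ne]
  · simp only [dif_pos ht, dif_pos ht']
    exact he t ht t' ht'

lemma ContinuousInLp.exists_bound (hu : ContinuousInLp p U I u) (hJ : IsCompact J)
    (hJI : J ⊆ I) : ∃ M : ℝ, 0 ≤ M ∧ ∀ t ∈ J,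
      eLpNorm (fun x => u x t) (ENNReal.ofReal p) (volume.restrict U) ≤ ENNReal.ofReal M := by
  obtain ⟨Φ, hΦ, hn, -⟩ := hu.exists_curve
  obtain ⟨M, hM⟩ := hJ.exists_bound_of_continuousOn (hΦ.mono hJI)
  refine ⟨|M|, abs_nonneg M, fun t ht => ?_⟩
  rw [hn t (hJI ht)]
  exact ENNReal.ofReal_le_ofReal ((hM t ht).trans (le_abs_self M))

lemma ContinuousInLp.uniform (hu : ContinuousInLp p U I u) (hJ : IsCompact J)
    (hJI : J ⊆ I) {ε : ℝ} (hε : 0 < ε) : ∃ δ > 0, ∀ t ∈ J, ∀ t' ∈ J, |t - t'| < δ →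
      eLpNorm (fun x => u x t - u x t') (ENNReal.ofReal p) (volume.restrict U)
        ≤ ENNReal.ofReal ε := by
  obtain ⟨Φ, hΦ, -, hd⟩ := hu.exists_curve
  obtain ⟨δ, hδ, h⟩ := Metric.uniformContinuousOn_iff.1
    (hJ.uniformContinuousOn_of_continuous (hΦ.mono hJI)) ε hε
  refine ⟨δ, hδ, fun t ht t' ht' htt => ?_⟩
  rw [hd t (hJI ht) t' (hJI ht'), edist_dist]
  exact ENNReal.ofReal_le_ofReal (h t ht t' ht' htt).le

end ContinuousInLp

lemma lintegral_rpow_eq_eLpNorm {α : Type*} [MeasurableSpace α] {μ : Measure α} {f : α → ℝ}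
    (h0 : ∀ᵐ x ∂μ, 0 ≤ f x) {p : ℝ} (hp : 0 < p) :
    ∫⁻ x, ENNReal.ofReal (f x ^ p) ∂μ = eLpNorm f (ENNReal.ofReal p) μ ^ p := by
  have h := eLpNorm_nnreal_pow_eq_lintegral (f := f) (μ := μ) (p := p.toNNReal)
    (by simpa using hp)
  rw [Real.coe_toNNReal p hp.le] at h
  rw [ENNReal.ofReal, h]
  refine lintegral_congr_ae ?_
  filter_upwards [h0] with x hx
  rw [← ENNReal.ofReal_rpow_of_nonneg hx hp.le, ← ofReal_norm, Real.norm_of_nonneg hx]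

lemma gagliardoSq_congr {N : ℕ} {s : ℝ} {U : Set (RN N)} {f g : RN N → ℝ}
    (h : ∀ᵐ x, f x = g x) : gagliardoSq s U f = gagliardoSq s U g := by
  unfold gagliardoSq
  refine lintegral_congr_ae ?_
  filter_upwards [ae_restrict_of_ae h] with x hx
  refine lintegral_congr_ae ?_
  filter_upwards [ae_restrict_of_ae h] with y hy
  rw [hx, hy]

/-- A function of space alone is admissible with zero time derivative, so the term containing the
derivative of the test function drops out. -/
lemma isTestFunction_const {N : ℕ} {s q T : ℝ} {U : Set (RN N)}
    {ψ : RN N → ℝ} (hψm : Measurable ψ) (hψ0 : ∀ x, 0 ≤ ψ x) (hψU : ∀ x, x ∉ U → ψ x = 0)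
    (hψq : MemLp ψ (ENNReal.ofReal (q + 1))) (hψ2 : MemLp ψ 2)
    (hψs : gagliardoSq s univ ψ < ⊤) :
    IsTestFunction s q T U (fun x _ => ψ x) (fun _ _ => 0) where
  nonneg x _ _ := hψ0 x
  memL2 a b _ _ _ := by
    refine ⟨by fun_prop, ae_of_all _ fun _ => ⟨by simpa using hψ2, hψs⟩, ?_⟩
    rw [lintegral_const, Measure.restrict_univ, Measure.restrict_apply_univ, Real.volume_Ioc]
    exact ENNReal.mul_lt_top (ENNReal.add_lt_top.2 ⟨ENNReal.pow_lt_top hψ2.2, hψs⟩)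
      ENNReal.ofReal_lt_top
  zero_trace := ae_of_all _ fun _ => ⟨⟨by simpa using hψ2, hψs⟩, hψU⟩
  eq_zero x hx _ _ := hψU x hx
  memW :=
    { memLp := fun a b _ _ _ => by
        rw [Measure.volume_eq_prod, ← Measure.prod_restrict]
        have : IsFiniteMeasure (volume.restrict (Ioc a b)) :=
          ⟨by rw [Measure.restrict_apply_univ]; exact measure_Ioc_lt_top⟩
        exact (hψq.restrict U).comp_fst _
      memLp_deriv := fun a b _ _ _ => MemLp.zero
      weak_deriv := fun χ hχ _ hs => ae_of_all _ fun x => by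
        -- The weak derivative identity reduces to `χ T - χ 0 = 0`, which holds because the support
        -- of `χ` lies in the open interval.
        have h0 : χ 0 = 0 := image_eq_zero_of_notMem_tsupport fun h => lt_irrefl _ (hs h).1
        have hT : χ T = 0 := image_eq_zero_of_notMem_tsupport fun h => lt_irrefl _ (hs h).2
        rw [intervalIntegral.integral_const_mul, intervalIntegral.integral_deriv_eq_sub'
          χ rfl (fun x _ => (hχ.differentiable (by simp)).differentiableAt)
          (hχ.continuous_deriv (by simp)).continuousOn, h0, hT]
        simp
      continuous := ⟨fun _ _ => hψq.restrict U, fun _ _ => by simpa using tendsto_const_nhds⟩ }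

section

variable {N : ℕ} {s q T L : ℝ} {Ω : Set (RN N)} {K : RN N → RN N → ℝ → ℝ} {u : RN N → ℝ → ℝ}

/-- Clamp a measurable representative between the two bounds. Off the diagonal the bounds already
hold for `K`, so clamping changes nothing almost everywhere there, and the new kernel satisfies them
everywhere. -/
lemma IsKernel.exists_measurable (hL : 1 ≤ L) (hK : IsKernel s T L K) :
    ∃ κ : RN N → RN N → ℝ → ℝ, Measurable (fun z : (RN N × RN N) × ℝ => κ z.1.1 z.1.2 z.2) ∧
      (∀ x y t, L⁻¹ * wt s x y ≤ κ x y t) ∧ (∀ x y t, κ x y t ≤ L * wt s x y) ∧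
      ∀ᵐ t ∂(volume.restrict (Ioc 0 T)), ∀ᵐ z : RN N × RN N,
        z.1 ≠ z.2 → K z.1 z.2 t = κ z.1 z.2 t := by
  have hwt := measurable_wt (N := N) s
  set k := hK.measurable.mk _ with hk
  have hkm : Measurable k := hK.measurable.measurable_mk
  have hLL : L⁻¹ ≤ L := (inv_le_one_of_one_le₀ hL).trans hL
  refine ⟨fun x y t => max (L⁻¹ * wt s x y) (min (k ((x, y), t)) (L * wt s x y)), by fun_prop,
    fun x y t => le_max_left _ _, fun x y t => max_le
      (mul_le_mul_of_nonneg_right hLL (wt_nonneg s x y)) (min_le_right _ _), ?_⟩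
  have h := ae_ae_swap_of_ae_restrict (p := fun (z : RN N × RN N) t => K z.1 z.2 t = k (z, t))
    hK.measurable.ae_eq_mk
  filter_upwards [h, ae_restrict_mem measurableSet_Ioc] with t ht htT
  filter_upwards [ht] with z hz hne
  have h1 := hK.lower z.1 z.2 hne t htT
  have h2 := hK.upper z.1 z.2 hne t htT
  rw [div_eq_mul_inv] at h1 h2
  rw [hz] at h1 h2 ⊢
  exact (min_eq_left h2).symm.trans (max_eq_right (h1.trans_eq (min_eq_left h2).symm)).symm

lemma exists_measurable_nonneg (hu : AEMeasurable (fun z : RN N × ℝ => u z.1 z.2)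
      (volume.restrict (univ ×ˢ Ioc 0 T)))
    (hu0 : ∀ᵐ z : RN N × ℝ ∂(volume.restrict (univ ×ˢ Ioc 0 T)), 0 ≤ u z.1 z.2) :
    ∃ v : RN N → ℝ → ℝ, Measurable (fun z : RN N × ℝ => v z.1 z.2) ∧ (∀ x t, 0 ≤ v x t) ∧
      ∀ᵐ z : RN N × ℝ ∂(volume.restrict (univ ×ˢ Ioc 0 T)), u z.1 z.2 = v z.1 z.2 := by
  have hm := hu.measurable_mk
  refine ⟨fun x t => max (hu.mk _ (x, t)) 0, by fun_prop, fun x t => le_max_right _ _, ?_⟩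
  filter_upwards [hu.ae_eq_mk, hu0] with z h1 h2
  rw [h1] at h2 ⊢
  exact (max_eq_left h2).symm

variable {x₀ : RN N} {ρ d a b : ℝ} {v : RN N → ℝ → ℝ} {κ : RN N → RN N → ℝ → ℝ}

lemma abs_rpow_mul_self (hq : 0 < q) {α : ℝ} (hα : 0 ≤ α) : |α| ^ (q - 1) * α = α ^ q := by
  rcases hα.eq_or_lt with h | h
  · rw [← h, Real.zero_rpow hq.ne', mul_zero]
  · rw [abs_of_pos h, ← Real.rpow_add_one h.ne', sub_add_cancel]

/-- A nonnegative weak sub-solution yields the cylinder inequalities on interior cylinders. -/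
theorem IsLocalWeakSubsolution.cylinderSub (hu : IsLocalWeakSubsolution s q T Ω K u) (hq : 1 < q)
    (hvm : Measurable fun z : RN N × ℝ => v z.1 z.2) (hv0 : ∀ x t, 0 ≤ v x t)
    (huv : ∀ᵐ z : RN N × ℝ ∂(volume.restrict (univ ×ˢ Ioc 0 T)), u z.1 z.2 = v z.1 z.2)
    (hκm : Measurable fun z : (RN N × RN N) × ℝ => κ z.1.1 z.1.2 z.2)
    (hκl : ∀ x y t, L⁻¹ * wt s x y ≤ κ x y t) (hκu : ∀ x y t, κ x y t ≤ L * wt s x y)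
    (hκ : ∀ᵐ t ∂(volume.restrict (Ioc 0 T)), ∀ᵐ z : RN N × RN N,
        z.1 ≠ z.2 → K z.1 z.2 t = κ z.1 z.2 t)
    (hB : CompactlyInside (Metric.ball x₀ (ρ + d)) Ω) (ha : 0 < a) (hab : a < b) (hbT : b ≤ T) :
    CylinderSub s q L x₀ ρ d a b v κ := by
  set B := Metric.ball x₀ (ρ + d) with hBdef
  have hq0 : 0 < q := by linarith
  have hBo : IsOpen B := Metric.isOpen_ball
  have hBfin : volume B < ⊤ := measure_ball_lt_top
  have hfact : Fact (1 ≤ ENNReal.ofReal (q + 1)) :=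
    ⟨by simpa using ENNReal.ofReal_le_ofReal (show 1 ≤ q + 1 by linarith)⟩
  have hIT : Ioc a b ⊆ Ioc 0 T := Ioc_subset_Ioc ha.le hbT
  have hJ : Icc a b ⊆ Ioc 0 T := fun t ht => ⟨by linarith [ht.1], by linarith [ht.2]⟩
  have huvT : ∀ᵐ t ∂(volume.restrict (Ioc a b)), ∀ᵐ x : RN N, u x t = v x t :=
    ae_restrict_of_ae_restrict_of_subset hIT (ae_ae_swap_of_ae_restrict huv)
  have hκT := ae_restrict_of_ae_restrict_of_subset hIT hκ
  have hcont := hu.continuous B hBo hB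
  obtain ⟨M, hM0, hM⟩ := hcont.exists_bound isCompact_Icc hJ
  have hpow : ∀ t ∈ Ioc a b, (∀ᵐ x : RN N, u x t = v x t) →
      ∫⁻ x in B, ENNReal.ofReal (v x t ^ (q + 1)) ≤ ENNReal.ofReal (M ^ (q + 1)) := by
    intro t htI ht
    rw [lintegral_rpow_eq_eLpNorm (ae_of_all _ fun x => hv0 x t) (by linarith),
      ← ENNReal.ofReal_rpow_of_nonneg hM0 (by linarith)]
    refine ENNReal.rpow_le_rpow ?_ (by linarith)
    rw [← eLpNorm_congr_ae (ae_restrict_of_ae ht)]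
    exact hM t ⟨htI.1.le, htI.2⟩
  refine ⟨hvm, hv0, hκm, hκl, hκu, ?_, ⟨M ^ (q + 1), ?_⟩, ?_, ?_, ?_⟩
  · refine lt_of_le_of_lt (lintegral_mono_ae ?_) (hu.memL2 B hBo hB a b ha hab hbT).2.2
    filter_upwards [huvT] with t ht
    rw [← gagliardoSq_congr ht]
    exact le_add_self
  · filter_upwards [huvT, ae_restrict_mem measurableSet_Ioc] with t ht htI using hpow t htI ht
  · intro ε hε
    -- This is the Hölder constant from `L^(q+1)` to `L¹` on the ball. Together with uniform
    -- continuity on the compact interval `[a, b]` it gives the `L¹` closeness of slices.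
    set V : ℝ := (volume B ^ (1 - 1 / (q + 1))).toReal with hV
    have hVt : volume B ^ (1 - 1 / (q + 1)) ≠ ⊤ :=
      ENNReal.rpow_ne_top_of_nonneg (by
        rw [sub_nonneg, div_le_one (by linarith)]; linarith) hBfin.ne
    have hV0 : 0 ≤ V := ENNReal.toReal_nonneg
    obtain ⟨δ, hδ, hunif⟩ := hcont.uniform isCompact_Icc hJ (show 0 < ε / (V + 1) by positivity)
    refine ⟨δ, hδ, fun h h0 hh => ?_⟩
    filter_upwards [ae_shift h0 huvT, ae_restrict_mem measurableSet_Ioc] with t ht htI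
    have h1 := hunif t ⟨by linarith [htI.1], htI.2⟩ (t - h) ⟨by linarith [htI.1], by linarith [htI.2]⟩
      (by rw [sub_sub_cancel, abs_of_pos h0]; exact hh)
    have e : eLpNorm (fun x => u x t - u x (t - h)) (ENNReal.ofReal (q + 1)) (volume.restrict B)
        = eLpNorm (fun x => v x t - v x (t - h)) (ENNReal.ofReal (q + 1)) (volume.restrict B) := by
      refine eLpNorm_congr_ae (ae_restrict_of_ae ?_)
      filter_upwards [ht.1, ht.2] with x h2 h3
      rw [h2, h3]
    rw [e] at h1
    have h2 := eLpNorm_le_eLpNorm_mul_rpow_measure_univ (μ := volume.restrict B) hfact.out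
      (f := fun x => v x t - v x (t - h)) (by fun_prop)
    rw [eLpNorm_one_eq_lintegral_enorm, Measure.restrict_apply_univ, ENNReal.toReal_one, div_one,
      ENNReal.toReal_ofReal (by linarith)] at h2
    simp only [← Real.enorm_eq_ofReal_abs]
    calc _ ≤ _ := h2
      _ ≤ ENNReal.ofReal (ε / (V + 1)) * ENNReal.ofReal V := by
          rw [hV, ENNReal.ofReal_toReal hVt]; gcongr
      _ ≤ ENNReal.ofReal ε := by
          rw [← ENNReal.ofReal_mul (by positivity)]
          refine ENNReal.ofReal_le_ofReal ?_
          rw [div_mul_eq_mul_div, div_le_iff₀ (by linarith)]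
          nlinarith
  · refine lt_of_le_of_lt (lintegral_mono_ae ?_) (hu.tail a b ha hab hbT)
    filter_upwards [huvT] with t ht
    refine lintegral_mono_ae ?_
    filter_upwards [ht] with x hx
    rw [hx, abs_of_nonneg (hv0 x t), tailWeight, mul_one_div]
  · intro h h0
    filter_upwards [ae_shift h0 huvT, ae_restrict_mem measurableSet_Ioc] with t ht htI
    intro ψ hψm hψ0 hψB hψq hψ2 hψs
    have hmain := hu.ineq (t - h) t (by linarith [htI.1]) (by linarith) (by linarith [htI.2]) B hBo hB
      (fun x _ => ψ x) (fun _ _ => 0) (isTestFunction_const hψm hψ0 hψB hψq hψ2 hψs)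
    have hvq : ∀ t', t' ∈ Ioc a b → (∀ᵐ x : RN N, u x t' = v x t') →
        Integrable (fun x => v x t' ^ q * ψ x) (volume.restrict B) := by
      intro t' ht'I ht'
      have i1 : Integrable (fun x => v x t' ^ (q + 1)) (volume.restrict B) := by
        refine ⟨(Measurable.pow_const (by fun_prop) _).aestronglyMeasurable, ?_⟩
        rw [hasFiniteIntegral_iff_ofReal (ae_of_all _ fun x => Real.rpow_nonneg (hv0 x t') _)]
        exact (hpow t' ht'I ht').trans_lt ENNReal.ofReal_lt_top
      have i2 : Integrable (fun x => ψ x ^ (q + 1)) (volume.restrict B) := by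
        refine ⟨(Measurable.pow_const (by fun_prop) _).aestronglyMeasurable, ?_⟩
        rw [hasFiniteIntegral_iff_ofReal (ae_of_all _ fun x => Real.rpow_nonneg (hψ0 x) _),
          lintegral_rpow_eq_eLpNorm (ae_of_all _ hψ0) (by linarith)]
        exact ENNReal.rpow_lt_top_of_nonneg (by linarith) (hψq.restrict B).2.ne
      refine (i1.add i2).mono' (by fun_prop) (ae_of_all _ fun x => ?_)
      rw [Real.norm_of_nonneg (mul_nonneg (Real.rpow_nonneg (hv0 x t') _) (hψ0 x))]
      exact rpow_mul_le_add (hv0 x t') (hψ0 x) hq0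
    have hslice : ∀ t', (∀ᵐ x : RN N, u x t' = v x t') →
        ∫ x in B, |u x t'| ^ (q - 1) * u x t' * ψ x = ∫ x in B, v x t' ^ q * ψ x := by
      intro t' ht'
      refine integral_congr_ae ?_
      filter_upwards [ae_restrict_of_ae ht'] with x hx
      rw [hx, abs_rpow_mul_self hq0 (hv0 x t')]
    have htI' : t ∈ Ioc a b := ⟨by linarith [htI.1], htI.2⟩
    have htI'' : t - h ∈ Ioc a b := ⟨by linarith [htI.1], by linarith [htI.2]⟩
    rw [hslice t ht.1, hslice (t - h) ht.2,
      ← integral_sub (hvq t htI' ht.1) (hvq (t - h) htI'' ht.2),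
      intervalIntegral.integral_of_le (by linarith), intervalIntegral.integral_of_le (by linarith)]
      at hmain
    simp only [mul_zero, integral_zero, sub_zero, ← sub_mul] at hmain
    have e : ∫ τ in Ioc (t - h) t, ∫ z : RN N × RN N,
          (u z.1 τ - u z.2 τ) * (ψ z.1 - ψ z.2) * K z.1 z.2 τ
        = ∫ τ in Ioc (t - h) t, ∫ z : RN N × RN N,
          (v z.1 τ - v z.2 τ) * (ψ z.1 - ψ z.2) * κ z.1 z.2 τ := by
      have hsub : Ioc (t - h) t ⊆ Ioc a b := Ioc_subset_Ioc htI''.1.le htI.2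
      refine integral_congr_ae ?_
      filter_upwards [ae_restrict_of_ae_restrict_of_subset hsub huvT,
        ae_restrict_of_ae_restrict_of_subset hsub hκT] with τ h1 h2
      refine integral_congr_ae ?_
      have h3 : ∀ᵐ z : RN N × RN N, u z.1 τ = v z.1 τ :=
        Measure.quasiMeasurePreserving_fst.ae h1
      have h4 : ∀ᵐ z : RN N × RN N, u z.2 τ = v z.2 τ :=
        Measure.quasiMeasurePreserving_snd.ae h1
      filter_upwards [h2, h3, h4] with z h2 h3 h4
      rw [h3, h4]
      -- On the diagonal the two kernels need not agree, but the integrand vanishes there.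
      by_cases hz : z.1 = z.2
      · simp [hz]
      · rw [h2 hz]
    rwa [e] at hmain

end

/-- Induction on compact sets. Intersecting with `(0, T]` lets the neighbourhoods extend beyond the
final time, which is needed at points with `t = T`. -/
lemma locallyBounded_of_nhds {N : ℕ} {T : ℝ} {Ω : Set (RN N)} {u : RN N → ℝ → ℝ}
    (h : ∀ z ∈ Ω ×ˢ Ioc 0 T, ∃ W ∈ 𝓝 z, ∃ M : ℝ,
      ∀ᵐ z ∂(volume.restrict (W ∩ univ ×ˢ Ioc 0 T)), |u z.1 z.2| ≤ M) :
    LocallyBounded T Ω u := by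
  intro C hC hCΩ
  have key : ∃ M : ℝ, ∀ᵐ z ∂(volume.restrict (C ∩ univ ×ˢ Ioc 0 T)), |u z.1 z.2| ≤ M := by
    refine hC.induction_on (p := fun S => ∃ M : ℝ,
      ∀ᵐ z ∂(volume.restrict (S ∩ univ ×ˢ Ioc 0 T)), |u z.1 z.2| ≤ M) ⟨0, by simp⟩ ?_ ?_ ?_
    · rintro S S' hS ⟨M, hM⟩
      exact ⟨M, ae_restrict_of_ae_restrict_of_subset (inter_subset_inter_left _ hS) hM⟩
    · rintro S S' ⟨M, hM⟩ ⟨M', hM'⟩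
      refine ⟨max M M', ?_⟩
      rw [union_inter_distrib_right, ae_restrict_union_iff]
      exact ⟨hM.mono fun z hz => hz.trans (le_max_left _ _),
        hM'.mono fun z hz => hz.trans (le_max_right _ _)⟩
    · intro z hz
      obtain ⟨W, hW, hM⟩ := h z (hCΩ hz)
      exact ⟨W, mem_nhdsWithin_of_mem_nhds hW, hM⟩
  rwa [inter_eq_left.2 (hCΩ.trans (prod_mono (subset_univ Ω) le_rfl))] at key

end FracPME

theorem theorem1p1 (N : ℕ) (hN : 2 ≤ N) (s q T L : ℝ) (hs0 : 0 < s) (hs1 : s < 1)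
    (hq : 1 < q) (hT : 0 < T) (hL : 1 ≤ L)
    (Ω : Set (FracPME.RN N)) (hΩ : IsOpen Ω) (hΩb : Bornology.IsBounded Ω)
    (K : FracPME.RN N → FracPME.RN N → ℝ → ℝ) (hK : FracPME.IsKernel s T L K)
    (u : FracPME.RN N → ℝ → ℝ) (hu : FracPME.IsLocalWeakSubsolution s q T Ω K u)
    (hu0 : ∀ᵐ z : FracPME.RN N × ℝ ∂(volume.restrict (univ ×ˢ Ioc 0 T)), 0 ≤ u z.1 z.2)
    (hqc : q ≤ ((N : ℝ) + 2 * s) / ((N : ℝ) - 2 * s)) :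
    FracPME.LocallyBounded T Ω u := by
  have hN2 : (2 : ℝ) ≤ N := by exact_mod_cast hN
  have hL0 : 0 < L := by linarith
  -- Since `N - 2s > 0`, the bound on `q` reads `q (N - 2s) ≤ N + 2s`, and rearranging it gives this
  -- form.
  have hqp : q + 1 ≤ 2 + 2 * s * (q + 1) / N := by
    rw [le_div_iff₀ (by linarith)] at hqc
    rw [← sub_le_iff_le_add', le_div_iff₀ (by linarith)]
    linarith
  obtain ⟨v, hvm, hv0, huv⟩ := FracPME.exists_measurable_nonneg hu.measurable hu0
  obtain ⟨κ, hκm, hκl, hκu, hκ⟩ := hK.exists_measurable hL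
  refine FracPME.locallyBounded_of_nhds ?_
  rintro ⟨x₀, t₀⟩ ⟨hx₀, ht₀, ht₀T⟩
  obtain ⟨ε, hε, hεΩ⟩ := Metric.isOpen_iff.1 hΩ x₀ hx₀
  -- With `d = ρ` the outer radius is `2ρ ≤ ε/2`, so its closed ball stays inside `Ω`. The cap at
  -- one meets the requirements `ρ ≤ 1` and `d ≤ 1`.
  set ρ : ℝ := min (ε / 4) 1 with hρdef
  have hρ : 0 < ρ := lt_min (by linarith) one_pos
  have hρ1 : ρ ≤ 1 := min_le_right _ _
  have hρε : ρ ≤ ε / 4 := min_le_left _ _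
  have hcl : closure (Metric.ball x₀ (ρ + ρ)) ⊆ Metric.closedBall x₀ (ρ + ρ) :=
    Metric.closure_ball_subset_closedBall
  have hB : FracPME.CompactlyInside (Metric.ball x₀ (ρ + ρ)) Ω :=
    ⟨(isCompact_closedBall x₀ (ρ + ρ)).of_isClosed_subset isClosed_closure hcl,
      hcl.trans ((Metric.closedBall_subset_ball (by linarith)).trans hεΩ)⟩
  set b : ℝ := min T (3 / 2 * t₀) with hbdef
  have hbT : b ≤ T := min_le_left _ _
  have hbt : b ≤ 3 / 2 * t₀ := min_le_right _ _
  have htb : t₀ ≤ b := le_min ht₀T (by linarith)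
  -- With `a = t₀/3` and `b ≤ 3t₀/2`, the midpoint `(a + b)/2` is at most `11 t₀ / 12 < t₀`. Hence
  -- `t₀` lies in the later half of the cylinder, where the bound holds.
  have hS := hu.cylinderSub hq hvm hv0 huv hκm hκl hκu hκ hB (a := t₀ / 3) (by linarith)
    (by linarith) hbT
  obtain ⟨c, hc, hfar⟩ := FracPME.wt_le_of_far (R := ρ) hs0 hρ x₀
  obtain ⟨M, hM⟩ := hS.bounded (by omega) (by linarith) hq.le hs0 hs1 hqp hL0 hρ hρ1 hρ hρ1
    (mul_pos hL0 hc) fun x hx y hy => by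
      have h := mul_le_mul_of_nonneg_left (hfar x hx y hy) hL0.le
      rwa [FracPME.tailWeight, mul_one_div, mul_div_assoc]
  refine ⟨Metric.ball x₀ (ρ / 2) ×ˢ Ioo (11 / 12 * t₀) (3 / 2 * t₀),
    prod_mem_nhds (Metric.ball_mem_nhds x₀ (by linarith))
      (Ioo_mem_nhds (by linarith) (by linarith)), M, ?_⟩
  have hsub : Metric.ball x₀ (ρ / 2) ×ˢ Ioo (11 / 12 * t₀) (3 / 2 * t₀) ∩ univ ×ˢ Ioc 0 T
      ⊆ Metric.ball x₀ (ρ / 2) ×ˢ Ioc ((t₀ / 3 + b) / 2) b := by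
    rintro z ⟨⟨h1, h2, h3⟩, -, -, h4⟩
    exact ⟨h1, by linarith, le_min h4 h3.le⟩
  filter_upwards [ae_restrict_of_ae_restrict_of_subset hsub hM,
    ae_restrict_of_ae_restrict_of_subset inter_subset_right huv] with z h1 h2
  rw [h2, abs_of_nonneg (hv0 z.1 z.2)]
  exact h1
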